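/- **Conventions.** $\mathrm{Spin}_+(1,3)\subset C\ell^+_{1,3}$ is the group of products of an even number of invertible vectors $x$ with $x\tilde x=1$. Let $\mathbb C_2$ be the complex Clifford algebra with two generators, acting on $\mathbb S_2=\mathbb C^2$ by the Pauli matrices, and let $\overset{*}{\mathbb C}_2$, $\dot{\mathbb S}_2$ be the complex conjugate algebra and space. The isomorphism $C\ell^+_{1,3}\simeq\mathbb C_2$, $vw\mapsto (v_0+\mathbf v\cdot\sigma)(w_0-\mathbf w\cdot\sigma)$, gives $\sigma:\mathrm{Spin}_+(1,3)\to\mathbb C_2$ and $\bar\sigma:\mathrm{Spin}_+(1,3)\to\overset{*}{\mathbb C}_2$. The group acts on $\mathbb S_{2^k}=\mathbb S_2^{\otimes k}$ through $\sigma(g)^{\otimes k}\in\mathbb C_2^{\otimes k}$ and on $\dot{\mathbb S}_{2^r}=\dot{\mathbb S}_2^{\otimes r}$ through $\bar\sigma(g)^{\otimes r}\in\overset{*}{\mathbb C}{}_2^{\otimes r}$. $\mathsf A_i,\mathsf B_i$ are the infinitesimal operators of the rotations $\cos\frac t2+\sin\frac t2\,e_{i+1}e_{i+2}$ and hyperbolic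 rotations $\cosh\frac t2+\sinh\frac t2\,e_0e_i$. A representation has weight $(l,\dot l)$ if $\mathsf X_j=\frac i2(\mathsf A_j+i\mathsf B_j)$, $\mathsf Y_j=\frac i2(\mathsf A_j-i\mathsf B_j)$ act in a basis $|l,m;\dot l,\dot m\rangle$ ($-l\le m\le l$, $-\dot l\le\dot m\le\dot l$) by the standard formulas for spins $l$ and $\dot l$. It has the pair $(l_0,l_1)$ if it has a basis $\xi_{k\nu}$ ($k=|l_0|,|l_0|+1,\dots,|l_1|-1$; $\nu=-k,\dots,k$) in which $H_3=i\mathsf A_3$, $H_\pm=i\mathsf A_1\mp\mathsf A_2$, $F_3=i\mathsf B_3$, $F_\pm=i\mathsf B_1\mp\mathsf B_2$ act by the Gel'fand–Naimark formulas $$H_3\xi_{k\nu}=\nu\xi_{k\nu},\quad H_\pm\xi_{k\nu}=\sqrt{(k\pm\nu+1)(k\mp\nu)}\,\xi_{k,\nu\pm1},$$ $$F_3\xi_{k\nu}=C_k\sqrt{k^2-\nu^2}\,\xi_{k-1,\nu}-A_k\nu\,\xi_{k\nu}-C_{k+1}\sqrt{(k+1)^2-\nu^2}\,\xi_{k+1,\nu},$$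 $$F_\pm\xi_{k\nu}=\pm C_k\sqrt{(k\mp\nu)(k\mp\nu-1)}\,\xi_{k-1,\nu\pm1}-A_k\sqrt{(k\mp\nu)(k\pm\nu+1)}\,\xi_{k,\nu\pm1}\pm C_{k+1}\sqrt{(k\pm\nu+1)(k\pm\nu+2)}\,\xi_{k+1,\nu\pm1},$$ $$A_k=\frac{il_0l_1}{k(k+1)},\qquad C_k=\frac ik\sqrt{\frac{(k^2-l_0^2)(k^2-l_1^2)}{4k^2-1}}.$$ A *field of type* $(l,\dot l)$ with pair $(l_0,l_1)$ is an irreducible representation of weight $(l,\dot l)$ with that pair. $C\ell_{p,q}$ is the real Clifford algebra of the quadratic form $x_1^2+\dots+x_p^2-x_{p+1}^2-\dots-x_{p+q}^2$. **Theorem.** *Complex representations.* Let $k,r\ge0$. (1) $\mathbb C_2^{\otimes k}=\mathrm{End}\,\mathbb S_{2^k}$ and $\overset{*}{\mathbb C}{}_2^{\otimes r}=\mathrm{End}\,\dot{\mathbb S}_{2^r}$. The group acts on the spinspace $\mathbb S_{2^k}\oplus\dot{\mathbb S}_{2^r}$ through the algebra $\mathbb C_2^{\otimes k}\oplus\overset{*}{\mathbb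 C}{}_2^{\otimes r}$, and the symmetric spintensors in the two summands form an invariant subspace carrying a field of type $(l,0)\oplus(0,\dot l)$, $l=\frac k2$, $\dot l=\frac r2$, with pairs $\left(\frac k2,\frac k2+1\right)$ and $\left(-\frac r2,\frac r2+1\right)$. The exponents $(l_0+l_1-1,\,l_0-l_1+1)$ of these pairs are $(k,0)$ and $(0,-r)$. (2) $\mathbb C_2^{\otimes k}\otimes\overset{*}{\mathbb C}{}_2^{\otimes r}=\mathrm{End}(\mathbb S_{2^k}\otimes\dot{\mathbb S}_{2^r})$ and $\overset{*}{\mathbb C}{}_2^{\otimes k}\otimes\mathbb C_2^{\otimes r}=\mathrm{End}(\dot{\mathbb S}_{2^k}\otimes\mathbb S_{2^r})$. The group acts on the sum $\mathbb S_{2^{k+r}}\oplus\mathbb S_{2^{k+r}}$ of these two spinspaces through the sum of the two algebras, and the spintensors that are symmetric in the first $k$ and in the last $r$ indices form an invariant subspace carrying a field of type $(l',l'')\oplus(\dot l'',\dot l')$, $l'=\dot l'=\frac k2$, $l''=\dot l''=\frac r2$, with pairs $(l_0,l_1)=\left(\frac{k-r}2,\frac{k+r}2+1\right)$ and the conjugate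 pair $(-l_0,l_1)$. Their exponents are $(k,-r)$ and $(r,-k)$. *Real representations.* The algebras $C\ell_{p,q}$ fall into two families. (3) ($\mathfrak M^+=\{\mathfrak R_0,\mathfrak R_2,\mathfrak H_4,\mathfrak H_6\}$.) Let $p+q=2r$; then $p-q\equiv0,2,4$ or $6\pmod 8$. There are an isomorphism $C\ell_{p,q}\simeq C\ell_{s_1,t_1}\otimes_{\mathbb R}\dots\otimes_{\mathbb R}C\ell_{s_r,t_r}$ with $s_i+t_i=2$ (so $s_i,t_i\in\{0,1,2\}$) and embeddings $C\ell_{s_i,t_i}\subset\mathbb C_2$ with $\mathbb C_2=\mathbb C\otimes C\ell_{s_i,t_i}$, whose tensor product makes $C\ell_{p,q}$ a real subalgebra of $\mathbb C_2^{\otimes r}$ with $\mathbb C_2^{\otimes r}=\mathbb C\otimes C\ell_{p,q}$. If $p-q\equiv0,2$, then $C\ell_{p,q}\simeq \mathrm{Mat}_{2^r}(\mathbb R)$, and $\mathbb S_{2^r}$ has a real structure (an antilinear $J$ with $J^2=1$) commuting with $C\ell_{p,q}$; if $p-q\equiv4,6$, then $C\ell_{p,q}\simeq \mathrm{Mat}_{2^{r-1}}(\mathbb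 H)$, and $\mathbb S_{2^r}$ has a quaternionic structure ($J^2=-1$) commuting with $C\ell_{p,q}$. The group $\mathrm{Spin}_+(1,3)$ acts on $\mathbb S_{2^r}$ through $\mathbb C\otimes C\ell_{p,q}=\mathbb C_2^{\otimes r}$, and the symmetric spintensors form an invariant subspace carrying the field of type $(l_0,0)$ with pair $(l_0,l_0+1)$, where $l_0=\frac r2=\frac{p+q}4$. (4) ($\mathfrak M^-=\{\mathfrak C_{3,7},\ \mathfrak R_{0,2}\cup\mathfrak R_{0,2},\ \mathfrak H_{4,6}\cup\mathfrak H_{4,6}\}$.) Let $p+q=2r+1$; then $p-q\equiv1,3,5$ or $7\pmod 8$. The volume element $\omega$ is central, and there are $B=C\ell_{s_1,t_1}\otimes_{\mathbb R}\dots\otimes_{\mathbb R} C\ell_{s_r,t_r}$ as in (3), embedded in $C\ell_{p,q}$, with $C\ell_{p,q}=B\oplus\omega B$, and an embedding $C\ell_{p,q}\subset\mathbb C_2^{\otimes r}\oplus\overset{*}{\mathbb C}{}_2^{\otimes r}$ for which the right-hand side is $\mathbb C\otimes C\ell_{p,q}$ and $b=x_1\otimes\dots\otimes x_r\in B$ goes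 to $(x_1\otimes\dots\otimes x_r,\ x_1\otimes\dots\otimes x_r)$, such that: * if $p-q\equiv1,5$: $\omega^2=1$, $\omega\mapsto(1,-1)$ and $C\ell_{p,q}\simeq B\oplus B$; moreover $C\ell_{p,q}\simeq C\ell_{p,q-1}\oplus C\ell_{p,q-1}$ if $q\ge1$, and $C\ell_{p,q}\simeq C\ell_{q,p-1}\oplus C\ell_{q,p-1}$ if $p\ge1$. For $p-q\equiv1$, $C\ell_{p,q}\simeq \mathrm{Mat}_{2^r}(\mathbb R)\oplus \mathrm{Mat}_{2^r}(\mathbb R)$ and the double spinspace $\mathbb S_{2^r}\oplus\dot{\mathbb S}_{2^r}$ has a real structure commuting with $C\ell_{p,q}$; for $p-q\equiv5$, $C\ell_{p,q}\simeq \mathrm{Mat}_{2^{r-1}}(\mathbb H)\oplus \mathrm{Mat}_{2^{r-1}}(\mathbb H)$ and it has a quaternionic structure commuting with $C\ell_{p,q}$; * if $p-q\equiv3,7$: $\omega^2=-1$, $\omega\mapsto(i,-i)$, the projection $C\ell_{p,q}\to\mathbb C_2^{\otimes r}$ is bijective, $C\ell_{p,q}\simeq \mathrm{Mat}_{2^r}(\mathbb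 C)$, and $g\mapsto(\sigma(g)^{\otimes r},\bar\sigma(g)^{\otimes r})$ takes its values in $C\ell_{p,q}$. The group acts on the double spinspace $\mathbb S_{2^r}\oplus\dot{\mathbb S}_{2^r}$ through $\mathbb C\otimes C\ell_{p,q}$, and the symmetric spintensors in the two summands form an invariant subspace carrying the field of type $(l_0,0)\oplus(0,l_0)$ with pairs $(l_0,l_0+1)$ and $(-l_0,l_0+1)$, where $l_0=\frac r2=\frac{p+q-1}4$. -/

import Mathlib

open scoped TensorProduct Quaternion

noncomputable section

namespace SpinField

/-! ### Real and complex Clifford algebras -/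

/-- The form `x₁² + ⋯ + x_p² - x_{p+1}² - ⋯ - x_{p+q}²`. -/
def realForm (p q : ℕ) : QuadraticForm ℝ (Fin p ⊕ Fin q → ℝ) :=
  QuadraticMap.weightedSumSquares ℝ (Sum.elim (fun _ => (1 : ℝ)) (fun _ => (-1 : ℝ)))

/-- The real Clifford algebra `Cl_{p,q}`. -/
abbrev Cl (p q : ℕ) : Type := CliffordAlgebra (realForm p q)

/-- The generators of `Cl_{p,q}` with square `+1`. -/
def ePos (p q : ℕ) (i : Fin p) : Cl p q :=
  CliffordAlgebra.ι (realForm p q) (Pi.single (Sum.inl i) 1)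

/-- The generators of `Cl_{p,q}` with square `-1`. -/
def eNeg (p q : ℕ) (i : Fin q) : Cl p q :=
  CliffordAlgebra.ι (realForm p q) (Pi.single (Sum.inr i) 1)

/-- The volume element `ω = e₁ e₂ ⋯ e_{p+q}`. -/
def vol (p q : ℕ) : Cl p q :=
  (List.ofFn (ePos p q)).prod * (List.ofFn (eNeg p q)).prod

/-- The form `z₁² + z₂²` on `ℂ²`. -/
def pauliForm : QuadraticForm ℂ (Fin 2 → ℂ) :=
  QuadraticMap.weightedSumSquares ℂ (fun _ => (1 : ℂ))

/-- The Pauli algebra `ℂ_2`: the complex Clifford algebra with two generators. -/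
def C2 : Type := CliffordAlgebra pauliForm

instance : Ring C2 := inferInstanceAs (Ring (CliffordAlgebra pauliForm))

instance : Algebra ℂ C2 := inferInstanceAs (Algebra ℂ (CliffordAlgebra pauliForm))

/-- The inclusion of the vectors `ℂ²` into `ℂ_2`. -/
def ι2 : (Fin 2 → ℂ) →ₗ[ℂ] C2 := CliffordAlgebra.ι pauliForm

theorem ι2_sq (z : Fin 2 → ℂ) : ι2 z * ι2 z = algebraMap ℂ C2 (pauliForm z) :=
  CliffordAlgebra.ι_sq_scalar pauliForm z

/-- The spinspace `S_2`. -/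
abbrev S2 : Type := Fin 2 → ℂ

/-! ### Complex conjugate spaces and algebras -/

/-- The complex conjugate of a complex vector space: the same additive group, on which the
scalar `c` acts as the old `conj c`. -/
def ConjMod (V : Type) : Type := V

instance (V : Type) [AddCommGroup V] : AddCommGroup (ConjMod V) := inferInstanceAs (AddCommGroup V)

instance (V : Type) [AddCommGroup V] [Module ℂ V] : Module ℂ (ConjMod V) :=
  Module.compHom V (starRingEnd ℂ)

/-- The identity map `V → ConjMod V`, as an additive isomorphism. -/
def conjMod (V : Type) [AddCommGroup V] : V ≃+ ConjMod V := AddEquiv.refl V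

theorem smul_conjMod (V : Type) [AddCommGroup V] [Module ℂ V] (c : ℂ) (v : V) :
    c • conjMod V v = conjMod V (starRingEnd ℂ c • v) := rfl

/-- The complex conjugate of a complex algebra: the same ring, on which the scalar `c` acts as
the old `conj c`. -/
def ConjAlg (A : Type) : Type := A

instance (A : Type) [Ring A] : Ring (ConjAlg A) := inferInstanceAs (Ring A)

instance (A : Type) [Ring A] [Algebra ℂ A] : Algebra ℂ (ConjAlg A) :=
  Algebra.compHom A (starRingEnd ℂ)

/-- The identity map `A → ConjAlg A`, as an isomorphism of rings. -/
def conjAlg (A : Type) [Ring A] : A ≃+* ConjAlg A := RingEquiv.refl A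

theorem smul_conjAlg (A : Type) [Ring A] [Algebra ℂ A] (c : ℂ) (a : A) :
    c • conjAlg A a = conjAlg A (starRingEnd ℂ c • a) :=
  rfl

/-- The action of the conjugate algebra on the conjugate space induced by an action of `A` on
`V`. -/
def conjAction {A V : Type} [Ring A] [Algebra ℂ A] [AddCommGroup V] [Module ℂ V]
    (γ : A →ₐ[ℂ] Module.End ℂ V) : ConjAlg A →ₐ[ℂ] Module.End ℂ (ConjMod V) where
  toFun a :=
    { toFun := fun v => conjMod V (γ ((conjAlg A).symm a) ((conjMod V).symm v))
      map_add' := fun v w => by simp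
      map_smul' := fun c v => by
        obtain ⟨v, rfl⟩ := (conjMod V).surjective v
        simp only [smul_conjMod, AddEquiv.symm_apply_apply, map_smul, RingHom.id_apply] }
  map_one' := by ext v; simp
  map_mul' a b := by ext v; simp
  map_zero' := by ext v; simp
  map_add' a b := by ext v; simp
  commutes' c := by
    ext v
    obtain ⟨v, rfl⟩ := (conjMod V).surjective v
    rw [Algebra.algebraMap_eq_smul_one, ← map_one (conjAlg A), smul_conjAlg]
    simp [smul_conjMod, Module.algebraMap_end_apply]

/-! ### The spinor action of `ℂ_2` on `S_2` by the Pauli matrices -/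

/-- `e₁ ↦ σ₁`, `e₂ ↦ σ₂`. -/
def pauliVec : (Fin 2 → ℂ) →ₗ[ℂ] Matrix (Fin 2) (Fin 2) ℂ where
  toFun z := !![0, z 0 - Complex.I * z 1; z 0 + Complex.I * z 1, 0]
  map_add' z w := by ext i j; fin_cases i <;> fin_cases j <;> simp <;> ring
  map_smul' c z := by ext i j; fin_cases i <;> fin_cases j <;> simp <;> ring

theorem pauliVec_sq (z : Fin 2 → ℂ) :
    pauliVec z * pauliVec z = algebraMap ℂ _ (pauliForm z) := by
  have hI : Complex.I ^ 2 = -1 := Complex.I_sq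
  ext i j
  fin_cases i <;> fin_cases j <;>
    simp [pauliVec, pauliForm, Matrix.mul_apply, Fin.sum_univ_two,
      QuadraticMap.weightedSumSquares_apply, Matrix.algebraMap_matrix_apply] <;>
    linear_combination (-(z 1) ^ 2) * hI

/-- The spinor representation of `ℂ_2` on `S_2`. -/
def spinor : C2 →ₐ[ℂ] Module.End ℂ S2 :=
  (Matrix.toLinAlgEquiv' : Matrix (Fin 2) (Fin 2) ℂ ≃ₐ[ℂ] _).toAlgHom.comp
    (CliffordAlgebra.lift pauliForm ⟨pauliVec, pauliVec_sq⟩ : CliffordAlgebra pauliForm →ₐ[ℂ] _)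

/-! ### The group `Spin₊(1,3)` and its fundamental representation -/

/-- `Spin₊(1,3)`: the products of an even number of invertible vectors of `Cl_{1,3}` (closed under
inverses) that satisfy `x x̃ = 1`. -/
abbrev Spin13 : Type := ↥(spinGroup (realForm 1 3))

/-- The Pauli generators `s₁ = e₁`, `s₂ = e₂`, `s₃ = -i e₁ e₂` of `ℂ_2`. -/
def s1 : C2 := ι2 (Pi.single 0 1)
/-- See `s1`. -/
def s2 : C2 := ι2 (Pi.single 1 1)
/-- See `s1`. -/
def s3 : C2 := -(Complex.I • (s1 * s2))

theorem s1_sq : s1 * s1 = 1 := by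
  rw [s1, ι2_sq]
  simp [pauliForm, QuadraticMap.weightedSumSquares_apply]

theorem s2_sq : s2 * s2 = 1 := by
  rw [s2, ι2_sq]
  simp [pauliForm, QuadraticMap.weightedSumSquares_apply]

theorem s2_s1 : s2 * s1 = -(s1 * s2) := by
  have h := ι2_sq (Pi.single 0 1 + Pi.single 1 1)
  have h' : pauliForm (Pi.single 0 1 + Pi.single 1 1) = 1 + 1 := by
    simp [pauliForm, QuadraticMap.weightedSumSquares_apply]
  rw [h', map_add ι2, map_add, map_one] at h
  change (s1 + s2) * (s1 + s2) = _ at h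
  rw [add_mul, mul_add, mul_add, s1_sq, s2_sq] at h
  have e : s2 * s1 + s1 * s2 = (1 + s1 * s2 + (s2 * s1 + 1)) - (1 + 1) := by abel
  rw [h, sub_self] at e
  exact eq_neg_of_add_eq_zero_left e

theorem s1_s2_s1 : s1 * s2 * s1 = -s2 := by
  rw [mul_assoc, s2_s1, mul_neg, ← mul_assoc, s1_sq, one_mul]

theorem s3_s1 : s3 * s1 = -(s1 * s3) := by
  rw [s3, neg_mul, mul_neg, smul_mul_assoc, mul_smul_comm, s1_s2_s1, ← mul_assoc, s1_sq, one_mul]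
  simp

theorem s3_s2 : s3 * s2 = -(s2 * s3) := by
  rw [s3, neg_mul, mul_neg, smul_mul_assoc, mul_smul_comm, ← mul_assoc s2, s2_s1, neg_mul,
    mul_assoc, s2_sq]
  simp

theorem s3_sq : s3 * s3 = 1 := by
  rw [s3, neg_mul_neg, smul_mul_smul_comm, Complex.I_mul_I, ← mul_assoc, s1_s2_s1, neg_mul, s2_sq]
  simp

/-- The paravector `v₀ + ε (v₁ s₁ + v₂ s₂ + v₃ s₃)` of `ℂ_2` attached to a vector `v` of `ℝ^{1,3}`
and a sign `ε`. -/
def paravec (ε : ℝ) : (Fin 1 ⊕ Fin 3 → ℝ) →ₗ[ℝ] C2 :=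
  (LinearMap.proj (Sum.inl 0)).smulRight 1 +
    ε • ((LinearMap.proj (Sum.inr 0)).smulRight s1 + (LinearMap.proj (Sum.inr 1)).smulRight s2 +
      (LinearMap.proj (Sum.inr 2)).smulRight s3)

theorem paravec_apply (ε : ℝ) (v : Fin 1 ⊕ Fin 3 → ℝ) :
    paravec ε v = v (Sum.inl 0) • (1 : C2) +
      ε • (v (Sum.inr 0) • s1 + v (Sum.inr 1) • s2 + v (Sum.inr 2) • s3) := rfl

theorem paravec_mul (ε : ℝ) (hε : ε * ε = 1) (v : Fin 1 ⊕ Fin 3 → ℝ) :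
    paravec ε v * paravec (-ε) v = algebraMap ℝ C2 (realForm 1 3 v) := by
  rw [paravec_apply, paravec_apply, Algebra.algebraMap_eq_smul_one]
  simp only [realForm, QuadraticMap.weightedSumSquares_apply, Fintype.sum_sum_type,
    Fin.sum_univ_three, Sum.elim_inl, Sum.elim_inr, Finset.univ_unique, Finset.sum_singleton,
    Fin.default_eq_zero]
  simp only [mul_add, add_mul, smul_add, smul_mul_assoc, mul_smul_comm, one_mul, mul_one, s1_sq,
    s2_sq, s3_sq, s2_s1, s3_s1, s3_s2, smul_smul, smul_neg, neg_smul]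
  match_scalars <;> simp <;> try ring1
  linear_combination (-(v (Sum.inr 0) ^ 2) - v (Sum.inr 1) ^ 2 - v (Sum.inr 2) ^ 2) * hε

/-- The isomorphism `Cl⁺_{1,3} ≃ ℂ_2`, `v w ↦ (v₀ + 𝐯·𝐬)(w₀ - 𝐰·𝐬)`. -/
def evenToC2 : CliffordAlgebra.even (realForm 1 3) →ₐ[ℝ] C2 :=
  CliffordAlgebra.even.lift (realForm 1 3)
    { bilin := (LinearMap.mul ℝ C2).compl₁₂ (paravec 1) (paravec (-1))
      contract := fun v => by
        simpa using paravec_mul 1 (by norm_num) v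
      contract_mid := fun v w x => by
        have h : paravec (-1) w * paravec 1 w = algebraMap ℝ C2 (realForm 1 3 w) := by
          simpa using paravec_mul (-1) (by norm_num) w
        simp only [LinearMap.compl₁₂_apply, LinearMap.mul_apply']
        rw [mul_assoc, ← mul_assoc (paravec (-1) w), h, ← Algebra.smul_def, mul_smul_comm] }

/-- The homomorphism `σ : Spin₊(1,3) → ℂ_2`. -/
def sigma : Spin13 →* C2 where
  toFun g := evenToC2 ⟨g.1, spinGroup.mem_even g.2⟩
  map_one' := map_one evenToC2
  map_mul' g h := map_mul evenToC2 ⟨g.1, spinGroup.mem_even g.2⟩ ⟨h.1, spinGroup.mem_even h.2⟩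

/-- The homomorphism `σ̄ : Spin₊(1,3) → ℂ̄_2`. -/
def sigmaBar : Spin13 →* ConjAlg C2 := (conjAlg C2).toMonoidHom.comp sigma

/-! ### One-parameter subgroups and infinitesimal operators -/

theorem mul_mem_spinGroup (v w : Fin 1 ⊕ Fin 3 → ℝ) (h : realForm 1 3 v * realForm 1 3 w = 1) :
    CliffordAlgebra.ι (realForm 1 3) v * CliffordAlgebra.ι (realForm 1 3) w ∈
      spinGroup (realForm 1 3) := by
  have hv : IsUnit (realForm 1 3 v) := IsUnit.of_mul_eq_one _ h
  have hw : IsUnit (realForm 1 3 w) := IsUnit.of_mul_eq_one _ ((mul_comm _ _).trans h)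
  obtain ⟨a, ha⟩ := (CliffordAlgebra.isUnit_ι_iff _).2 hv
  obtain ⟨b, hb⟩ := (CliffordAlgebra.isUnit_ι_iff _).2 hw
  refine spinGroup.mem_iff.2 ⟨pinGroup.mem_iff.2 ⟨⟨a * b, mul_mem ?_ ?_, ?_⟩, ?_⟩, ?_⟩
  · exact Subgroup.subset_closure ⟨v, ha.symm⟩
  · exact Subgroup.subset_closure ⟨w, hb.symm⟩
  · simp [ha, hb]
  · have key : ∀ x y : Fin 1 ⊕ Fin 3 → ℝ, realForm 1 3 x * realForm 1 3 y = 1 →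
        CliffordAlgebra.ι (realForm 1 3) x * CliffordAlgebra.ι (realForm 1 3) y *
          (CliffordAlgebra.ι (realForm 1 3) y * CliffordAlgebra.ι (realForm 1 3) x) = 1 := by
      intro x y hxy
      rw [mul_assoc, ← mul_assoc (CliffordAlgebra.ι _ y), CliffordAlgebra.ι_sq_scalar,
        ← mul_assoc, ← Algebra.commutes, mul_assoc, CliffordAlgebra.ι_sq_scalar, ← map_mul,
        mul_comm, hxy, map_one]
    rw [Unitary.mem_iff]
    simp only [star_mul, CliffordAlgebra.star_ι, neg_mul_neg]
    exact ⟨key w v ((mul_comm _ _).trans h), key v w h⟩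
  · exact CliffordAlgebra.ι_mul_ι_mem_evenOdd_zero _ _ _

theorem eNeg_sq (i : Fin 3) : eNeg 1 3 i * eNeg 1 3 i = -1 := by
  have h : realForm 1 3 (Pi.single (Sum.inr i) 1) = -1 := by
    simp [realForm, QuadraticMap.weightedSumSquares_apply, Pi.single_apply]
  rw [eNeg, CliffordAlgebra.ι_sq_scalar, h, map_neg, map_one]

theorem ePos_sq : ePos 1 3 0 * ePos 1 3 0 = 1 := by
  have h : realForm 1 3 (Pi.single (Sum.inl 0) 1) = 1 := by
    simp [realForm, QuadraticMap.weightedSumSquares_apply, Pi.single_apply]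
  rw [ePos, CliffordAlgebra.ι_sq_scalar, h, map_one]

/-- The rotations `a_i(t) = cos(t/2) + sin(t/2) e_{i+1} e_{i+2}`, indices modulo `3`. -/
def rot (i : Fin 3) (t : ℝ) : Spin13 :=
  ⟨Real.cos (t / 2) • (1 : Cl 1 3) +
      Real.sin (t / 2) • (eNeg 1 3 (i + 1) * eNeg 1 3 (i + 2)), by
    have h := mul_mem_spinGroup (Pi.single (Sum.inr (i + 1)) 1)
      (Pi.single (Sum.inr (i + 1)) (-Real.cos (t / 2)) +
        Pi.single (Sum.inr (i + 2)) (Real.sin (t / 2))) (by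
        have := Real.cos_sq_add_sin_sq (t / 2)
        fin_cases i <;>
          simp [realForm, QuadraticMap.weightedSumSquares_apply, Fin.sum_univ_three,
            Pi.single_apply] <;>
          linear_combination this)
    have e1 : CliffordAlgebra.ι (realForm 1 3)
        (Pi.single (Sum.inr (i + 1)) (-Real.cos (t / 2)) +
          Pi.single (Sum.inr (i + 2)) (Real.sin (t / 2))) =
        (-Real.cos (t / 2)) • eNeg 1 3 (i + 1) + Real.sin (t / 2) • eNeg 1 3 (i + 2) := by
      rw [map_add, eNeg, eNeg, ← map_smul, ← map_smul, ← Pi.single_smul, ← Pi.single_smul,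
        smul_eq_mul, smul_eq_mul, mul_one, mul_one]
    rw [e1] at h
    change eNeg 1 3 (i + 1) * _ ∈ _ at h
    rwa [mul_add, mul_smul_comm, mul_smul_comm, eNeg_sq, smul_neg, neg_smul, neg_neg] at h⟩

/-- The hyperbolic rotations `b_i(t) = cosh(t/2) + sinh(t/2) e_0 e_i`. -/
def boost (i : Fin 3) (t : ℝ) : Spin13 :=
  ⟨Real.cosh (t / 2) • (1 : Cl 1 3) + Real.sinh (t / 2) • (ePos 1 3 0 * eNeg 1 3 i), by
    have h := mul_mem_spinGroup (Pi.single (Sum.inl 0) 1)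
      (Pi.single (Sum.inl 0) (Real.cosh (t / 2)) +
        Pi.single (Sum.inr i) (Real.sinh (t / 2))) (by
        have := Real.cosh_sq_sub_sinh_sq (t / 2)
        fin_cases i <;>
          simp [realForm, QuadraticMap.weightedSumSquares_apply, Pi.single_apply] <;>
          linear_combination this)
    have e1 : CliffordAlgebra.ι (realForm 1 3)
        (Pi.single (Sum.inl 0) (Real.cosh (t / 2)) + Pi.single (Sum.inr i) (Real.sinh (t / 2))) =
        Real.cosh (t / 2) • ePos 1 3 0 + Real.sinh (t / 2) • eNeg 1 3 i := by
      rw [map_add, ePos, eNeg, ← map_smul, ← map_smul, ← Pi.single_smul, ← Pi.single_smul,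
        smul_eq_mul, smul_eq_mul, mul_one, mul_one]
    rw [e1] at h
    change ePos 1 3 0 * _ ∈ _ at h
    rwa [mul_add, mul_smul_comm, mul_smul_comm, ePos_sq] at h⟩

section Representations

variable {V : Type} [AddCommGroup V] [Module ℂ V]

/-- `A i` and `B i` are the infinitesimal operators of `ρ` along the rotations `a_i(t)` and the
hyperbolic rotations `b_i(t)`: the derivatives at `t = 0` of all matrix coefficients. -/
structure Infinitesimal (ρ : Representation ℂ Spin13 V) (A B : Fin 3 → Module.End ℂ V) : Prop where
  rot : ∀ (i : Fin 3) (v : V) (f : Module.Dual ℂ V),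
    HasDerivAt (fun t => f (ρ (SpinField.rot i t) v)) (f (A i v)) 0
  boost : ∀ (i : Fin 3) (v : V) (f : Module.Dual ℂ V),
    HasDerivAt (fun t => f (ρ (SpinField.boost i t) v)) (f (B i v)) 0

/-- The real square root of a real number, as a complex number. -/
def rt (x : ℝ) : ℂ := (Real.sqrt x : ℂ)

/-- `{-l, -l + 1, …, l}`. -/
def weights (l : ℝ) : Set ℝ := {m | ∃ i : ℕ, m = -l + i ∧ m ≤ l}

/-- The family `ξ` of vectors indexed by the set `I` is a basis of `V`. -/
def IsBasisOn (I : Set (ℝ × ℝ)) (ξ : ℝ → ℝ → V) : Prop :=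
  LinearIndependent ℂ (fun p : I => ξ p.1.1 p.1.2) ∧
    Submodule.span ℂ (Set.range fun p : I => ξ p.1.1 p.1.2) = ⊤

/-- The representation `ρ` is given by the Van der Waerden formulas of weight `(l, l')` in some
basis `|l, m; l', m'⟩`. Here `X_j = (i/2)(A_j + i B_j)`, `Y_j = (i/2)(A_j - i B_j)`,
`X_± = X_1 ± i X_2`, `Y_± = Y_1 ± i Y_2`. -/
def HasWeight (ρ : Representation ℂ Spin13 V) (l l' : ℝ) : Prop :=
  ∃ A B X Y : Fin 3 → Module.End ℂ V, Infinitesimal ρ A B ∧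
    (∀ j, X j = (Complex.I / 2) • (A j + Complex.I • B j)) ∧
    (∀ j, Y j = (Complex.I / 2) • (A j - Complex.I • B j)) ∧
    (∃ n : ℕ, 2 * l = n) ∧ (∃ n : ℕ, 2 * l' = n) ∧
    ∃ ξ : ℝ → ℝ → V, IsBasisOn (weights l ×ˢ weights l') ξ ∧
      ∀ m ∈ weights l, ∀ m' ∈ weights l',
        (X 0 - Complex.I • X 1) (ξ m m') = rt ((l + m) * (l - m + 1)) • ξ (m - 1) m' ∧
        (X 0 + Complex.I • X 1) (ξ m m') = rt ((l - m) * (l + m + 1)) • ξ (m + 1) m' ∧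
        X 2 (ξ m m') = (m : ℂ) • ξ m m' ∧
        (Y 0 - Complex.I • Y 1) (ξ m m') = rt ((l' + m') * (l' - m' + 1)) • ξ m (m' - 1) ∧
        (Y 0 + Complex.I • Y 1) (ξ m m') = rt ((l' - m') * (l' + m' + 1)) • ξ m (m' + 1) ∧
        Y 2 (ξ m m') = (m' : ℂ) • ξ m m'

/-- The coefficient `A_k = i l₀ l₁ / (k (k + 1))` of the Gel'fand–Naimark formulas. -/
def coeffA (l0 l1 k : ℝ) : ℂ := Complex.I * ((l0 * l1 / (k * (k + 1)) : ℝ) : ℂ)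

/-- The coefficient `C_k = (i / k) √((k² - l₀²)(k² - l₁²) / (4 k² - 1))` of the Gel'fand–Naimark
formulas (a complex square root: the radicand is nonpositive for `|l₀| ≤ k ≤ |l₁|`). -/
def coeffC (l0 l1 k : ℝ) : ℂ :=
  Complex.I / (k : ℂ) *
    (((k ^ 2 - l0 ^ 2) * (k ^ 2 - l1 ^ 2) / (4 * k ^ 2 - 1) : ℝ) : ℂ) ^ (1 / 2 : ℂ)

/-- The pairs `(k, ν)` with `k = |l₀|, |l₀| + 1, …, |l₁| - 1` and `ν = -k, …, k`. -/
def gnIndex (l0 l1 : ℝ) : Set (ℝ × ℝ) :=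
  {p | (∃ i : ℕ, p.1 = |l0| + i) ∧ p.1 < |l1| ∧ p.2 ∈ weights p.1}

/-- The finite-dimensional representation `ρ` is defined by the pair `(l₀, l₁)` in a
Gel'fand–Naimark basis `ξ_{k ν}`. Here `H_± = i A_1 ∓ A_2`, `H_3 = i A_3`, `F_± = i B_1 ∓ B_2`,
`F_3 = i B_3`, the number `2 l₀` is an integer and `l₁² = (|l₀| + p)²` for a natural number
`p ≥ 1`. -/
def HasGelfandNaimarkPair (ρ : Representation ℂ Spin13 V) (l0 l1 : ℝ) : Prop :=
  ∃ A B : Fin 3 → Module.End ℂ V, Infinitesimal ρ A B ∧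
    (∃ n : ℤ, 2 * l0 = n) ∧ (∃ p : ℕ, 1 ≤ p ∧ l1 ^ 2 = (|l0| + p) ^ 2) ∧
    ∃ ξ : ℝ → ℝ → V, IsBasisOn (gnIndex l0 l1) ξ ∧
      ∀ k ν : ℝ, (k, ν) ∈ gnIndex l0 l1 →
        (Complex.I • A 2) (ξ k ν) = (ν : ℂ) • ξ k ν ∧
        (Complex.I • A 0 - A 1) (ξ k ν) = rt ((k + ν + 1) * (k - ν)) • ξ k (ν + 1) ∧
        (Complex.I • A 0 + A 1) (ξ k ν) = rt ((k + ν) * (k - ν + 1)) • ξ k (ν - 1) ∧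
        (Complex.I • B 2) (ξ k ν) =
          (coeffC l0 l1 k * rt (k ^ 2 - ν ^ 2)) • ξ (k - 1) ν
          - (coeffA l0 l1 k * (ν : ℂ)) • ξ k ν
          - (coeffC l0 l1 (k + 1) * rt ((k + 1) ^ 2 - ν ^ 2)) • ξ (k + 1) ν ∧
        (Complex.I • B 0 - B 1) (ξ k ν) =
          (coeffC l0 l1 k * rt ((k - ν) * (k - ν - 1))) • ξ (k - 1) (ν + 1)
          - (coeffA l0 l1 k * rt ((k - ν) * (k + ν + 1))) • ξ k (ν + 1)
          + (coeffC l0 l1 (k + 1) * rt ((k + ν + 1) * (k + ν + 2))) • ξ (k + 1) (ν + 1) ∧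
        (Complex.I • B 0 + B 1) (ξ k ν) =
          -((coeffC l0 l1 k * rt ((k + ν) * (k + ν - 1))) • ξ (k - 1) (ν - 1))
          - (coeffA l0 l1 k * rt ((k + ν) * (k - ν + 1))) • ξ k (ν - 1)
          - (coeffC l0 l1 (k + 1) * rt ((k - ν + 1) * (k - ν + 2))) • ξ (k + 1) (ν - 1)

/-- `ρ` is a field representation of type `(l, l')` with the Gel'fand–Naimark pair `(l₀, l₁)`:
it is irreducible, of weight `(l, l')`, and defined by the pair `(l₀, l₁)`. -/
structure IsField (ρ : Representation ℂ Spin13 V) (l l' l0 l1 : ℝ) : Prop where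
  irreducible : ρ.IsIrreducible
  weight : HasWeight ρ l l'
  pair : HasGelfandNaimarkPair ρ l0 l1

/-- The representation `ρ` is the direct sum of the subrepresentations `W₁` and `W₂`. -/
def IsDirectSum {ρ : Representation ℂ Spin13 V} (W₁ W₂ : Subrepresentation ρ) : Prop :=
  IsCompl W₁.toSubmodule W₂.toSubmodule

/-- `ρ` is a field representation of type `(l, l') ⊕ (m, m')`, whose two summands are defined by
the pairs `(l₀, l₁)` and `(m₀, m₁)`. -/
def IsSumField (ρ : Representation ℂ Spin13 V) (l l' l0 l1 m m' m0 m1 : ℝ) : Prop :=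
  ∃ W₁ W₂ : Subrepresentation ρ, IsDirectSum W₁ W₂ ∧
    IsField W₁.toRepresentation l l' l0 l1 ∧ IsField W₂.toRepresentation m m' m0 m1

/-- The subspace `W` is invariant under `ρ` and carries a field of type `(l, l')` with the
Gel'fand–Naimark pair `(l₀, l₁)`. -/
def CarriesField (ρ : Representation ℂ Spin13 V) (W : Submodule ℂ V) (l l' l0 l1 : ℝ) : Prop :=
  ∃ F : Subrepresentation ρ, F.toSubmodule = W ∧ IsField F.toRepresentation l l' l0 l1

/-- The subspace `W` is invariant under `ρ` and carries a field of type `(l, l') ⊕ (m, m')`, whose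
two summands are defined by the pairs `(l₀, l₁)` and `(m₀, m₁)`. -/
def CarriesSumField (ρ : Representation ℂ Spin13 V) (W : Submodule ℂ V)
    (l l' l0 l1 m m' m0 m1 : ℝ) : Prop :=
  ∃ F : Subrepresentation ρ, F.toSubmodule = W ∧
    IsSumField F.toRepresentation l l' l0 l1 m m' m0 m1

end Representations

/-! ### Tensor powers of algebras, spinspaces and representations -/

/-- The tensor power `V ⊗ ⋯ ⊗ V` (`k` times) over `ℂ`. -/
abbrev Pow (V : Type) [AddCommGroup V] [Module ℂ V] (k : ℕ) : Type := ⨂[ℂ] _ : Fin k, V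

/-- The tensor power `A ⊗ ⋯ ⊗ A` (`k` times) of a complex algebra. -/
abbrev AlgPow (A : Type) [Ring A] [Algebra ℂ A] (k : ℕ) : Type := ⨂[ℂ] _ : Fin k, A

section Powers

variable {A V A' V' : Type} [Ring A] [Algebra ℂ A] [AddCommGroup V] [Module ℂ V]
  [Ring A'] [Algebra ℂ A'] [AddCommGroup V'] [Module ℂ V']

/-- The action `(a₁ ⊗ ⋯ ⊗ a_k)(v₁ ⊗ ⋯ ⊗ v_k) = a₁ v₁ ⊗ ⋯ ⊗ a_k v_k`. -/
def powAction (γ : A →ₐ[ℂ] Module.End ℂ V) (k : ℕ) : AlgPow A k →ₐ[ℂ] Module.End ℂ (Pow V k) :=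
  PiTensorProduct.liftAlgHom
    ((PiTensorProduct.mapMultilinear ℂ (fun _ : Fin k => V) (fun _ : Fin k => V)).compLinearMap
      (fun _ => γ.toLinearMap))
    (by
      change PiTensorProduct.map (fun _ : Fin k => γ 1) = 1
      rw [map_one]; exact PiTensorProduct.map_one)
    (fun x y => by
      change PiTensorProduct.map (fun i : Fin k => γ (x i * y i)) = _
      simp only [map_mul]; exact PiTensorProduct.map_mul _ _)

/-- The group element `g` as the element `u(g) ⊗ ⋯ ⊗ u(g)` of the tensor power. -/
def powHom (u : Spin13 →* A) (k : ℕ) : Spin13 →* AlgPow A k where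
  toFun g := PiTensorProduct.tprod ℂ fun _ => u g
  map_one' := by simp only [map_one]; rfl
  map_mul' g h := by
    simp only [map_mul]
    exact (PiTensorProduct.tprodMonoidHom ℂ).map_mul (fun _ : Fin k => u g) (fun _ => u h)

/-- The representation of `Spin₊(1,3)` obtained from a homomorphism into an algebra that acts
on `V`. -/
def repOf (γ : A →ₐ[ℂ] Module.End ℂ V) (u : Spin13 →* A) : Representation ℂ Spin13 V :=
  (γ : A →* Module.End ℂ V).comp u

/-- The action of `A ⊗ A'` on `V ⊗ V'`. -/
def tensorAction (γ : A →ₐ[ℂ] Module.End ℂ V) (γ' : A' →ₐ[ℂ] Module.End ℂ V') :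
    A ⊗[ℂ] A' →ₐ[ℂ] Module.End ℂ (V ⊗[ℂ] V') :=
  (Module.endTensorEndAlgHom (R := ℂ) (S := ℂ) (A := ℂ) (M := V) (N := V')).comp
    (Algebra.TensorProduct.map γ γ')

/-- `g ↦ u(g) ⊗ u'(g)`. -/
def tensorHom (u : Spin13 →* A) (u' : Spin13 →* A') : Spin13 →* A ⊗[ℂ] A' where
  toFun g := u g ⊗ₜ u' g
  map_one' := by rw [map_one, map_one]; rfl
  map_mul' g h := by rw [map_mul, map_mul, Algebra.TensorProduct.tmul_mul_tmul]

/-- The action of `A ⊕ A'` on `V ⊕ V'`. -/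
def sumAction (γ : A →ₐ[ℂ] Module.End ℂ V) (γ' : A' →ₐ[ℂ] Module.End ℂ V') :
    A × A' →ₐ[ℂ] Module.End ℂ (V × V') :=
  (LinearMap.prodMapAlgHom ℂ V V').comp (AlgHom.prodMap γ γ')

/-- `g ↦ (u(g), u'(g))`. -/
def sumHom (u : Spin13 →* A) (u' : Spin13 →* A') : Spin13 →* A × A' := u.prod u'

/-- The permutation of the tensor factors by `π`. -/
def permute (V : Type) [AddCommGroup V] [Module ℂ V] {k : ℕ} (π : Equiv.Perm (Fin k)) :
    Module.End ℂ (Pow V k) :=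
  (PiTensorProduct.reindex ℂ (fun _ : Fin k => V) π).toLinearMap

/-- The symmetric spintensors in `V ⊗ ⋯ ⊗ V`. -/
def symPow (V : Type) [AddCommGroup V] [Module ℂ V] (k : ℕ) : Submodule ℂ (Pow V k) :=
  ⨅ π : Equiv.Perm (Fin k), LinearMap.eqLocus (permute V π) LinearMap.id

/-- The spintensors in `(V ⊗ ⋯ ⊗ V) ⊗ (V' ⊗ ⋯ ⊗ V')` that are symmetric in the first `k` and in
the last `r` factors. -/
def symMixed (V V' : Type) [AddCommGroup V] [Module ℂ V] [AddCommGroup V'] [Module ℂ V']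
    (k r : ℕ) : Submodule ℂ (Pow V k ⊗[ℂ] Pow V' r) :=
  (⨅ π : Equiv.Perm (Fin k),
      LinearMap.eqLocus (TensorProduct.map (permute V π) LinearMap.id) LinearMap.id) ⊓
    ⨅ π : Equiv.Perm (Fin r),
      LinearMap.eqLocus (TensorProduct.map LinearMap.id (permute V' π)) LinearMap.id

end Powers

/-! ### The algebras, spinspaces and spintensor representations of `Spin₊(1,3)` -/

/-- The algebra `ℂ_2 ⊗ ⋯ ⊗ ℂ_2`, `k` times. -/
abbrev Und (k : ℕ) : Type := AlgPow C2 k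

/-- The algebra `ℂ̄_2 ⊗ ⋯ ⊗ ℂ̄_2`, `r` times. -/
abbrev Dot (r : ℕ) : Type := AlgPow (ConjAlg C2) r

/-- The spinspace `S_{2^k}`. -/
abbrev S (k : ℕ) : Type := Pow S2 k

/-- The dotted spinspace `Ṡ_{2^r}`. -/
abbrev SDot (r : ℕ) : Type := Pow (ConjMod S2) r

/-- The spinor action of `ℂ_2 ⊗ ⋯ ⊗ ℂ_2` on `S_{2^k}`. -/
def undAction (k : ℕ) : Und k →ₐ[ℂ] Module.End ℂ (S k) := powAction spinor k

/-- The spinor action of `ℂ̄_2 ⊗ ⋯ ⊗ ℂ̄_2` on `Ṡ_{2^r}`. -/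
def dotAction (r : ℕ) : Dot r →ₐ[ℂ] Module.End ℂ (SDot r) := powAction (conjAction spinor) r

/-- `g ↦ σ(g) ⊗ ⋯ ⊗ σ(g)`. -/
def undHom (k : ℕ) : Spin13 →* Und k := powHom sigma k

/-- `g ↦ σ̄(g) ⊗ ⋯ ⊗ σ̄(g)`. -/
def dotHom (r : ℕ) : Spin13 →* Dot r := powHom sigmaBar r

/-- The representation `ℭ^{k,0} ⊕ ℭ^{0,-r}` on `S_{2^k} ⊕ Ṡ_{2^r}`. -/
def sumRep (k r : ℕ) : Representation ℂ Spin13 (S k × SDot r) :=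
  repOf (sumAction (undAction k) (dotAction r)) (sumHom (undHom k) (dotHom r))

/-- The action of `(ℂ_2)^{⊗k} ⊗ (ℂ̄_2)^{⊗r}` on `S_{2^k} ⊗ Ṡ_{2^r} = S_{2^{k+r}}`. -/
def mixedAction (k r : ℕ) : Und k ⊗[ℂ] Dot r →ₐ[ℂ] Module.End ℂ (S k ⊗[ℂ] SDot r) :=
  tensorAction (undAction k) (dotAction r)

/-- The action of the conjugate algebra `(ℂ̄_2)^{⊗k} ⊗ (ℂ_2)^{⊗r}` on
`Ṡ_{2^k} ⊗ S_{2^r} = S_{2^{k+r}}`. -/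
def mixedAction' (k r : ℕ) : Dot k ⊗[ℂ] Und r →ₐ[ℂ] Module.End ℂ (SDot k ⊗[ℂ] S r) :=
  tensorAction (dotAction k) (undAction r)

/-- The representation `ℭ^{k,-r} ⊕ ℭ^{-r,k}` on `S_{2^{k+r}} ⊕ S_{2^{k+r}}`. -/
def mixedRep (k r : ℕ) : Representation ℂ Spin13 ((S k ⊗[ℂ] SDot r) × (SDot k ⊗[ℂ] S r)) :=
  repOf (V := (S k ⊗[ℂ] SDot r) × (SDot k ⊗[ℂ] S r))
    (sumAction (mixedAction k r) (mixedAction' k r))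
    (sumHom (tensorHom (undHom k) (dotHom r)) (tensorHom (dotHom k) (undHom r)))

/-- The exponents `(l₀ + l₁ - 1, l₀ - l₁ + 1)` of `ℭ^{l₀+l₁-1, l₀-l₁+1}`. -/
def exponents (l0 l1 : ℝ) : ℝ × ℝ := (l0 + l1 - 1, l0 - l1 + 1)

/-! ### Real subalgebras -/

/-- Homomorphisms of real algebras from `B` to the complex algebra `A`. -/
abbrev RealHom (B A : Type) [Ring B] [Algebra ℝ B] [Ring A] [Algebra ℂ A] : Type := B →ₐ[ℝ] A

/-- `A` is the complexification of `B` along `j`: the map `ℂ ⊗ B → A`, `c ⊗ b ↦ c j(b)` is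
bijective. -/
def IsRealForm {B A : Type} [Ring B] [Algebra ℝ B] [Ring A] [Algebra ℂ A] (j : RealHom B A) :
    Prop :=
  Function.Bijective (LinearMap.liftBaseChange ℂ j.toLinearMap : ℂ ⊗[ℝ] B →ₗ[ℂ] A)

/-- The real algebra `Cl_{s_1,t_1} ⊗ ⋯ ⊗ Cl_{s_r,t_r}`. -/
abbrev TensorCl {r : ℕ} (s t : Fin r → ℕ) : Type := ⨂[ℝ] i, Cl (s i) (t i)

/-- The action of `B` on `V` through `j : B → A` and the action of `A` on `V` commutes with an
antilinear map `J` of square `ε`: a real structure for `ε = 1`, a quaternionic structure for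
`ε = -1`. -/
def HasStructure {B A V : Type} [Ring B] [Algebra ℝ B] [Ring A] [Algebra ℂ A] [AddCommGroup V]
    [Module ℂ V] (ε : ℂ) (γ : A →ₐ[ℂ] Module.End ℂ V) (j : RealHom B A) : Prop :=
  ∃ J : V →ₛₗ[starRingEnd ℂ] V, (∀ v, J (J v) = ε • v) ∧ ∀ b v, J (γ (j b) v) = γ (j b) (J v)

/-- The type of `Cl_{p,q}`: `p - q ≡ h (mod 8)`. -/
def HasType (p q : ℕ) (h : ℤ) : Prop := (p : ℤ) - q ≡ h [ZMOD 8]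

/-- Factors `Cl_{s_i,t_i}` with `s_i + t_i = 2` (so that `s_i, t_i ∈ {0, 1, 2}`), each embedded in
its complexification `ℂ_2`. -/
structure Factors (r : ℕ) where
  s : Fin r → ℕ
  t : Fin r → ℕ
  sum_eq : ∀ i, s i + t i = 2
  emb : ∀ i, RealHom (Cl (s i) (t i)) C2
  isRealForm : ∀ i, IsRealForm (emb i)

/-- The real algebra `Cl_{s_1,t_1} ⊗ ⋯ ⊗ Cl_{s_r,t_r}` of a family of factors. -/
abbrev Factors.Alg {r : ℕ} (f : Factors r) : Type := TensorCl f.s f.t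

/-- The element `j_1(x_1) ⊗ ⋯ ⊗ j_r(x_r)` of `ℂ_2 ⊗ ⋯ ⊗ ℂ_2`. -/
def Factors.und {r : ℕ} (f : Factors r) (x : ∀ i, Cl (f.s i) (f.t i)) : Und r :=
  PiTensorProduct.tprod ℂ fun i => f.emb i (x i)

/-- The same element in the conjugate algebra `ℂ̄_2 ⊗ ⋯ ⊗ ℂ̄_2`. -/
def Factors.dot {r : ℕ} (f : Factors r) (x : ∀ i, Cl (f.s i) (f.t i)) : Dot r :=
  PiTensorProduct.tprod ℂ fun i => conjAlg C2 (f.emb i (x i))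

/-- Real matrices of size `2^r`. -/
abbrev MatR (r : ℕ) : Type := Matrix (Fin (2 ^ r)) (Fin (2 ^ r)) ℝ

/-- Complex matrices of size `2^r`. -/
abbrev MatC (r : ℕ) : Type := Matrix (Fin (2 ^ r)) (Fin (2 ^ r)) ℂ

/-- Quaternionic matrices of size `2^(r-1)`. -/
abbrev MatH (r : ℕ) : Type := Matrix (Fin (2 ^ (r - 1))) (Fin (2 ^ (r - 1))) ℍ[ℝ]

end SpinField

end

open SpinField
open scoped TensorProduct

open scoped TensorProduct Quaternion

noncomputable section

/-! The statement has a representation-theoretic half (fields carried by symmetric spintensors) and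
an algebraic half (structure of the real Clifford algebras). They meet only in the algebras `Und r`,
`Dot r` and their spinspaces.

Fields. The complexified Lorentz algebra is a sum of two commuting copies of sl₂, spanned by X and
Y. On `S2` the infinitesimal operators are A = -(i/2)s and B = -(1/2)s, s being the Pauli
generators, so X = s/2 and Y = 0; on the conjugate space i changes sign, so X = 0 and Y = -s/2
(`weight_und`, `weight_dot`). On tensor powers these operators act as derivations. The symmetric
tensors are spanned by the sums of all basis tensors with a given number of factors `e 1`, and these
sums form a ladder of spin k/2 (`Doublet.ladder`). So every representation in question has a basis
indexed by a pair of ladders (`BiLadder`). Rescaling gives the weight formulas. Irreducibility holds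
because every nonzero invariant subspace contains the unique highest weight vector
(`BiLadder.invariant_eq_top`).

The Gel'fand–Naimark pair needs more work. Put J = X + Y and F = i(Y - X). The Casimir operator J·F
= i(Y² - X²) is the scalar -i l₀l₁ with l₀ = (k-r)/2, l₁ = (k+r)/2 + 1
(`BiLadder.lorentzRelations`). From a vector of highest weight κ for J one reaches spin κ - 1 by
projecting F₋ of it onto the kernel of J₊. The Casimir fixes all coefficients, and the constants C_k
solve the resulting recursion (`gnP_recurrence`). This yields a tower of highest weight vectors of
spins (k+r)/2, …, |k-r|/2 (`LorentzRelations.isTower`), which satisfy the formulas at ν = κ;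
commuting with J₋ carries them to all ν (`GNFormulas.step`). The span of the vectors obtained is
invariant, hence everything, and a dimension count makes them a basis
(`BiLadder.hasGelfandNaimarkPair`).

Algebras. The spinor action maps `C2` onto all 2×2 matrices, and tensor products of matrix units are
matrix units. For p + q even, two-generator factors are split off one at a time: the volume element
of a factor anticommutes with its generators, so putting it in front makes generators of different
factors anticommute (`isGenerating_tensorGen`). Each factor has an antilinear map commuting with it,
of square -1 only for `Cl 0 2`. Their tensor product is a structure map on the spinspace whose sign
depends on p - q mod 8 (`exists_factorization`). A real structure yields real matrices acting on its
fixed points, a quaternionic one yields quaternionic matrices.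

For p + q odd, one generator is removed. The volume element ω is central and, up to sign, recovers
that generator, so the algebra is B ⊕ ωB with B of the even kind (`exists_odd_factors`). Sending ω
to (c, -c) with c² = ω² embeds it into the sum of `Und r` and `Dot r`. For c = 1 it splits as B ⊕ B;
for c = i the first projection is already bijective (`odd_system_complex`). -/

namespace SpinField

/-! ### Highest weight vectors and the boosts. -/

section Lorentz

variable {V : Type} [AddCommGroup V] [Module ℂ V]

/-- The commutation relations of the complexified Lorentz algebra, in the form in which rotations
`J` are moved past the boosts `F`, together with the value `c` of the Casimir operator `J · F`. -/
structure LorentzRelations (Jp Jm J3 Fp Fm F3 : Module.End ℂ V) (c : ℂ) : Prop where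
  J3Jm : ∀ v, J3 (Jm v) = Jm (J3 v) - Jm v
  JpJm : ∀ v, Jp (Jm v) = Jm (Jp v) + (2 : ℂ) • J3 v
  JpFm : ∀ v, Jp (Fm v) = Fm (Jp v) + (2 : ℂ) • F3 v
  FpJm : ∀ v, Fp (Jm v) = Jm (Fp v) + (2 : ℂ) • F3 v
  F3Jm : ∀ v, F3 (Jm v) = Jm (F3 v) - Fm v
  FmJm : ∀ v, Fm (Jm v) = Jm (Fm v)
  J3Fm : ∀ v, J3 (Fm v) = Fm (J3 v) - Fm v
  FpFm : ∀ v, Fp (Fm v) = Fm (Fp v) - (2 : ℂ) • J3 v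
  casimir : ∀ v, F3 (J3 v) + F3 v + (1 / 2 : ℂ) • (Jm (Fp v) + Fm (Jp v)) = c • v

namespace LorentzRelations

variable {Jp Jm J3 Fp Fm F3 : Module.End ℂ V} {c : ℂ}

/-- On such a vector the Casimir relation loses its Jp term and becomes a linear equation for F3 t
with factor κ + 1. -/
theorem F3_highest (R : LorentzRelations Jp Jm J3 Fp Fm F3 c) {κ P : ℂ} {t t' : V}
    (hκ : κ + 1 ≠ 0) (h1 : Jp t = 0) (h2 : J3 t = κ • t) (h3 : Fp t = P • t') :
    F3 t = (c / (κ + 1)) • t - (P / (2 * κ + 2)) • Jm t' := by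
  have h := R.casimir t
  rw [h1, h2, h3, map_zero, map_smul, map_smul, add_zero] at h
  have h' : (κ + 1) • F3 t = c • t - (1 / 2 : ℂ) • P • Jm t' := by
    rw [← h]; module
  have h2κ : 2 * κ + 2 ≠ 0 := by
    rw [show 2 * κ + 2 = 2 * (κ + 1) by ring]; exact mul_ne_zero two_ne_zero hκ
  apply (smul_right_injective V hκ)
  simp only
  rw [h', smul_sub, smul_smul, smul_smul, smul_smul, mul_div_cancel₀ _ hκ]
  congr 2
  field_simp

/-- The projection of `F₋ t` to the highest weight vectors of spin `κ - 1`. -/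
def lowered (Jm Fm : Module.End ℂ V) (κ A P : ℂ) (t t' : V) : V :=
  Fm t + A • Jm t + (P / ((2 * κ + 2) * (2 * κ + 1))) • Jm (Jm t')

/-- The two corrections in `lowered` are chosen for this. Jp (Fm t) = 2 F3 t has a component along
t, cancelled by A (as Jp Jm t = 2κ t), and one along Jm t', cancelled by the last coefficient (as Jp
Jm Jm t' = (4κ + 2) Jm t'). -/
theorem Jp_lowered (R : LorentzRelations Jp Jm J3 Fp Fm F3 c) {κ A P : ℂ} {t t' : V}
    (hκ : κ + 1 ≠ 0) (hκ' : 2 * κ + 1 ≠ 0) (hA : κ * A * (κ + 1) = - c)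
    (h1 : Jp t = 0) (h2 : J3 t = κ • t) (h3 : Fp t = P • t')
    (h1' : Jp t' = 0) (h2' : J3 t' = (κ + 1) • t') :
    Jp (lowered Jm Fm κ A P t t') = 0 := by
  have h2κ : 2 * κ + 2 ≠ 0 := by
    rw [show 2 * κ + 2 = 2 * (κ + 1) by ring]; exact mul_ne_zero two_ne_zero hκ
  have hc : c = -(κ * A * (κ + 1)) := by rw [hA, neg_neg]
  simp only [lowered, map_add, map_smul, R.JpFm, R.JpJm, h1, h2, h1', h2', map_zero,
    R.F3_highest hκ h1 h2 h3, R.J3Jm]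
  subst hc
  match_scalars
  · field_simp; ring
  · field_simp; ring

theorem J3_lowered (R : LorentzRelations Jp Jm J3 Fp Fm F3 c) {κ A P : ℂ} {t t' : V}
    (h2 : J3 t = κ • t) (h2' : J3 t' = (κ + 1) • t') :
    J3 (lowered Jm Fm κ A P t t') = (κ - 1) • lowered Jm Fm κ A P t t' := by
  simp only [lowered, map_add, map_smul, R.J3Fm, R.J3Jm, h2, h2', map_sub]
  module

/-- Raising the projected vector returns a multiple of t; the multiple determines the normalization
of the next level. Since Fp Fm t involves Fm t', the formula of the preceding level is an input. It
is needed only after multiplication by P, which makes it void at the top, where P = 0. -/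
theorem Fp_lowered (R : LorentzRelations Jp Jm J3 Fp Fm F3 c) {κ A A' P P' : ℂ} {t t' t'' : V}
    (hκ : κ + 1 ≠ 0) (hκ' : 2 * κ + 1 ≠ 0) (hκ2 : κ + 2 ≠ 0) (hκ3 : 2 * κ + 3 ≠ 0)
    (hA : κ * A * (κ + 1) = - c) (hA' : (κ + 1) * A' * (κ + 2) = - c)
    (h1 : Jp t = 0) (h2 : J3 t = κ • t) (h3 : Fp t = P • t')
    (h1' : Jp t' = 0) (h2' : J3 t' = (κ + 1) • t') (h3' : Fp t' = P' • t'')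
    (hm : P • Fm t' = P • (-(P • t) - A' • Jm t' - (P' / ((2 * κ + 4) * (2 * κ + 3))) • Jm (Jm t''))) :
    Fp (lowered Jm Fm κ A P t t') =
      -(P ^ 2 * (κ * (2 * κ + 3)) / ((κ + 1) * (2 * κ + 1)) + 2 * κ + 2 * κ * A ^ 2) • t := by
  have h2κ : 2 * κ + 2 ≠ 0 := by
    rw [show 2 * κ + 2 = 2 * (κ + 1) by ring]; exact mul_ne_zero two_ne_zero hκ
  have h2κ4 : 2 * κ + 4 ≠ 0 := by
    rw [show 2 * κ + 4 = 2 * (κ + 2) by ring]; exact mul_ne_zero two_ne_zero hκ2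
  have hc : c = -(κ * A * (κ + 1)) := by rw [hA, neg_neg]
  have hA2 : A' = κ * A / (κ + 2) := by
    field_simp
    have : (κ + 1) * (A' * (κ + 2)) = (κ + 1) * (κ * A) := by linear_combination hA' - hA
    exact mul_left_cancel₀ hκ this
  have h3'' : κ + 1 + 1 ≠ 0 := by rwa [add_assoc, one_add_one_eq_two]
  -- The correction 2/((2κ+2)(2κ+1)) comes from Fp Jm Jm t' = Jm Jm Fp t' + 4 Jm F3 t' - 2 Fm t'.
  have key : Fp (lowered Jm Fm κ A P t t') =
      (1 - 2 / ((2 * κ + 2) * (2 * κ + 1))) • (P • Fm t') - (2 : ℂ) • (κ • t)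
      + A • (P • Jm t' + (2 : ℂ) • F3 t)
      + (P / ((2 * κ + 2) * (2 * κ + 1))) • (P' • Jm (Jm t'') + (4 : ℂ) • Jm (F3 t')) := by
    simp only [lowered, map_add, map_smul, R.FpFm, R.FpJm, h2, h3, h3', R.F3Jm]
    module
  rw [key, hm, R.F3_highest hκ h1 h2 h3, R.F3_highest h3'' h1' h2' h3']
  simp only [map_sub, map_smul]
  subst hc hA2
  have e4 : 2 * (κ + 1) + 2 ≠ 0 := by rwa [show 2 * (κ + 1) + 2 = 2 * κ + 4 by ring]
  -- The coefficients of Jm t' and Jm Jm t'' cancel; that of t is the claim.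
  match_scalars
  · field_simp; ring
  · field_simp; ring
  · field_simp; ring

end LorentzRelations
end Lorentz

/-! ### The Gel'fand–Naimark coefficients. -/

/-- The value of `coeffC` for `|l₀| ≤ κ ≤ |l₁|`, as a real number. -/
def gnC (l0 l1 κ : ℝ) : ℝ := -(√((κ ^ 2 - l0 ^ 2) * (l1 ^ 2 - κ ^ 2) / (4 * κ ^ 2 - 1)) / κ)

/-- The coefficient with which `F₊` raises a highest weight vector of spin `κ`. -/
def gnP (l0 l1 κ : ℝ) : ℝ := gnC l0 l1 (κ + 1) * √((2 * κ + 2) * (2 * κ + 1))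

theorem sq_nonneg_of_half_le {κ : ℝ} (h : 1 / 2 ≤ κ) : 0 ≤ 4 * κ ^ 2 - 1 := by nlinarith

theorem sq_sub_sq_nonneg_of_abs_le {a b : ℝ} (h : |a| ≤ b) : 0 ≤ b ^ 2 - a ^ 2 := by
  have := sq_le_sq' (neg_le_of_abs_le h) (le_of_abs_le h); linarith

theorem coeffC_eq {l0 l1 κ : ℝ} (h0 : |l0| ≤ κ) (h1 : κ ≤ l1) (h : 1 / 2 ≤ κ ∨ κ = |l0|) :
    coeffC l0 l1 κ = gnC l0 l1 κ := by
  have hκ : 0 ≤ κ := (abs_nonneg _).trans h0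
  set x : ℝ := (κ ^ 2 - l0 ^ 2) * (l1 ^ 2 - κ ^ 2) / (4 * κ ^ 2 - 1) with hx
  have hx0 : 0 ≤ x := by
    rcases h with h | h
    · exact div_nonneg (mul_nonneg (sq_sub_sq_nonneg_of_abs_le h0)
        (sq_sub_sq_nonneg_of_abs_le (by rwa [abs_of_nonneg hκ]))) (sq_nonneg_of_half_le h)
    -- At κ = |l0| the denominator may be negative or zero, but the numerator vanishes.
    · rw [hx, h, sq_abs, sub_self, zero_mul, zero_div]
  have e : (κ ^ 2 - l0 ^ 2) * (κ ^ 2 - l1 ^ 2) / (4 * κ ^ 2 - 1) = -x := by rw [hx]; ring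
  -- The principal root of a nonpositive number lies on the upper imaginary axis; this second factor
  -- i explains the minus sign in `gnC`.
  have hs : ((-x : ℝ) : ℂ) ^ (1 / 2 : ℂ) = Complex.I * (√x : ℝ) := by
    rcases hx0.eq_or_lt with h0 | h0
    · rw [← h0]; simp
    · have : (-x) < 0 := by linarith
      rw [Complex.ofReal_cpow_of_nonpos this.le, ← Complex.ofReal_neg, neg_neg, Real.sqrt_eq_rpow,
        Complex.ofReal_cpow hx0, mul_comm]
      congr 1
      · rw [show (Real.pi : ℂ) * Complex.I * (1 / 2) = (Real.pi / 2 : ℂ) * Complex.I by ring,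
          Complex.exp_mul_I, Complex.cos_pi_div_two, Complex.sin_pi_div_two]; simp
      · push_cast; rfl
  rw [coeffC, e, hs, gnC, ← hx]
  push_cast
  rw [show Complex.I / (κ : ℂ) * (Complex.I * (√x : ℝ)) =
    (Complex.I * Complex.I) * ((√x : ℝ) / κ) by ring, Complex.I_mul_I, neg_one_mul]

theorem gnP_sq {l0 l1 κ : ℝ} (hκ : 0 ≤ κ) (h0 : |l0| ≤ κ + 1) (h1 : κ + 1 ≤ l1) :
    gnP l0 l1 κ ^ 2 =
      2 * ((κ + 1) ^ 2 - l0 ^ 2) * (l1 ^ 2 - (κ + 1) ^ 2) / ((κ + 1) * (2 * κ + 3)) := by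
  have hd : 0 ≤ 4 * (κ + 1) ^ 2 - 1 := sq_nonneg_of_half_le (by linarith)
  rw [gnP, gnC, mul_pow, neg_sq, div_pow, Real.sq_sqrt, Real.sq_sqrt (by positivity)]
  · have : 4 * (κ + 1) ^ 2 - 1 = (2 * κ + 1) * (2 * κ + 3) := by ring
    rw [this]; field_simp
  · exact div_nonneg (mul_nonneg (sq_sub_sq_nonneg_of_abs_le h0)
      (sq_sub_sq_nonneg_of_abs_le (by rwa [abs_of_nonneg (by linarith)]))) hd

theorem gnC_abs (l0 l1 : ℝ) : gnC l0 l1 |l0| = 0 := by simp [gnC]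

theorem gnC_top (l0 l1 : ℝ) : gnC l0 l1 l1 = 0 := by simp [gnC]

/-- With `gnP_top`, this bounds the tower: nothing is raised from spin l₁ - 1, and nothing is
reached below spin |l₀|. -/
theorem gnP_abs (l0 l1 : ℝ) : gnP l0 l1 (|l0| - 1) = 0 := by simp [gnP, gnC]

theorem gnP_top (l0 l1 : ℝ) : gnP l0 l1 (l1 - 1) = 0 := by simp [gnP, gnC_top]

/-- This is the recursion produced by `Fp_lowered`, with A² = -(l₀l₁/(κ(κ+1)))². The case κ = |l₀|
is separate because there the left side has to vanish, the formula `gnP_sq` being unavailable one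
step lower. -/
theorem gnP_recurrence {l0 l1 κ : ℝ} (h0 : |l0| + 1 ≤ κ ∨ |l0| = κ) (h1 : κ + 1 ≤ l1) :
    gnP l0 l1 κ ^ 2 * (κ * (2 * κ + 3)) / ((κ + 1) * (2 * κ + 1)) + 2 * κ
      - 2 * κ * (l0 * l1 / (κ * (κ + 1))) ^ 2 = gnP l0 l1 (κ - 1) ^ 2 := by
  have ha := abs_nonneg l0
  have hκ : 0 ≤ κ := by rcases h0 with h | h <;> linarith
  rw [gnP_sq hκ (by rcases h0 with h | h <;> linarith) h1]
  rcases h0 with h | h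
  · have : 0 < κ := by linarith
    rw [gnP_sq (by linarith) (by linarith) (by linarith), sub_add_cancel,
      show 2 * (κ - 1) + 3 = 2 * κ + 1 by ring]
    field_simp
    ring
  · rw [← h, gnP_abs]
    have hl : l0 ^ 2 = κ ^ 2 := by rw [← h, sq_abs]
    rw [h]
    -- For κ = 0 the quotient by κ is zero by convention and every term carries a factor κ.
    rcases hκ.eq_or_lt with h' | h'
    · rw [← h']; simp
    · rw [div_pow, mul_pow, hl]
      field_simp
      ring

theorem gnP_ne_zero {l0 l1 κ : ℝ} (h0 : |l0| < κ + 1) (hκ : 0 ≤ κ) (h1 : κ + 1 < l1) :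
    gnP l0 l1 κ ≠ 0 := by
  have h := gnP_sq hκ h0.le h1.le
  have : 0 < (κ + 1) ^ 2 - l0 ^ 2 := by
    have := sq_lt_sq' (neg_lt_of_abs_lt h0) (lt_of_abs_lt h0); linarith
  have : 0 < l1 ^ 2 - (κ + 1) ^ 2 := by nlinarith
  intro h'
  rw [h'] at h
  have : 0 < 2 * ((κ + 1) ^ 2 - l0 ^ 2) * (l1 ^ 2 - (κ + 1) ^ 2) / ((κ + 1) * (2 * κ + 3)) := by
    positivity
  linarith [h]

/-- The right side is minus the Casimir value -i l₀l₁. At κ = 0 the bound forces l₀ = 0, so the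
division by zero in `coeffA` is harmless. -/
theorem coeffA_mul (l0 l1 : ℝ) {κ : ℝ} (hκ : 0 ≤ κ) (h0 : |l0| ≤ κ) :
    (κ : ℂ) * coeffA l0 l1 κ * (κ + 1) = -(-(Complex.I * (l0 * l1))) := by
  rcases hκ.eq_or_lt with h | h
  · rw [← h, abs_nonpos_iff] at h0
    simp [h0, ← h]
  · have : (κ : ℂ) ≠ 0 := by exact_mod_cast h.ne'
    have : (κ + 1 : ℂ) ≠ 0 := by exact_mod_cast (by linarith : κ + 1 ≠ 0)
    rw [coeffA]; push_cast; field_simp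

theorem coeffA_sq (l0 l1 κ : ℝ) :
    coeffA l0 l1 κ ^ 2 = ((-(l0 * l1 / (κ * (κ + 1))) ^ 2 : ℝ) : ℂ) := by
  rw [coeffA, mul_pow, Complex.I_sq]; push_cast; ring

/-! ### The tower of highest weight vectors. -/

section Tower

variable {V : Type} [AddCommGroup V] [Module ℂ V]

/-- The normalized highest weight vectors of spins `l₁ - 1 - n` (second component), each together
with its predecessor. -/
def tower (Jm Fm : Module.End ℂ V) (v0 : V) (l0 l1 : ℝ) : ℕ → V × V
  | 0 => (0, v0)
  | n + 1 =>
    ((tower Jm Fm v0 l0 l1 n).2,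
      (-(gnP l0 l1 (l1 - 1 - n - 1) : ℂ))⁻¹ •
        LorentzRelations.lowered Jm Fm ((l1 - 1 - n : ℝ) : ℂ) (coeffA l0 l1 (l1 - 1 - n))
          (gnP l0 l1 (l1 - 1 - n)) (tower Jm Fm v0 l0 l1 n).2 (tower Jm Fm v0 l0 l1 n).1)

/-- The sequence of the vectors `t n` is a tower of highest weight vectors of spins
`l₁ - 1 - n`, `n ≤ N`. -/
structure IsTower (Jp Jm J3 Fp Fm F3 : Module.End ℂ V) (l0 l1 : ℝ) (N : ℕ) (t : ℕ → V) : Prop where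
  Jp_apply : ∀ n ≤ N, Jp (t n) = 0
  J3_apply : ∀ n ≤ N, ∀ κ : ℝ, κ = l1 - 1 - n → J3 (t n) = (κ : ℂ) • t n
  Fp_apply : ∀ n ≤ N, ∀ κ : ℝ, κ = l1 - 1 - n → Fp (t n) = (gnP l0 l1 κ : ℂ) • t (n - 1)
  Fm_apply : ∀ n ≤ N, ∀ κ : ℝ, κ = l1 - 1 - n → Fm (t n) =
    -((gnP l0 l1 (κ - 1) : ℂ) • t (n + 1)) - coeffA l0 l1 κ • Jm (t n)
      - ((gnP l0 l1 κ : ℂ) / ((2 * κ + 2) * (2 * κ + 1))) • Jm (Jm (t (n - 1)))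
  F3_apply : ∀ n ≤ N, ∀ κ : ℝ, κ = l1 - 1 - n → F3 (t n) =
    -((κ * coeffA l0 l1 κ) • t n) - ((gnP l0 l1 κ : ℂ) / (2 * κ + 2)) • Jm (t (n - 1))

/-- One level of the tower, with the properties of the candidate for the next level. -/
structure TowerLevel (Jp Jm J3 Fp Fm : Module.End ℂ V) (l0 l1 κ : ℝ) (t t' : V) : Prop where
  Jp_apply : Jp t = 0
  J3_apply : J3 t = (κ : ℂ) • t
  Fp_apply : Fp t = (gnP l0 l1 κ : ℂ) • t'
  Jp_prev : Jp t' = 0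
  J3_prev : J3 t' = (κ + 1 : ℂ) • t'
  Jp_next : Jp (LorentzRelations.lowered Jm Fm κ (coeffA l0 l1 κ) (gnP l0 l1 κ) t t') = 0
  J3_next : J3 (LorentzRelations.lowered Jm Fm κ (coeffA l0 l1 κ) (gnP l0 l1 κ) t t') =
    (κ - 1 : ℂ) • LorentzRelations.lowered Jm Fm κ (coeffA l0 l1 κ) (gnP l0 l1 κ) t t'
  Fp_next : Fp (LorentzRelations.lowered Jm Fm κ (coeffA l0 l1 κ) (gnP l0 l1 κ) t t') =
    -((gnP l0 l1 (κ - 1) : ℂ) ^ 2) • t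

variable {Jp Jm J3 Fp Fm F3 : Module.End ℂ V}

theorem ofReal_add_ne_zero {κ b : ℝ} (hκ : 0 ≤ κ) (hb : 0 < b) : (κ : ℂ) + b ≠ 0 := by
  exact_mod_cast (by linarith : κ + b ≠ 0)

/-- The induction step of the tower: the data of one level give the highest weight equations of the
candidate below it, with raising coefficient -P(κ-1)² before normalization. -/
theorem LorentzRelations.towerLevel {l0 l1 κ : ℝ}
    (R : LorentzRelations Jp Jm J3 Fp Fm F3 (-(Complex.I * (l0 * l1))))
    (h0 : |l0| + 1 ≤ κ ∨ |l0| = κ) (h1 : κ + 1 ≤ l1) {t t' t'' : V} {P' : ℂ}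
    (a1 : Jp t = 0) (a2 : J3 t = (κ : ℂ) • t) (a3 : Fp t = (gnP l0 l1 κ : ℂ) • t')
    (a4 : Jp t' = 0) (a5 : J3 t' = (κ + 1 : ℂ) • t') (a6 : Fp t' = P' • t'')
    (a8 : (gnP l0 l1 κ : ℂ) • Fm t' = (gnP l0 l1 κ : ℂ) • (-((gnP l0 l1 κ : ℂ) • t)
      - coeffA l0 l1 (κ + 1) • Jm t' - (P' / ((2 * κ + 4) * (2 * κ + 3))) • Jm (Jm t''))) :
    TowerLevel Jp Jm J3 Fp Fm l0 l1 κ t t' := by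
  have ha := abs_nonneg l0
  have hle : |l0| ≤ κ := by rcases h0 with h | h <;> linarith
  have hκ0 : 0 ≤ κ := ha.trans hle
  have k1 : (κ : ℂ) + 1 ≠ 0 := by simpa using ofReal_add_ne_zero hκ0 one_pos
  have k2 : 2 * (κ : ℂ) + 1 ≠ 0 := by
    simpa using ofReal_add_ne_zero (κ := 2 * κ) (by linarith) one_pos
  have k3 : (κ : ℂ) + 2 ≠ 0 := by simpa using ofReal_add_ne_zero hκ0 two_pos
  have k4 : 2 * (κ : ℂ) + 3 ≠ 0 := by
    simpa using ofReal_add_ne_zero (κ := 2 * κ) (by linarith) three_pos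
  have hA := coeffA_mul l0 l1 hκ0 hle
  have hA' : ((κ : ℂ) + 1) * coeffA l0 l1 (κ + 1) * (κ + 2) = -(-(Complex.I * (l0 * l1))) := by
    have := coeffA_mul l0 l1 (κ := κ + 1) (by linarith) (by linarith)
    push_cast at this
    rw [← this]; ring
  refine ⟨a1, a2, a3, a4, a5, R.Jp_lowered k1 k2 hA a1 a2 a3 a4 a5, R.J3_lowered a2 a5, ?_⟩
  rw [R.Fp_lowered k1 k2 k3 k4 hA hA' a1 a2 a3 a4 a5 a6 a8, coeffA_sq]
  congr 2
  rw [← Complex.ofReal_pow, ← Complex.ofReal_pow, ← gnP_recurrence h0 h1]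
  push_cast
  ring

/-- Dividing each candidate by -P(κ-1), nonzero above spin |l₀|, makes Fp act with coefficient
P(κ-1) and turns the definition of the candidate into the formula for Fm. At spin |l₀| the candidate
must vanish, which is where the uniqueness of the highest weight vector enters. -/
theorem LorentzRelations.isTower {l0 l1 : ℝ} {N : ℕ} {v0 : V}
    (R : LorentzRelations Jp Jm J3 Fp Fm F3 (-(Complex.I * (l0 * l1))))
    (hN : |l0| = l1 - 1 - N) (h1 : Jp v0 = 0) (h2 : Fp v0 = 0)
    (h3 : J3 v0 = ((l1 - 1 : ℝ) : ℂ) • v0)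
    (htop : ∀ v, Jp v = 0 → Fp v = 0 → ∃ z : ℂ, v = z • v0) :
    IsTower Jp Jm J3 Fp Fm F3 l0 l1 N (fun n => (tower Jm Fm v0 l0 l1 n).2) := by
  have ha := abs_nonneg l0
  have hle : ∀ n ≤ N, |l0| ≤ l1 - 1 - n := fun n hn => by
    have : (n : ℝ) ≤ N := by exact_mod_cast hn
    linarith
  have hgap : ∀ n ≤ N, |l0| + 1 ≤ l1 - 1 - n ∨ |l0| = l1 - 1 - n := fun n hn => by
    rcases hn.lt_or_eq with h | h
    · left
      have : (n : ℝ) + 1 ≤ N := by exact_mod_cast h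
      linarith
    · right; rw [h, hN]
  have hPne : ∀ n < N, (gnP l0 l1 (l1 - 1 - n - 1) : ℂ) ≠ 0 := fun n hn => by
    have : (n : ℝ) + 1 ≤ N := by exact_mod_cast hn
    have h0 : (0 : ℝ) ≤ n := n.cast_nonneg
    exact_mod_cast gnP_ne_zero (by linarith) (by linarith) (by linarith)
  have key : ∀ n ≤ N, TowerLevel Jp Jm J3 Fp Fm l0 l1 (l1 - 1 - n)
      (tower Jm Fm v0 l0 l1 n).2 (tower Jm Fm v0 l0 l1 n).1 := by
    intro n
    induction n with
    | zero =>
      intro hn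
      rw [Nat.cast_zero, sub_zero]
      have := hgap 0 hn
      rw [Nat.cast_zero, sub_zero] at this
      -- The top has no predecessor: t' = 0, and its coefficient P(l₁ - 1) is zero.
      refine R.towerLevel (t'' := 0) (P' := 0) this (by linarith) h1 h3 ?_ ?_ ?_ ?_ ?_
      · rw [gnP_top]; simpa [tower] using h2
      · simp [tower]
      · simp [tower]
      · simp [tower]
      · rw [gnP_top]; simp
    | succ n ih =>
      intro hn
      have hκ1 : l1 - 1 - (n : ℝ) = (l1 - 1 - (n + 1 : ℕ)) + 1 := by push_cast; ring
      have hPn := hPne n hn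
      have T := ih (by omega)
      have hg := hgap _ hn
      have h0 : (0 : ℝ) ≤ (n + 1 : ℕ) := (n + 1).cast_nonneg
      simp only [tower]
      rw [hκ1] at T hPn ⊢
      set κ : ℝ := l1 - 1 - (n + 1 : ℕ)
      rw [add_sub_cancel_right] at hPn ⊢
      set t := (tower Jm Fm v0 l0 l1 n).2
      set t' := (tower Jm Fm v0 l0 l1 n).1
      obtain ⟨b1, b2, b3, b4, b5, b6, b7, b8⟩ := T
      rw [add_sub_cancel_right] at b8
      refine R.towerLevel (t'' := t') (P' := gnP l0 l1 (κ + 1)) hg (by linarith) ?_ ?_ ?_ b1 ?_ b3 ?_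
      · rw [map_smul, b6, smul_zero]
      · rw [map_smul, b7]; push_cast; module
      · rw [map_smul, b8, smul_smul]; congr 1; field_simp
      · rw [b2]; push_cast; rfl
      · congr 1
        rw [smul_smul, inv_neg, mul_neg, mul_inv_cancel₀ hPn, LorentzRelations.lowered]
        have e1 : 2 * ((κ + 1 : ℝ) : ℂ) + 2 = 2 * κ + 4 := by push_cast; ring
        have e2 : 2 * ((κ + 1 : ℝ) : ℂ) + 1 = 2 * κ + 3 := by push_cast; ring
        rw [e1, e2]
        module
  -- The stored predecessor and `t (n - 1)` differ only at n = 0, where the coefficient in front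
  -- vanishes.
  have key1 : ∀ n ≤ N, gnP l0 l1 (l1 - 1 - n) ≠ 0 → (tower Jm Fm v0 l0 l1 n).1 =
      (tower Jm Fm v0 l0 l1 (n - 1)).2 := by
    rintro (_ | n) hn h
    · simp [gnP_top] at h
    · rfl
  have key2 : ∀ n ≤ N, ∀ κ : ℝ, κ = l1 - 1 - n → ∃ t', (gnP l0 l1 κ : ℂ) • t' =
      (gnP l0 l1 κ : ℂ) • (tower Jm Fm v0 l0 l1 (n - 1)).2 ∧
      TowerLevel Jp Jm J3 Fp Fm l0 l1 κ (tower Jm Fm v0 l0 l1 n).2 t' ∧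
      (tower Jm Fm v0 l0 l1 n).1 = t' := by
    rintro n hn κ rfl
    refine ⟨_, ?_, key n hn, rfl⟩
    by_cases h : gnP l0 l1 (l1 - 1 - n) = 0
    · simp [h]
    · rw [key1 n hn h]
  refine ⟨fun n hn => (key n hn).Jp_apply, fun n hn κ hκ => hκ ▸ (key n hn).J3_apply, fun n hn κ hκ => ?_,
    fun n hn κ hκ => ?_, fun n hn κ hκ => ?_⟩
  · obtain ⟨t', e, T, -⟩ := key2 n hn κ hκ
    rw [T.Fp_apply, e]
  · obtain ⟨t', e, T, ht'⟩ := key2 n hn κ hκ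
    have low : LorentzRelations.lowered Jm Fm κ (coeffA l0 l1 κ) (gnP l0 l1 κ)
        (tower Jm Fm v0 l0 l1 n).2 t' =
        -((gnP l0 l1 (κ - 1) : ℂ) • (tower Jm Fm v0 l0 l1 (n + 1)).2) := by
      rcases hn.lt_or_eq with h | h
      · have := hPne n h
        rw [← hκ] at this
        simp only [tower]
        rw [← hκ, ht', smul_smul, inv_neg, mul_neg, mul_inv_cancel₀ this]
        module
      -- At the bottom the candidate is killed by Jp and Fp, so it is a multiple of v0; but its
      -- weight κ - 1 is not l₁ - 1.
      · have hκl : κ = |l0| := by rw [hκ, h, hN]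
        have hP : gnP l0 l1 (κ - 1) = 0 := by rw [hκl, gnP_abs]
        rw [hP]
        obtain ⟨z, hz⟩ := htop _ T.Jp_next (by rw [T.Fp_next, hP]; simp)
        have h5 := T.J3_next
        rw [hz, map_smul, h3] at h5
        have h6 : ((l1 - 1 - (κ - 1) : ℝ) : ℂ) • (z • v0) = 0 := by
          push_cast at h5 ⊢
          rw [sub_smul, ← h5]; module
        have h7 : l1 - 1 - (κ - 1) ≠ 0 := by
          rw [hκ]; have := n.cast_nonneg (α := ℝ); linarith
        rw [hz, (smul_eq_zero.1 h6).resolve_left (by exact_mod_cast h7)]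
        simp
    -- Only the products P t' and P t (n - 1) are known to agree, so P has to be moved inside the
    -- operators.
    have e2 : ((gnP l0 l1 κ : ℂ) / ((2 * κ + 2) * (2 * κ + 1))) •
        Jm (Jm (tower Jm Fm v0 l0 l1 (n - 1)).2) =
        ((gnP l0 l1 κ : ℂ) / ((2 * κ + 2) * (2 * κ + 1))) • Jm (Jm t') := by
      rw [div_eq_inv_mul, mul_smul, mul_smul, ← map_smul Jm (gnP l0 l1 κ : ℂ),
        ← map_smul Jm (gnP l0 l1 κ : ℂ), ← e, map_smul, map_smul]
    rw [e2, ← low, LorentzRelations.lowered]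
    module
  · obtain ⟨t', e, T, -⟩ := key2 n hn κ hκ
    have hκ0 : 0 ≤ κ := hκ ▸ ha.trans (hle n hn)
    have k1 : (κ : ℂ) + 1 ≠ 0 := by simpa using ofReal_add_ne_zero hκ0 one_pos
    rw [R.F3_highest k1 T.Jp_apply T.J3_apply T.Fp_apply]
    have hA := coeffA_mul l0 l1 hκ0 (hκ ▸ hle n hn)
    have e2 : ((gnP l0 l1 κ : ℂ) / (2 * κ + 2)) • Jm (tower Jm Fm v0 l0 l1 (n - 1)).2 =
        ((gnP l0 l1 κ : ℂ) / (2 * κ + 2)) • Jm t' := by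
      rw [div_eq_inv_mul, mul_smul, mul_smul, ← map_smul, ← e, map_smul]
    rw [e2, ← neg_eq_iff_eq_neg.2 hA, neg_div, mul_div_cancel_right₀ _ k1, neg_smul]

end Tower

/-! ### The Gel'fand–Naimark basis and its formulas. -/

theorem rt_mul {x : ℝ} (hx : 0 ≤ x) (y : ℝ) : rt (x * y) = rt x * rt y := by
  rw [rt, Real.sqrt_mul hx]; push_cast; rfl

theorem rt_mul' (x : ℝ) {y : ℝ} (hy : 0 ≤ y) : rt (x * y) = rt x * rt y := by
  rw [mul_comm, rt_mul hy, mul_comm]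

theorem rt_sq {x : ℝ} (hx : 0 ≤ x) : rt x * rt x = x := by
  rw [rt, ← Complex.ofReal_mul, Real.mul_self_sqrt hx]

theorem rt_zero : rt 0 = 0 := by simp [rt]

theorem rt_ne_zero {x : ℝ} (hx : 0 < x) : rt x ≠ 0 := by
  rw [rt]; exact_mod_cast (Real.sqrt_pos.2 hx).ne'

section GN

variable {V : Type} [AddCommGroup V] [Module ℂ V] {Jp Jm J3 Fp Fm F3 : Module.End ℂ V}

/-- The normalized vectors `J₋ᵐ t` in a representation of spin `κ`. -/
def descend (Jm : Module.End ℂ V) (κ : ℝ) (t : V) : ℕ → V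
  | 0 => t
  | m + 1 => (rt ((2 * κ - m) * (m + 1)))⁻¹ • Jm (descend Jm κ t m)

open Classical in
/-- The Gel'fand–Naimark basis attached to a tower of highest weight vectors. -/
def gnBasis (Jm : Module.End ℂ V) (l1 : ℝ) (N : ℕ) (t : ℕ → V) (κ ν : ℝ) : V :=
  if h : ∃ p : ℕ × ℕ, p.1 ≤ N ∧ κ = l1 - 1 - p.1 ∧ ν = κ - p.2 then
    descend Jm κ (t h.choose.1) h.choose.2 else 0

theorem gnBasis_eq (Jm : Module.End ℂ V) {l1 : ℝ} {N : ℕ} (t : ℕ → V) {κ ν : ℝ} {n m : ℕ}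
    (hn : n ≤ N) (hκ : κ = l1 - 1 - n) (hν : ν = κ - m) :
    gnBasis Jm l1 N t κ ν = descend Jm κ (t n) m := by
  have h : ∃ p : ℕ × ℕ, p.1 ≤ N ∧ κ = l1 - 1 - p.1 ∧ ν = κ - p.2 := ⟨(n, m), hn, hκ, hν⟩
  obtain ⟨-, h1, h2⟩ := h.choose_spec
  have e1 : h.choose.1 = n := by
    have : (h.choose.1 : ℝ) = n := by linarith
    exact_mod_cast this
  have e2 : h.choose.2 = m := by
    have : (h.choose.2 : ℝ) = m := by linarith
    exact_mod_cast this
  rw [gnBasis, dif_pos h, e1, e2]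

theorem gnBasis_eq_zero (Jm : Module.End ℂ V) {l1 : ℝ} {N : ℕ} (t : ℕ → V) {κ ν : ℝ}
    (h : ¬ ∃ n m : ℕ, n ≤ N ∧ κ = l1 - 1 - n ∧ ν = κ - m) :
    gnBasis Jm l1 N t κ ν = 0 :=
  dif_neg fun ⟨p, hp⟩ => h ⟨p.1, p.2, hp⟩

theorem gnBasis_top (Jm : Module.End ℂ V) {l1 : ℝ} {N : ℕ} (t : ℕ → V) {κ : ℝ} {n : ℕ}
    (hn : n ≤ N) (hκ : κ = l1 - 1 - n) : gnBasis Jm l1 N t κ κ = t n := by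
  rw [gnBasis_eq Jm t (m := 0) hn hκ (by simp), descend]

/-- Below the bottom weight both sides are zero: the left by `hbot`, the right because `descend` is
then built from the zero vector. Hence no bound on m is needed. -/
theorem descend_lower {κ : ℝ} {t : V} {M : ℕ} (hM : 2 * κ = M)
    (hbot : (Jm ^ (M + 1)) t = 0) (m : ℕ) :
    Jm (descend Jm κ t m) = rt ((2 * κ - m) * (m + 1)) • descend Jm κ t (m + 1) := by
  rcases lt_or_ge m M with h | h
  · have h' : (m : ℝ) < M := by exact_mod_cast h
    rw [descend, smul_smul, mul_inv_cancel₀, one_smul]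
    exact rt_ne_zero (mul_pos (by linarith) (by positivity))
  · have hpow : ∀ m, ∃ z : ℂ, descend Jm κ t m = z • (Jm ^ m) t := by
      intro m
      induction m with
      | zero => exact ⟨1, by simp [descend]⟩
      | succ m ih =>
        obtain ⟨z, hz⟩ := ih
        refine ⟨(rt ((2 * κ - m) * (m + 1)))⁻¹ * z, ?_⟩
        rw [descend, hz, map_smul, smul_smul, pow_succ']
        rfl
    have h0 : Jm (descend Jm κ t m) = 0 := by
      obtain ⟨z, hz⟩ := hpow m
      rw [hz, map_smul, ← Module.End.mul_apply, ← pow_succ']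
      obtain ⟨j, rfl⟩ := Nat.exists_eq_add_of_le h
      rw [show M + j + 1 = j + (M + 1) by ring, pow_add, Module.End.mul_apply, hbot, map_zero,
        smul_zero]
    rw [descend, h0, smul_zero, smul_zero]

/-- Valid for all real κ and ν, also off the index set; this spares case distinctions later. -/
theorem gnBasis_lower {l1 : ℝ} {N M : ℕ} {t : ℕ → V} (hM : 2 * (l1 - 1) = M) (hNM : 2 * N ≤ M)
    (hbot : ∀ n ≤ N, (Jm ^ (M - 2 * n + 1)) (t n) = 0) (κ ν : ℝ) :
    Jm (gnBasis Jm l1 N t κ ν) = rt ((κ + ν) * (κ - ν + 1)) • gnBasis Jm l1 N t κ (ν - 1) := by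
  by_cases h : ∃ n m : ℕ, n ≤ N ∧ κ = l1 - 1 - n ∧ ν = κ - m
  · obtain ⟨n, m, hn, hκ, hν⟩ := h
    rw [gnBasis_eq Jm t hn hκ hν, gnBasis_eq Jm t (ν := ν - 1) (m := m + 1) hn hκ
      (by rw [hν]; push_cast; ring), descend_lower (M := M - 2 * n) _ (hbot n hn)]
    · congr 2; rw [hν]; ring
    · rw [Nat.cast_sub (by omega)]; push_cast; rw [← hM, hκ]; ring
  · rw [gnBasis_eq_zero Jm t h, map_zero]
    -- The one place where ν - 1 is an index but ν is not is ν = κ + 1, and there the coefficient is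
    -- zero.
    by_cases h' : κ - ν + 1 = 0
    · rw [h', mul_zero, rt_zero, zero_smul]
    · rw [gnBasis_eq_zero, smul_zero]
      rintro ⟨n, m, hn, hκ, hν⟩
      rcases m with _ | m
      · apply h'; rw [Nat.cast_zero] at hν; linarith
      · exact h ⟨n, m, hn, hκ, by push_cast at hν; linarith⟩

/-- The Gel'fand–Naimark formulas at `(κ, ν)`. -/
structure GNFormulas (Jp J3 Fp Fm F3 : Module.End ℂ V) (C C' A : ℂ) (ξ : ℝ → ℝ → V) (κ ν : ℝ) :
    Prop where
  J3_apply : J3 (ξ κ ν) = (ν : ℂ) • ξ κ ν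
  Jp_apply : Jp (ξ κ ν) = rt ((κ + ν + 1) * (κ - ν)) • ξ κ (ν + 1)
  F3_apply : F3 (ξ κ ν) = (C * rt (κ ^ 2 - ν ^ 2)) • ξ (κ - 1) ν - (A * (ν : ℂ)) • ξ κ ν
    - (C' * rt ((κ + 1) ^ 2 - ν ^ 2)) • ξ (κ + 1) ν
  Fp_apply : Fp (ξ κ ν) = (C * rt ((κ - ν) * (κ - ν - 1))) • ξ (κ - 1) (ν + 1)
    - (A * rt ((κ - ν) * (κ + ν + 1))) • ξ κ (ν + 1)
    + (C' * rt ((κ + ν + 1) * (κ + ν + 2))) • ξ (κ + 1) (ν + 1)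
  Fm_apply : Fm (ξ κ ν) = -((C * rt ((κ + ν) * (κ + ν - 1))) • ξ (κ - 1) (ν - 1))
    - (A * rt ((κ + ν) * (κ - ν + 1))) • ξ κ (ν - 1)
    - (C' * rt ((κ - ν + 1) * (κ - ν + 2))) • ξ (κ + 1) (ν - 1)

/-- The vector at ν - 1 is a nonzero multiple of Jm applied to the one at ν. Each formula follows by
moving its operator past Jm, applying the formulas at ν, and comparing coefficients as products of
square roots. -/
theorem GNFormulas.step {c : ℂ} (R : LorentzRelations Jp Jm J3 Fp Fm F3 c) {C C' A : ℂ}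
    {ξ : ℝ → ℝ → V} {κ ν : ℝ}
    (hJ : ∀ κ ν, Jm (ξ κ ν) = rt ((κ + ν) * (κ - ν + 1)) • ξ κ (ν - 1))
    (h1 : 1 ≤ κ + ν) (h2 : κ = ν ∨ 1 ≤ κ - ν) (G : GNFormulas Jp J3 Fp Fm F3 C C' A ξ κ ν) :
    GNFormulas Jp J3 Fp Fm F3 C C' A ξ κ (ν - 1) := by
  have h3 : 0 ≤ κ - ν := by rcases h2 with h | h <;> linarith
  obtain ⟨g1, g2, g3, g4, g5⟩ := G
  have e (x y z : ℝ) (hx : 0 ≤ x) (h : z = x * y) : rt z = rt x * rt y := by rw [h, rt_mul hx]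
  have e' (x y z : ℝ) (hx : 0 ≤ y) (h : z = x * y) : rt z = rt x * rt y := by rw [h, rt_mul' _ hx]
  have hs : rt (κ + ν) * rt (κ - ν + 1) ≠ 0 :=
    mul_ne_zero (rt_ne_zero (by linarith)) (rt_ne_zero (by linarith))
  have a0 := rt_sq (x := κ + ν) (by linarith)
  have am := rt_sq (x := κ + ν - 1) (by linarith)
  have ap := rt_sq (x := κ + ν + 1) (by linarith)
  have ap2 := rt_sq (x := κ + ν + 2) (by linarith)
  have b0 := rt_sq (x := κ - ν) (by linarith)
  have b1 := rt_sq (x := κ - ν + 1) (by linarith)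
  have b2 := rt_sq (x := κ - ν + 2) (by linarith)
  -- At ν = κ the number κ - ν - 1 is negative and its `rt` does not square back; the factor `rt (κ
  -- - ν)` is then zero.
  have bm : rt (κ - ν) * (rt (κ - ν - 1) * rt (κ - ν - 1)) = rt (κ - ν) * (κ - ν - 1) := by
    rcases h2 with h | h
    · rw [h, sub_self, rt_zero]; simp
    · rw [rt_sq (by linarith)]; push_cast; rfl
  have J1 := hJ κ ν
  rw [e (κ + ν) (κ - ν + 1) _ (by linarith) rfl] at J1
  have Jx : (rt (κ + ν) * rt (κ - ν + 1)) • ξ κ (ν - 1) = Jm (ξ κ ν) := J1.symm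
  have n1 : ν - 1 + 1 = ν := by ring
  have n2 : ν + 1 - 1 = ν := by ring
  rw [e (κ + ν + 1) (κ - ν) _ (by linarith) rfl] at g2
  rw [e (κ + ν) (κ - ν) _ (by linarith) (by ring : κ ^ 2 - ν ^ 2 = _),
    e (κ + ν + 1) (κ - ν + 1) _ (by linarith) (by ring : (κ + 1) ^ 2 - ν ^ 2 = _)] at g3
  rw [e (κ - ν) (κ - ν - 1) _ h3 rfl, e (κ - ν) (κ + ν + 1) _ h3 rfl,
    e (κ + ν + 1) (κ + ν + 2) _ (by linarith) rfl] at g4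
  rw [e (κ + ν) (κ + ν - 1) _ (by linarith) rfl, e (κ + ν) (κ - ν + 1) _ (by linarith) rfl,
    e (κ - ν + 1) (κ - ν + 2) _ (by linarith) rfl] at g5
  have q1 := hJ (κ - 1) ν
  rw [e (κ + ν - 1) (κ - ν) _ (by linarith) (by ring : (κ - 1 + ν) * (κ - 1 - ν + 1) = _)] at q1
  have q2 := hJ (κ - 1) (ν + 1)
  rw [e (κ + ν) (κ - ν - 1) _ (by linarith) (by ring : (κ - 1 + (ν + 1)) * (κ - 1 - (ν + 1) + 1) = _), n2] at q2
  have q3 := hJ (κ - 1) (ν - 1)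
  -- Here κ + ν - 2 may be negative, so the root is split by the sign of the other factor.
  rw [e' (κ + ν - 2) (κ - ν + 1) _ (by linarith) (by ring : (κ - 1 + (ν - 1)) * (κ - 1 - (ν - 1) + 1) = _)] at q3
  have q4 := hJ κ (ν + 1)
  rw [e (κ + ν + 1) (κ - ν) _ (by linarith) (by ring : (κ + (ν + 1)) * (κ - (ν + 1) + 1) = _), n2] at q4
  have q5 := hJ κ (ν - 1)
  rw [e (κ + ν - 1) (κ - ν + 2) _ (by linarith) (by ring : (κ + (ν - 1)) * (κ - (ν - 1) + 1) = _)] at q5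
  have q6 := hJ (κ + 1) (ν + 1)
  rw [e (κ + ν + 2) (κ - ν + 1) _ (by linarith) (by ring : (κ + 1 + (ν + 1)) * (κ + 1 - (ν + 1) + 1) = _), n2] at q6
  have q7 := hJ (κ + 1) ν
  rw [e (κ + ν + 1) (κ - ν + 2) _ (by linarith) (by ring : (κ + 1 + ν) * (κ + 1 - ν + 1) = _)] at q7
  have q8 := hJ (κ + 1) (ν - 1)
  rw [e (κ + ν) (κ - ν + 3) _ (by linarith) (by ring : (κ + 1 + (ν - 1)) * (κ + 1 - (ν - 1) + 1) = _)] at q8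
  push_cast at a0 am ap ap2 b0 b1 b2
  refine ⟨?_, ?_, ?_, ?_, ?_⟩ <;> apply smul_right_injective V hs <;>
    simp only [← map_smul, Jx]
  · rw [R.J3Jm, g1, map_smul, J1]
    push_cast
    module
  · rw [R.JpJm, g1, g2, map_smul, q4, n1, e (κ + ν) (κ - ν + 1) _ (by linarith) (by ring : (κ + (ν - 1) + 1) * (κ - (ν - 1)) = _)]
    match_scalars
    linear_combination (rt (κ - ν) * rt (κ - ν)) * ap + (κ + ν + 1) * b0 -
      (rt (κ - ν + 1) * rt (κ - ν + 1)) * a0 - (κ + ν) * b1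
  · rw [R.F3Jm, g3, g5, map_sub, map_sub, map_smul, map_smul, map_smul, q1, q7, J1,
      e (κ + ν - 1) (κ - ν + 1) _ (by linarith) (by ring : κ ^ 2 - (ν - 1) ^ 2 = _),
      e (κ + ν) (κ - ν + 2) _ (by linarith) (by ring : (κ + 1) ^ 2 - (ν - 1) ^ 2 = _)]
    push_cast
    match_scalars
    · linear_combination C * rt (κ + ν) * rt (κ + ν - 1) * (b0 - b1)
    · ring
    · linear_combination C' * rt (κ - ν + 1) * rt (κ - ν + 2) * (a0 - ap)
  · rw [R.FpJm, g4, g3, map_add, map_sub, map_smul, map_smul, map_smul, q2, q4, q6, n1,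
      e (κ - ν + 1) (κ - ν) _ (by linarith) (by ring : (κ - (ν - 1)) * (κ - (ν - 1) - 1) = _),
      e (κ - ν + 1) (κ + ν) _ (by linarith) (by ring : (κ - (ν - 1)) * (κ + (ν - 1) + 1) = _),
      e (κ + ν) (κ + ν + 1) _ (by linarith) (by ring : (κ + (ν - 1) + 1) * (κ + (ν - 1) + 2) = _)]
    match_scalars
    · linear_combination C * rt (κ + ν) * bm - C * rt (κ + ν) * rt (κ - ν) * b1
    · linear_combination -A * rt (κ - ν) * rt (κ - ν) * ap - A * (κ + ν + 1) * b0 +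
        A * rt (κ + ν) * rt (κ + ν) * b1 + A * (κ - ν + 1) * a0
    · linear_combination C' * rt (κ + ν + 1) * rt (κ - ν + 1) * (ap2 - a0)
  · rw [R.FmJm, g5, map_sub, map_sub, map_neg, map_smul, map_smul, map_smul, q3, q5, q8,
      e (κ + ν - 1) (κ + ν - 2) _ (by linarith) (by ring : (κ + (ν - 1)) * (κ + (ν - 1) - 1) = _),
      e (κ + ν - 1) (κ - ν + 2) _ (by linarith) (by ring : (κ + (ν - 1)) * (κ - (ν - 1) + 1) = _),
      e (κ - ν + 2) (κ - ν + 3) _ (by linarith) (by ring : (κ - (ν - 1) + 1) * (κ - (ν - 1) + 2) = _)]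
    module

/-- Induction on the distance m from the highest weight: at ν = κ the formulas are those of the
tower, and `GNFormulas.step` lowers ν. -/
theorem IsTower.gnFormulas {l0 l1 : ℝ} {N M : ℕ} {t : ℕ → V} {c : ℂ}
    (R : LorentzRelations Jp Jm J3 Fp Fm F3 c)
    (T : IsTower Jp Jm J3 Fp Fm F3 l0 l1 N t) (hN : |l0| = l1 - 1 - N)
    (hM : 2 * (l1 - 1) = M) (hbot : ∀ n ≤ N, (Jm ^ (M - 2 * n + 1)) (t n) = 0)
    {κ : ℝ} {n m : ℕ} (hn : n ≤ N) (hκ : κ = l1 - 1 - n) (hm : (m : ℝ) ≤ 2 * κ) :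
    GNFormulas Jp J3 Fp Fm F3 (coeffC l0 l1 κ) (coeffC l0 l1 (κ + 1)) (coeffA l0 l1 κ)
      (gnBasis Jm l1 N t) κ (κ - m) := by
  have ha := abs_nonneg l0
  have hnN : (n : ℝ) ≤ N := by exact_mod_cast hn
  have hn0 : (0 : ℝ) ≤ n := n.cast_nonneg
  have hκ0 : 0 ≤ κ := by linarith
  have hNM : 2 * N ≤ M := by
    have : (2 * N : ℝ) ≤ M := by linarith
    exact_mod_cast this
  have hJ := gnBasis_lower hM hNM hbot
  induction m with
  | succ m ih =>
    push_cast at hm ⊢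
    rw [← sub_sub]
    refine (ih (by linarith)).step R hJ (by linarith) ?_
    rcases m with _ | m
    · left; simp
    · right; push_cast; have := m.cast_nonneg (α := ℝ); linarith
  | zero =>
    rw [Nat.cast_zero, sub_zero]
    have e (x y z : ℝ) (hx : 0 ≤ x) (h : z = x * y) : rt z = rt x * rt y := by rw [h, rt_mul hx]
    have hC' : coeffC l0 l1 (κ + 1) = gnC l0 l1 (κ + 1) :=
      coeffC_eq (by linarith) (by linarith) (Or.inl (by linarith))
    have hC : coeffC l0 l1 κ = gnC l0 l1 κ := by
      refine coeffC_eq (by linarith) (by linarith) ?_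
      rcases hn.lt_or_eq with h | h
      · left
        have : (n : ℝ) + 1 ≤ N := by exact_mod_cast h
        linarith
      · right; rw [hκ, h, hN]
    have htn := gnBasis_top Jm t hn hκ
    have hP : (gnP l0 l1 κ : ℂ) = coeffC l0 l1 (κ + 1) * (rt (2 * κ + 2) * rt (2 * κ + 1)) := by
      rw [← rt_mul (by linarith), hC', gnP, rt]; push_cast; rfl
    -- For n = N both coefficients vanish, so the vectors beyond the tower do not matter.
    have hP' : (gnP l0 l1 (κ - 1) : ℂ) • t (n + 1) =
        (coeffC l0 l1 κ * rt ((κ + κ) * (κ + κ - 1))) • gnBasis Jm l1 N t (κ - 1) (κ - 1) := by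
      rw [hC, gnP, sub_add_cancel]
      rcases hn.lt_or_eq with h | h
      · rw [gnBasis_top Jm t (n := n + 1) h (by rw [hκ]; push_cast; ring), rt]
        congr 1
        rw [Complex.ofReal_mul, show (2 * (κ - 1) + 2) * (2 * (κ - 1) + 1) =
          (κ + κ) * (κ + κ - 1) by ring]
      · have : κ = |l0| := by rw [hκ, h, hN]
        rw [this, gnC_abs]; simp
    have hprev : (gnP l0 l1 κ : ℂ) • t (n - 1) =
        (gnP l0 l1 κ : ℂ) • gnBasis Jm l1 N t (κ + 1) (κ + 1) := by
      rcases n with _ | n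
      · have : κ = l1 - 1 := by rw [hκ]; simp
        rw [this, gnP_top]; simp
      · rw [gnBasis_top Jm t (n := n) (by omega) (by rw [hκ]; push_cast; ring)]; rfl
    have hprev' (z : ℂ) (f : Module.End ℂ V) : ((gnP l0 l1 κ : ℂ) / z) • f (t (n - 1)) =
        ((gnP l0 l1 κ : ℂ) / z) • f (gnBasis Jm l1 N t (κ + 1) (κ + 1)) := by
      rw [div_eq_inv_mul, mul_smul, mul_smul, ← map_smul f, hprev, map_smul]
    have a2 := rt_sq (x := 2 * κ + 2) (by linarith)
    have a1 := rt_sq (x := 2 * κ + 1) (by linarith)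
    have n2 : rt (2 * κ + 2) ≠ 0 := rt_ne_zero (by linarith)
    have n1 : rt (2 * κ + 1) ≠ 0 := rt_ne_zero (by linarith)
    push_cast at a1 a2
    have J1 := hJ (κ + 1) (κ + 1)
    rw [show (κ + 1 + (κ + 1)) * (κ + 1 - (κ + 1) + 1) = 2 * κ + 2 by ring, add_sub_cancel_right]
      at J1
    have J2 := hJ (κ + 1) κ
    rw [e (2 * κ + 1) 2 _ (by linarith) (by ring : (κ + 1 + κ) * (κ + 1 - κ + 1) = _)] at J2
    have z1 : rt (κ ^ 2 - κ ^ 2) = 0 := by rw [sub_self, rt_zero]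
    refine ⟨?_, ?_, ?_, ?_, ?_⟩
    · rw [htn, T.J3_apply n hn κ hκ]
    · rw [htn, T.Jp_apply n hn, sub_self, mul_zero, rt_zero, zero_smul]
    · rw [htn, T.F3_apply n hn κ hκ, hprev', J1, z1, hP, ← a2,
        show (κ + 1) ^ 2 - κ ^ 2 = 2 * κ + 1 by ring, mul_zero, zero_smul]
      generalize rt (2 * κ + 2) = x at n2 ⊢
      generalize rt (2 * κ + 1) = y
      match_scalars
      · ring
      · field_simp
    · rw [htn, T.Fp_apply n hn κ hκ, hprev, hP, sub_self, zero_mul, zero_mul, rt_zero,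
        e (2 * κ + 2) (2 * κ + 1) _ (by linarith)
          (by ring : (κ + κ + 1) * (κ + κ + 2) = _)]
      simp
    · have hJJ := hprev' ((2 * κ + 2) * (2 * κ + 1)) (Jm * Jm)
      simp only [Module.End.mul_apply] at hJJ
      rw [htn, T.Fm_apply n hn κ hκ, hP', hJJ, J1, map_smul,
        J2, ← htn, hJ, hP, ← a2, ← a1, show (κ - κ + 1) * (κ - κ + 2) = 2 by ring]
      generalize rt (2 * κ + 2) = x at n2 ⊢
      generalize rt (2 * κ + 1) = y at n1 ⊢
      match_scalars
      · ring
      · ring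
      · field_simp

end GN

/-! ### Pairs of commuting ladders and the Lorentz relations. -/

section Ladder

variable {V : Type} [AddCommGroup V] [Module ℂ V]

/-- The coefficient with which the raising operator acts on the `a`-th vector of a ladder. -/
def raiseCoeff (k a : ℕ) : ℂ := if a = 0 then 0 else k + 1 - a

theorem raiseCoeff_zero (k : ℕ) : raiseCoeff k 0 = 0 := rfl

theorem raiseCoeff_succ (k a : ℕ) : raiseCoeff k (a + 1) = k - a := by
  simp [raiseCoeff]

/-- The vectors `v 0, …, v k` form an (unnormalized) ladder of spin `k / 2`. -/
structure Ladder (k : ℕ) (Tp Tm T3 : Module.End ℂ V) (v : ℕ → V) : Prop where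
  lower : ∀ a, Tm (v a) = (a + 1 : ℂ) • v (a + 1)
  raise : ∀ a, Tp (v a) = raiseCoeff k a • v (a - 1)
  weight : ∀ a, T3 (v a) = (k / 2 - a : ℂ) • v a
  zero : ∀ a, k < a → v a = 0

/-- The vectors `v a c`, `a ≤ k`, `c ≤ r`, form a basis of the submodule `W` and a ladder of spin
`k / 2` with respect to the operators `X` and of spin `r / 2` with respect to the operators `Y`. -/
structure BiLadder (W : Submodule ℂ V) (k r : ℕ) (X Y : Fin 3 → Module.End ℂ V) (v : ℕ → ℕ → V) :
    Prop where
  left : ∀ c, Ladder k (X 0 + Complex.I • X 1) (X 0 - Complex.I • X 1) (X 2) fun a => v a c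
  right : ∀ a, Ladder r (Y 0 + Complex.I • Y 1) (Y 0 - Complex.I • Y 1) (Y 2) fun c => v a c
  linearIndependent : LinearIndependent ℂ fun p : Fin (k + 1) × Fin (r + 1) => v p.1 p.2
  span_eq : Submodule.span ℂ (Set.range fun p : Fin (k + 1) × Fin (r + 1) => v p.1 p.2) = W

namespace BiLadder

variable {k r : ℕ} {X Y : Fin 3 → Module.End ℂ V} {v : ℕ → ℕ → V}

theorem ext (h : BiLadder ⊤ k r X Y v) {f g : Module.End ℂ V}
    (hfg : ∀ a c, f (v a c) = g (v a c)) : f = g :=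
  LinearMap.ext_on h.span_eq (by rintro _ ⟨p, rfl⟩; exact hfg _ _)

/-- One operator moves the first index with a coefficient depending on it alone, the other does the
same with the second index. -/
theorem commute (h : BiLadder ⊤ k r X Y v) {f g : Module.End ℂ V} {x y : ℕ → ℂ} {s t : ℕ → ℕ}
    (hf : ∀ a c, f (v a c) = x a • v (s a) c) (hg : ∀ a c, g (v a c) = y c • v a (t c)) (u : V) :
    f (g u) = g (f u) := by
  have : f * g = g * f := h.ext fun a c => by
    simp only [Module.End.mul_apply, hf, hg, map_smul]
    rw [smul_comm]
  exact LinearMap.congr_fun this u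

theorem ladder_relations {k : ℕ} {Tp Tm T3 : Module.End ℂ V} {v : ℕ → V} (h : Ladder k Tp Tm T3 v)
    (a : ℕ) : T3 (Tm (v a)) = Tm (T3 (v a)) - Tm (v a) ∧ T3 (Tp (v a)) = Tp (T3 (v a)) + Tp (v a) ∧
      Tp (Tm (v a)) = Tm (Tp (v a)) + (2 : ℂ) • T3 (v a) ∧
      T3 (T3 (v a)) + T3 (v a) + Tm (Tp (v a)) = ((k / 2 : ℂ) * (k / 2 + 1)) • v a := by
  refine ⟨?_, ?_, ?_, ?_⟩
  · simp only [h.lower, h.weight, map_smul]; push_cast; module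
  · rcases a with _ | a
    · simp only [h.raise, h.weight, map_smul, raiseCoeff_zero]; simp
    · simp only [h.raise, h.weight, map_smul, Nat.add_sub_cancel]; push_cast; module
  · rcases a with _ | a
    · simp only [h.raise, h.lower, h.weight, map_smul, raiseCoeff_zero, raiseCoeff_succ]
      simp only [zero_add, Nat.sub_self, Nat.cast_zero, zero_smul]; module
    · simp only [h.raise, h.lower, h.weight, map_smul, raiseCoeff_succ, Nat.add_sub_cancel]
      push_cast; module
  · rcases a with _ | a
    · simp only [h.raise, h.lower, h.weight, map_smul, raiseCoeff_zero]
      simp only [Nat.cast_zero, zero_smul]; module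
    · simp only [h.raise, h.lower, h.weight, map_smul, raiseCoeff_succ, Nat.add_sub_cancel]
      push_cast; module

variable (X) in
/-- The raising operators. -/
abbrev up : Module.End ℂ V := X 0 + Complex.I • X 1

variable (X) in
/-- The lowering operators. -/
abbrev down : Module.End ℂ V := X 0 - Complex.I • X 1

theorem relations (h : BiLadder ⊤ k r X Y v) : 
    ((∀ u, X 2 (down X u) = down X (X 2 u) - down X u) ∧
    (∀ u, X 2 (up X u) = up X (X 2 u) + up X u) ∧
    (∀ u, up X (down X u) = down X (up X u) + (2 : ℂ) • X 2 u) ∧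
    (∀ u, X 2 (X 2 u) + X 2 u + down X (up X u) = ((k / 2 : ℂ) * (k / 2 + 1)) • u)) ∧
    ((∀ u, Y 2 (down Y u) = down Y (Y 2 u) - down Y u) ∧
    (∀ u, Y 2 (up Y u) = up Y (Y 2 u) + up Y u) ∧
    (∀ u, up Y (down Y u) = down Y (up Y u) + (2 : ℂ) • Y 2 u) ∧
    (∀ u, Y 2 (Y 2 u) + Y 2 u + down Y (up Y u) = ((r / 2 : ℂ) * (r / 2 + 1)) • u)) := by
  have ex {f g : Module.End ℂ V} (hfg : ∀ a c, f (v a c) = g (v a c)) (u : V) : f u = g u :=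
    LinearMap.congr_fun (h.ext hfg) u
  refine ⟨⟨?_, ?_, ?_, ?_⟩, ?_, ?_, ?_, ?_⟩
  · exact ex (f := X 2 * down X) (g := down X * X 2 - down X) fun a c =>
      (ladder_relations (h.left c) a).1
  · exact ex (f := X 2 * up X) (g := up X * X 2 + up X) fun a c =>
      (ladder_relations (h.left c) a).2.1
  · exact ex (f := up X * down X) (g := down X * up X + (2 : ℂ) • X 2) fun a c =>
      (ladder_relations (h.left c) a).2.2.1
  · exact ex (f := X 2 * X 2 + X 2 + down X * up X) (g := ((k / 2 : ℂ) * (k / 2 + 1)) • 1)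
      fun a c => (ladder_relations (h.left c) a).2.2.2
  · exact ex (f := Y 2 * down Y) (g := down Y * Y 2 - down Y) fun a c =>
      (ladder_relations (h.right a) c).1
  · exact ex (f := Y 2 * up Y) (g := up Y * Y 2 + up Y) fun a c =>
      (ladder_relations (h.right a) c).2.1
  · exact ex (f := up Y * down Y) (g := down Y * up Y + (2 : ℂ) • Y 2) fun a c =>
      (ladder_relations (h.right a) c).2.2.1
  · exact ex (f := Y 2 * Y 2 + Y 2 + down Y * up Y) (g := ((r / 2 : ℂ) * (r / 2 + 1)) • 1)
      fun a c => (ladder_relations (h.right a) c).2.2.2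

variable (X Y) in
/-- The rotation operators `J = X + Y`. -/
abbrev J : Fin 3 → Module.End ℂ V := fun j => X j + Y j

variable (X Y) in
/-- The boost operators `F = i (Y - X)`. -/
abbrev F : Fin 3 → Module.End ℂ V := fun j => Complex.I • (Y j - X j)

theorem up_J : up (J X Y) = up X + up Y := by simp only [up, J]; module
theorem down_J : down (J X Y) = down X + down Y := by simp only [down, J]; module
theorem up_F : up (F X Y) = Complex.I • (up Y - up X) := by simp only [up, F]; module
theorem down_F : down (F X Y) = Complex.I • (down Y - down X) := by simp only [down, F]; module

/-- The relations follow from those of the two commuting sl₂. The Casimir value is i times the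
difference of the spin Casimirs, i((r/2)(r/2 + 1) - (k/2)(k/2 + 1)), which factors as -i l₀l₁. -/
theorem lorentzRelations (h : BiLadder ⊤ k r X Y v) :
    LorentzRelations (up (J X Y)) (down (J X Y)) (J X Y 2) (up (F X Y)) (down (F X Y)) (F X Y 2)
      (-(Complex.I * ((((k - r) / 2 : ℝ) : ℂ) * (((k + r) / 2 + 1 : ℝ) : ℂ)))) := by
  obtain ⟨⟨x1, x2, x3, x4⟩, y1, y2, y3, y4⟩ := h.relations
  have l1 := fun a c => (h.left c).lower a
  have l2 := fun a c => (h.left c).raise a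
  have l3 := fun a c => (h.left c).weight a
  have r1 := fun a c => (h.right a).lower c
  have r2 := fun a c => (h.right a).raise c
  have r3 := fun a c => (h.right a).weight c
  have cmm := h.commute (s := fun a => a + 1) (t := fun a => a + 1) l1 r1
  have cmp := h.commute (s := fun a => a + 1) (t := fun a => a - 1) l1 r2
  have cm3 := h.commute (s := fun a => a + 1) (t := fun a => a) l1 r3
  have cpm := h.commute (s := fun a => a - 1) (t := fun a => a + 1) l2 r1
  have c3m := h.commute (s := fun a => a) (t := fun a => a + 1) l3 r1
  have c33 := h.commute (s := fun a => a) (t := fun a => a) l3 r3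
  rw [up_J, down_J, up_F, down_F]
  simp only [J, F]
  change ∀ u, down X (down Y u) = down Y (down X u) at cmm
  change ∀ u, down X (up Y u) = up Y (down X u) at cmp
  change ∀ u, down X (Y 2 u) = Y 2 (down X u) at cm3
  change ∀ u, up X (down Y u) = down Y (up X u) at cpm
  change ∀ u, X 2 (down Y u) = down Y (X 2 u) at c3m
  generalize up X = Xp at *
  generalize down X = Xm at *
  generalize up Y = Yp at *
  generalize down Y = Ym at *
  have x4' : ∀ u, Xm (Xp u) = ((k / 2 : ℂ) * (k / 2 + 1)) • u - X 2 (X 2 u) - X 2 u := fun u => by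
    rw [← x4 u]; abel
  have y4' : ∀ u, Ym (Yp u) = ((r / 2 : ℂ) * (r / 2 + 1)) • u - Y 2 (Y 2 u) - Y 2 u := fun u => by
    rw [← y4 u]; abel
  constructor <;> intro u <;>
    simp only [LinearMap.add_apply, LinearMap.smul_apply, LinearMap.sub_apply, map_add, map_sub,
      map_smul, x1, x3, y1, y3, cmm, cmp, cm3, cpm, c3m, c33, x4', y4', smul_add, smul_sub,
      smul_smul, Complex.I_mul_I]
  any_goals module
  match_scalars <;> first | ring1 | linear_combination 2 * Complex.I_mul_I

end BiLadder
end Ladder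

/-! ### Highest weight vectors and invariant subspaces of a pair of ladders. -/

section

variable {V : Type} [AddCommGroup V] [Module ℂ V]

theorem exists_pow_apply_eq_zero {f : Module.End ℂ V} {n : ℕ} (hf : f ^ n = 0) {w : V}
    (hw : w ≠ 0) : ∃ j, (f ^ j) w ≠ 0 ∧ f ((f ^ j) w) = 0 := by
  obtain ⟨j, h1, h2⟩ := Nat.exists_not_and_succ_of_not_zero_of_exists
    (p := fun j => (f ^ j) w = 0) (by simpa using hw) ⟨n, by rw [hf]; rfl⟩
  exact ⟨j, h1, by rwa [← Module.End.mul_apply, ← pow_succ']⟩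

theorem pow_apply_mem {f : Module.End ℂ V} {W : Submodule ℂ V} (hf : ∀ w ∈ W, f w ∈ W) {w : V}
    (hw : w ∈ W) (j : ℕ) : (f ^ j) w ∈ W := by
  induction j with
  | zero => simpa using hw
  | succ j ih => rw [pow_succ', Module.End.mul_apply]; exact hf _ ih

theorem repr_apply_of_diagonal {ι : Type} (b : Module.Basis ι ℂ V) {f : Module.End ℂ V} {d : ι → ℂ}
    (hf : ∀ i, f (b i) = d i • b i) (w : V) (i : ι) : b.repr (f w) i = d i * b.repr w i := by
  classical
  have : (Finsupp.lapply i ∘ₗ b.repr.toLinearMap) ∘ₗ f =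
      d i • (Finsupp.lapply i ∘ₗ b.repr.toLinearMap) := b.ext fun j => by
    simp only [LinearMap.comp_apply, hf, map_smul, LinearMap.smul_apply]
    simp only [LinearEquiv.coe_coe, Module.Basis.repr_self, Finsupp.lapply_apply, smul_eq_mul,
      Finsupp.single_apply]
    split_ifs with hij
    · rw [hij]
    · simp
  exact LinearMap.congr_fun this w

end

namespace BiLadder

variable {V : Type} [AddCommGroup V] [Module ℂ V]
variable {k r : ℕ} {X Y : Fin 3 → Module.End ℂ V} {v : ℕ → ℕ → V}

/-- The basis of a ladder. -/
def basis (h : BiLadder ⊤ k r X Y v) : Module.Basis (Fin (k + 1) × Fin (r + 1)) ℂ V :=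
  .mk h.linearIndependent h.span_eq.ge

theorem basis_apply (h : BiLadder ⊤ k r X Y v) (p : Fin (k + 1) × Fin (r + 1)) :
    h.basis p = v p.1 p.2 := by simp [basis]

theorem down_up_ladder {k : ℕ} {Tp Tm T3 : Module.End ℂ V} {v : ℕ → V} (h : Ladder k Tp Tm T3 v)
    (a : ℕ) : Tm (Tp (v a)) = ((a : ℂ) * (k + 1 - a)) • v a := by
  rcases a with _ | a
  · simp [h.raise, raiseCoeff_zero]
  · rw [h.raise, map_smul, Nat.add_sub_cancel, h.lower, raiseCoeff_succ, smul_smul]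
    congr 1; push_cast; ring

/-- Lowering after raising is diagonal with eigenvalues a(k + 1 - a), nonzero for 0 < a ≤ k. A
vector killed by both raising operators therefore has only its (0, 0) coordinate. -/
theorem exists_smul_of_up_eq_zero (h : BiLadder ⊤ k r X Y v) {w : V} (hX : up X w = 0)
    (hY : up Y w = 0) : ∃ z : ℂ, w = z • v 0 0 := by
  have ne {k : ℕ} (a : Fin (k + 1)) (ha : a ≠ 0) : ((a : ℕ) : ℂ) * (k + 1 - (a : ℕ)) ≠ 0 := by
    have h1 : ((a : ℕ) : ℂ) ≠ 0 := by
      exact Nat.cast_ne_zero.2 fun h0 => ha (Fin.ext h0)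
    refine mul_ne_zero h1 ?_
    rw [sub_ne_zero]
    have := a.2
    exact_mod_cast this.ne'
  have hx (p) : h.basis.repr (down X (up X w)) p = _ :=
    repr_apply_of_diagonal h.basis (f := down X * up X)
      (d := fun p => ((p.1 : ℕ) : ℂ) * (k + 1 - (p.1 : ℕ))) (fun p => by
      rw [basis_apply]; exact down_up_ladder (h.left p.2) p.1) w p
  have hy (p) : h.basis.repr (down Y (up Y w)) p = _ :=
    repr_apply_of_diagonal h.basis (f := down Y * up Y)
      (d := fun p => ((p.2 : ℕ) : ℂ) * (r + 1 - (p.2 : ℕ))) (fun p => by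
      rw [basis_apply]; exact down_up_ladder (h.right p.1) p.2) w p
  refine ⟨h.basis.repr w (0, 0), ?_⟩
  conv_lhs => rw [← h.basis.sum_repr w]
  rw [Finset.sum_eq_single (0, 0), basis_apply]
  · rfl
  · rintro ⟨a, c⟩ - hac
    have hx := hx (a, c)
    have hy := hy (a, c)
    simp only [hX, hY, map_zero, Finsupp.coe_zero, Pi.zero_apply] at hx hy
    by_cases ha : a = 0
    · have hc : c ≠ 0 := fun hc => hac (by rw [ha, hc])
      rw [(mul_eq_zero.1 hy.symm).resolve_left (ne c hc), zero_smul]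
    · rw [(mul_eq_zero.1 hx.symm).resolve_left (ne a ha), zero_smul]
  · simp

theorem pow_raise_eq_zero {k : ℕ} {Tp Tm T3 : Module.End ℂ V} {v : ℕ → V}
    (h : Ladder k Tp Tm T3 v) (a : ℕ) : (Tp ^ (k + 1)) (v a) = 0 := by
  have key : ∀ n a, a < n → (Tp ^ n) (v a) = 0 := by
    intro n
    induction n with
    | zero => simp
    | succ n ih =>
      rintro a ha
      rw [pow_succ, Module.End.mul_apply, h.raise, map_smul]
      rcases a with _ | a
      · rw [raiseCoeff_zero, zero_smul]
      · rw [Nat.add_sub_cancel, ih a (by omega), smul_zero]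
  rcases lt_or_ge a (k + 1) with ha | ha
  · exact key _ _ ha
  · rw [h.zero a ha, map_zero]

theorem up_commute (h : BiLadder ⊤ k r X Y v) (u : V) : up X (up Y u) = up Y (up X u) :=
  h.commute (s := fun a => a - 1) (t := fun a => a - 1) (fun a c => (h.left c).raise a)
    (fun a c => (h.right a).raise c) u

theorem top_ne_zero (h : BiLadder ⊤ k r X Y v) : v 0 0 ≠ 0 := by
  have := h.basis.ne_zero (0, 0)
  rwa [basis_apply] at this

/-- Raising is nilpotent, so raising a nonzero vector as far as possible with X and then with Y ends
at a multiple of v 0 0; lowering from there produces the whole basis. -/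
theorem invariant_eq_top (h : BiLadder ⊤ k r X Y v) {W : Submodule ℂ V} (hW : W ≠ ⊥)
    (hXu : ∀ w ∈ W, up X w ∈ W) (hXd : ∀ w ∈ W, down X w ∈ W)
    (hYu : ∀ w ∈ W, up Y w ∈ W) (hYd : ∀ w ∈ W, down Y w ∈ W) : W = ⊤ := by
  obtain ⟨w, hw, hw0⟩ := (Submodule.ne_bot_iff W).1 hW
  have nX : up X ^ (k + 1) = 0 := h.ext fun a c => pow_raise_eq_zero (h.left c) a
  have nY : up Y ^ (r + 1) = 0 := h.ext fun a c => pow_raise_eq_zero (h.right a) c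
  obtain ⟨i, hi, hi'⟩ := exists_pow_apply_eq_zero nX hw0
  obtain ⟨j, hj, hj'⟩ := exists_pow_apply_eq_zero nY hi
  set u := (up Y ^ j) ((up X ^ i) w) with hu
  have huW : u ∈ W := pow_apply_mem hYu (pow_apply_mem hXu hw i) j
  have hcomm : up X u = 0 := by
    have : Commute (up X) (up Y ^ j) :=
      Commute.pow_right (LinearMap.ext fun x => h.up_commute x) j
    rw [hu, ← Module.End.mul_apply, this.eq, Module.End.mul_apply, hi', map_zero]
  obtain ⟨z, hz⟩ := h.exists_smul_of_up_eq_zero hcomm hj'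
  have hz0 : z ≠ 0 := by rintro rfl; exact hj (by rw [hz, zero_smul])
  have h00 : v 0 0 ∈ W := by
    have := W.smul_mem z⁻¹ huW
    rwa [hz, smul_smul, inv_mul_cancel₀ hz0, one_smul] at this
  have hmem : ∀ a c, v a c ∈ W := by
    intro a
    induction a with
    | zero =>
      intro c
      induction c with
      | zero => exact h00
      | succ c ih =>
        have := hYd _ ih
        rw [(h.right 0).lower c] at this
        exact (W.smul_mem_iff (by exact_mod_cast c.succ_ne_zero)).1 this
    | succ a ih =>
      intro c
      have := hXd _ (ih c)
      rw [(h.left c).lower a] at this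
      exact (W.smul_mem_iff (by exact_mod_cast a.succ_ne_zero)).1 this
  rw [eq_top_iff, ← h.span_eq, Submodule.span_le]
  rintro _ ⟨p, rfl⟩
  exact hmem _ _

end BiLadder

/-! ### From ladders to the three properties of a field. -/

section

variable {V : Type} [AddCommGroup V] [Module ℂ V]

theorem isBasisOn_of_bijective {ι : Type} {I : Set (ℝ × ℝ)} {ξ : ℝ → ℝ → V} (e : ι → I)
    (he : Function.Bijective e) (hli : LinearIndependent ℂ fun i => ξ (e i).1.1 (e i).1.2)
    (hsp : Submodule.span ℂ (Set.range fun i => ξ (e i).1.1 (e i).1.2) = ⊤) : IsBasisOn I ξ := by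
  constructor
  · rw [← linearIndependent_equiv (Equiv.ofBijective e he)]
    exact hli
  · rw [← hsp]
    congr 1
    exact (he.surjective.range_comp (fun p : I => ξ p.1.1 p.1.2)).symm

-- A highest weight vector of integral weight M in a finite-dimensional sl₂-module generates a
-- module of dimension at most M + 1. The triple is (2h, e, f), because h is normalized so that f
-- lowers it by 1.
attribute [local instance] LieRing.ofAssociativeRing in
theorem pow_lower_eq_zero [FiniteDimensional ℂ V] {e f h : Module.End ℂ V} {M : ℕ} {t : V}
    (h1 : ∀ u, h (f u) = f (h u) - f u) (h2 : ∀ u, h (e u) = e (h u) + e u)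
    (h3 : ∀ u, e (f u) = f (e u) + (2 : ℂ) • h u) (he : e t = 0) (ht : h t = (M / 2 : ℂ) • t) :
    (f ^ (M + 1)) t = 0 := by
  by_cases ht0 : t = 0
  · rw [ht0, map_zero]
  -- An `IsSl2Triple` needs h ≠ 0; if h = 0, the first relation gives f = 0.
  by_cases hh : h = 0
  · have : f = 0 := LinearMap.ext fun u => by
      have := h1 u
      simp only [hh, LinearMap.zero_apply, map_zero, zero_sub] at this
      simpa using this.symm
    rw [this, zero_pow (Nat.succ_ne_zero _)]; rfl
  have T : IsSl2Triple ((2 : ℂ) • h) e f := by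
    refine ⟨smul_ne_zero two_ne_zero hh, ?_, ?_, ?_⟩ <;>
      refine LinearMap.ext fun u => ?_ <;>
      simp only [LieRing.of_associative_ring_bracket, LinearMap.sub_apply, Module.End.mul_apply,
        LinearMap.smul_apply, LinearMap.neg_apply, h1, h2, h3, map_smul] <;> module
  have P : T.HasPrimitiveVectorWith t (M : ℂ) := by
    refine ⟨ht0, ?_, ?_⟩
    · change (2 : ℂ) • h t = _
      rw [ht, smul_smul]; congr 1; ring
    · exact he
  exact P.pow_toEnd_f_eq_zero_of_eq_nat rfl

end

section

variable {V : Type} [AddCommGroup V] [Module ℂ V]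

/-- A functional that vanishes on W but not on A i w would have a constantly zero matrix coefficient
with nonzero derivative. -/
theorem Infinitesimal.mem_of_invariant {ρ : Representation ℂ Spin13 V} {A B : Fin 3 → Module.End ℂ V}
    (h : Infinitesimal ρ A B) {W : Submodule ℂ V} (hW : ∀ g, ∀ w ∈ W, ρ g w ∈ W) {w : V}
    (hw : w ∈ W) (i : Fin 3) : A i w ∈ W ∧ B i w ∈ W := by
  constructor <;> by_contra hn <;>
    obtain ⟨f, hf, hfW⟩ := Submodule.exists_le_ker_of_notMem hn
  · have h1 := h.rot i w f
    simp only [fun t => LinearMap.mem_ker.1 (hfW (hW (SpinField.rot i t) w hw))] at h1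
    exact hf (h1.unique (hasDerivAt_const _ _))
  · have h1 := h.boost i w f
    simp only [fun t => LinearMap.mem_ker.1 (hfW (hW (SpinField.boost i t) w hw))] at h1
    exact hf (h1.unique (hasDerivAt_const _ _))

/-- The normalization that turns a ladder into an orthonormal one. -/
def ladderNorm (k a : ℕ) : ℂ := rt ((a.factorial * (k - a).factorial : ℕ) : ℝ)

theorem ladderNorm_ne_zero (k a : ℕ) : ladderNorm k a ≠ 0 :=
  rt_ne_zero (by exact_mod_cast Nat.mul_pos a.factorial_pos (k - a).factorial_pos)

theorem ladderNorm_mul {k a : ℕ} (h : a < k) :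
    ladderNorm k a * rt (a + 1) = ladderNorm k (a + 1) * rt (k - a) := by
  rw [ladderNorm, ladderNorm, ← rt_mul (by positivity), ← rt_mul (by positivity)]
  congr 1
  have h1 : ((k - a : ℕ) : ℝ) = k - a := Nat.cast_sub h.le
  rw [← h1, show k - a = (k - (a + 1)) + 1 by omega]
  push_cast [Nat.factorial_succ]
  ring

/-- The normalized vector of weight `m` in a ladder. -/
def ladderVec (k : ℕ) (v : ℕ → V) (m : ℝ) : V :=
  ladderNorm k ⌊k / 2 - m⌋₊ • v ⌊k / 2 - m⌋₊

theorem ladderVec_eq {k : ℕ} (v : ℕ → V) {m : ℝ} {a : ℕ} (h : m = k / 2 - a) :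
    ladderVec k v m = ladderNorm k a • v a := by
  rw [ladderVec, h, sub_sub_cancel, Nat.floor_natCast]

theorem mem_weights_iff {k : ℕ} {l m : ℝ} (hl : 2 * l = k) :
    m ∈ weights l ↔ ∃ a : ℕ, a ≤ k ∧ m = l - a := by
  constructor
  · rintro ⟨i, hi, hm⟩
    have : i ≤ k := by
      have : (i : ℝ) ≤ k := by linarith
      exact_mod_cast this
    refine ⟨k - i, Nat.sub_le _ _, ?_⟩
    rw [Nat.cast_sub this]; linarith
  · rintro ⟨a, ha, hm⟩
    refine ⟨k - a, ?_, ?_⟩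
    · rw [Nat.cast_sub ha]; linarith
    · have := a.cast_nonneg (α := ℝ); linarith

/-- Rescaling by √(a!(k-a)!) symmetrizes the coefficients a + 1 and k - a of the ladder. At the
ends, where `ladderVec` takes values off the weights, either the coefficient or the next ladder
vector is zero. -/
theorem Ladder.formulas {k : ℕ} {Tp Tm T3 : Module.End ℂ V} {v : ℕ → V} (h : Ladder k Tp Tm T3 v)
    {m : ℝ} (hm : m ∈ weights (k / 2)) :
    Tm (ladderVec k v m) = rt ((k / 2 + m) * (k / 2 - m + 1)) • ladderVec k v (m - 1) ∧
    Tp (ladderVec k v m) = rt ((k / 2 - m) * (k / 2 + m + 1)) • ladderVec k v (m + 1) ∧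
    T3 (ladderVec k v m) = (m : ℂ) • ladderVec k v m := by
  obtain ⟨a, ha, rfl⟩ := (mem_weights_iff (by ring : 2 * ((k : ℝ) / 2) = k)).1 hm
  refine ⟨?_, ?_, ?_⟩
  · rw [ladderVec_eq v (a := a) rfl, ladderVec_eq v (a := a + 1) (by push_cast; ring), map_smul,
      h.lower, show ((k : ℝ) / 2 + (k / 2 - a)) * (k / 2 - (k / 2 - a) + 1) = (k - a) * (a + 1) by ring]
    rcases ha.lt_or_eq with ha | rfl
    · rw [rt_mul' _ (by positivity), smul_smul, smul_smul]
      congr 1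
      have := rt_sq (x := (a : ℝ) + 1) (by positivity)
      push_cast at this
      rw [← this]
      linear_combination rt (a + 1) * ladderNorm_mul ha
    · rw [h.zero _ (Nat.lt_succ_self _)]; simp
  · rcases a with _ | a
    · rw [ladderVec_eq v (a := 0) rfl, map_smul, h.raise, raiseCoeff_zero]
      simp [rt_zero]
    · rw [ladderVec_eq v (a := a + 1) rfl, ladderVec_eq v (a := a) (by push_cast; ring), map_smul,
        h.raise, raiseCoeff_succ, Nat.add_sub_cancel, smul_smul, smul_smul]
      congr 1
      have hka : (0 : ℝ) ≤ k - a := sub_nonneg.2 (by exact_mod_cast (Nat.le_succ a).trans ha)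
      rw [show ((k : ℝ) / 2 - (k / 2 - (a + 1 : ℕ))) * (k / 2 + (k / 2 - (a + 1 : ℕ)) + 1) =
        (a + 1) * (k - a) by push_cast; ring, rt_mul' _ hka]
      have := rt_sq hka
      push_cast at this
      rw [← this]
      linear_combination -rt (k - a) * ladderNorm_mul (Nat.lt_of_succ_le ha)
  · rw [ladderVec_eq v (a := a) rfl, map_smul, h.weight]
    push_cast
    rw [smul_comm]

namespace BiLadder

variable {k r : ℕ} {X Y A B : Fin 3 → Module.End ℂ V} {v : ℕ → ℕ → V}
  {ρ : Representation ℂ Spin13 V}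

theorem hasWeight (h : BiLadder ⊤ k r X Y v) (hAB : Infinitesimal ρ A B)
    (hX : ∀ j, X j = (Complex.I / 2) • (A j + Complex.I • B j))
    (hY : ∀ j, Y j = (Complex.I / 2) • (A j - Complex.I • B j)) :
    HasWeight ρ (k / 2) (r / 2) := by
  refine ⟨A, B, X, Y, hAB, hX, hY, ⟨k, by ring⟩, ⟨r, by ring⟩,
    fun m m' => ladderVec k (fun a => ladderVec r (v a) m') m, ?_, ?_⟩
  · have hk : 2 * ((k : ℝ) / 2) = k := by ring
    have hr : 2 * ((r : ℝ) / 2) = r := by ring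
    let e : Fin (k + 1) × Fin (r + 1) → (weights ((k : ℝ) / 2) ×ˢ weights ((r : ℝ) / 2) : Set _) :=
      fun p => ⟨(k / 2 - (p.1 : ℕ), r / 2 - (p.2 : ℕ)),
        (mem_weights_iff hk).2 ⟨p.1, Nat.lt_succ_iff.1 p.1.2, rfl⟩,
        (mem_weights_iff hr).2 ⟨p.2, Nat.lt_succ_iff.1 p.2.2, rfl⟩⟩
    have he : ∀ p, ladderVec k (fun a => ladderVec r (v a) (e p).1.2) (e p).1.1 =
        (ladderNorm k p.1 * ladderNorm r p.2) • v p.1 p.2 := fun p => by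
      rw [ladderVec_eq _ (a := p.1) rfl, ladderVec_eq _ (a := p.2) rfl, smul_smul]
    have hu : ∀ p : Fin (k + 1) × Fin (r + 1), ladderNorm k p.1 * ladderNorm r p.2 ≠ 0 := fun p =>
      mul_ne_zero (ladderNorm_ne_zero _ _) (ladderNorm_ne_zero _ _)
    let b := h.basis.unitsSMul fun p => Units.mk0 _ (hu p)
    have hb : ⇑b = fun p => ladderVec k (fun a => ladderVec r (v a) (e p).1.2) (e p).1.1 := by
      funext p
      rw [he, Module.Basis.unitsSMul_apply, basis_apply]; rfl
    refine isBasisOn_of_bijective e ⟨?_, ?_⟩ ?_ ?_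
    · rintro ⟨a, c⟩ ⟨a', c'⟩ heq
      have := congrArg Subtype.val heq
      simp only [e, Prod.mk.injEq, sub_right_inj, Nat.cast_inj] at this
      exact Prod.ext (Fin.ext this.1) (Fin.ext this.2)
    · rintro ⟨⟨m, m'⟩, hm, hm'⟩
      obtain ⟨a, ha, h1⟩ := (mem_weights_iff hk).1 hm
      obtain ⟨c, hc, h2⟩ := (mem_weights_iff hr).1 hm'
      exact ⟨(⟨a, by omega⟩, ⟨c, by omega⟩), Subtype.ext (Prod.ext h1.symm h2.symm)⟩
    · rw [← hb]; exact b.linearIndependent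
    · rw [← hb]; exact b.span_eq
  · intro m hm m' hm'
    have hl : Ladder k (X 0 + Complex.I • X 1) (X 0 - Complex.I • X 1) (X 2)
        fun a => ladderVec r (v a) m' := by
      have := h.left ⌊r / 2 - m'⌋₊
      constructor <;> intro a <;> simp only [ladderVec, map_smul]
      · rw [this.lower, smul_comm]
      · rw [this.raise, smul_comm]
      · rw [this.weight, smul_comm]
      · intro ha; rw [this.zero a ha, smul_zero]
    have hr := fun a => (h.right a).formulas hm'
    obtain ⟨l1, l2, l3⟩ := hl.formulas hm
    refine ⟨l1, l2, l3, ?_, ?_, ?_⟩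
    · change (Y 0 - Complex.I • Y 1) (ladderNorm k _ • _) = _ • ladderNorm k _ • _
      rw [map_smul, (hr _).1, smul_comm]
    · change (Y 0 + Complex.I • Y 1) (ladderNorm k _ • _) = _ • ladderNorm k _ • _
      rw [map_smul, (hr _).2.1, smul_comm]
    · change (Y 2) (ladderNorm k _ • _) = _ • ladderNorm k _ • _
      rw [map_smul, (hr _).2.2, smul_comm]

/-- An invariant subspace of the group is invariant under A and B, hence under X and Y, and
`invariant_eq_top` applies. -/
theorem isIrreducible (h : BiLadder ⊤ k r X Y v) (hAB : Infinitesimal ρ A B)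
    (hX : ∀ j, X j = (Complex.I / 2) • (A j + Complex.I • B j))
    (hY : ∀ j, Y j = (Complex.I / 2) • (A j - Complex.I • B j)) : ρ.IsIrreducible := by
  have : Nontrivial (Subrepresentation ρ) := by
    refine ⟨⊥, ⊤, fun heq => h.top_ne_zero ?_⟩
    have : v 0 0 ∈ (⊤ : Subrepresentation ρ).toSubmodule := Submodule.mem_top
    rw [← heq] at this
    exact this
  refine { eq_bot_or_eq_top := fun W => ?_ }
  by_cases hW : W.toSubmodule = ⊥
  · exact Or.inl (Subrepresentation.toSubmodule_injective hW)
  · right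
    apply Subrepresentation.toSubmodule_injective
    have mA : ∀ i, ∀ w ∈ W.toSubmodule, A i w ∈ W.toSubmodule := fun i w hw =>
      (hAB.mem_of_invariant W.apply_mem_toSubmodule hw i).1
    have mB : ∀ i, ∀ w ∈ W.toSubmodule, B i w ∈ W.toSubmodule := fun i w hw =>
      (hAB.mem_of_invariant W.apply_mem_toSubmodule hw i).2
    have mX : ∀ i, ∀ w ∈ W.toSubmodule, X i w ∈ W.toSubmodule := fun i w hw => by
      rw [hX]
      exact Submodule.smul_mem _ _ (add_mem (mA i w hw) (Submodule.smul_mem _ _ (mB i w hw)))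
    have mY : ∀ i, ∀ w ∈ W.toSubmodule, Y i w ∈ W.toSubmodule := fun i w hw => by
      rw [hY]
      exact Submodule.smul_mem _ _ (sub_mem (mA i w hw) (Submodule.smul_mem _ _ (mB i w hw)))
    exact h.invariant_eq_top hW
      (fun w hw => add_mem (mX 0 w hw) (Submodule.smul_mem _ _ (mX 1 w hw)))
      (fun w hw => sub_mem (mX 0 w hw) (Submodule.smul_mem _ _ (mX 1 w hw)))
      (fun w hw => add_mem (mY 0 w hw) (Submodule.smul_mem _ _ (mY 1 w hw)))
      (fun w hw => sub_mem (mY 0 w hw) (Submodule.smul_mem _ _ (mY 1 w hw)))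

/-- The step from m = 2κ multiplies by the inverse of `rt 0`, which is 0 by convention. -/
theorem descend_eq_zero (Jm : Module.End ℂ V) {κ : ℝ} {M : ℕ} (hM : 2 * κ = M) (t : V) {m : ℕ}
    (hm : M < m) : descend Jm κ t m = 0 := by
  induction m, hm using Nat.le_induction with
  | base => rw [descend, hM, sub_self, zero_mul, rt_zero, inv_zero, zero_smul]
  | succ m hm ih => rw [descend, ih, map_zero, smul_zero]

/-- The Clebsch–Gordan dimension count for the tensor product of spins N/2 and (N + d)/2. -/
theorem sum_multiplicities (N d : ℕ) :
    ∑ n ∈ Finset.range (N + 1), (2 * N + d - 2 * n + 1) = (N + 1) * (N + d + 1) := by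
  induction N with
  | zero => simp
  | succ N ih =>
    rw [Finset.sum_range_succ', Nat.mul_zero, Nat.sub_zero]
    have : ∀ n, 2 * (N + 1) + d - 2 * (n + 1) + 1 = 2 * N + d - 2 * n + 1 := fun n => by omega
    simp only [this]
    rw [ih]; ring

/-- The tower is applied to J and F with top vector v 0 0. The span of the vectors is stable under
J₊, J₋, F₊ and F₋, hence under raising and lowering by X and by Y, so it is everything. Independence
then follows from the number of vectors. -/
theorem hasGelfandNaimarkPair (h : BiLadder ⊤ k r X Y v) (hAB : Infinitesimal ρ A B)
    (hX : ∀ j, X j = (Complex.I / 2) • (A j + Complex.I • B j))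
    (hY : ∀ j, Y j = (Complex.I / 2) • (A j - Complex.I • B j)) :
    HasGelfandNaimarkPair ρ ((k - r) / 2) ((k + r) / 2 + 1) := by
  have : FiniteDimensional ℂ V := h.basis.finiteDimensional_of_finite
  set l0 : ℝ := (k - r) / 2 with hl0
  set l1 : ℝ := (k + r) / 2 + 1 with hl1
  -- N = min(k, r) and d = |k - r|, so that |l₀| = d/2 and the tower has N + 1 levels.
  obtain ⟨N, d, hkr⟩ : ∃ N d : ℕ, (k = N ∧ r = N + d) ∨ (k = N + d ∧ r = N) := by
    rcases le_total k r with h | h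
    · exact ⟨k, r - k, Or.inl ⟨rfl, by omega⟩⟩
    · exact ⟨r, k - r, Or.inr ⟨by omega, rfl⟩⟩
  have hkrsum : k + r = 2 * N + d := by omega
  have hkrprod : (k + 1) * (r + 1) = (N + 1) * (N + d + 1) := by
    rcases hkr with ⟨rfl, rfl⟩ | ⟨rfl, rfl⟩ <;> ring
  have habs : |l0| = d / 2 := by
    rcases hkr with ⟨e1, e2⟩ | ⟨e1, e2⟩
    · rw [hl0, e1, e2]; push_cast
      rw [show ((N : ℝ) - (N + d)) / 2 = -(d / 2) by ring, abs_neg, abs_of_nonneg (by positivity)]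
    · rw [hl0, e1, e2]; push_cast
      rw [show ((N : ℝ) + d - N) / 2 = d / 2 by ring, abs_of_nonneg (by positivity)]
  have hsum : (k : ℝ) + r = 2 * N + d := by exact_mod_cast hkrsum
  have hl1' : l1 = N + d / 2 + 1 := by rw [hl1, hsum]; ring
  have hN : |l0| = l1 - 1 - N := by rw [habs, hl1']; ring
  have hM : 2 * (l1 - 1) = (k + r : ℕ) := by rw [hl1]; push_cast; ring
  have hl1abs : |l1| = l1 := abs_of_nonneg (by rw [hl1']; positivity)
  have R := h.lorentzRelations
  obtain ⟨⟨x1, x2, x3, x4⟩, y1, y2, y3, y4⟩ := h.relations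
  have Xtop : up X (v 0 0) = 0 := by
    change (X 0 + Complex.I • X 1) (v 0 0) = 0
    rw [(h.left 0).raise, raiseCoeff_zero, zero_smul]
  have Ytop : up Y (v 0 0) = 0 := by
    change (Y 0 + Complex.I • Y 1) (v 0 0) = 0
    rw [(h.right 0).raise, raiseCoeff_zero, zero_smul]
  have recX : ∀ u, up X u = (1 / 2 : ℂ) • (up (J X Y) u + Complex.I • up (F X Y) u) := fun u => by
    rw [up_J, up_F]
    simp only [LinearMap.add_apply, LinearMap.smul_apply, LinearMap.sub_apply, smul_smul,
      Complex.I_mul_I, smul_add]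
    module
  have recY : ∀ u, up Y u = (1 / 2 : ℂ) • (up (J X Y) u - Complex.I • up (F X Y) u) := fun u => by
    rw [up_J, up_F]
    simp only [LinearMap.add_apply, LinearMap.smul_apply, LinearMap.sub_apply, smul_smul,
      Complex.I_mul_I]
    module
  have recX' : ∀ u, down X u = (1 / 2 : ℂ) • (down (J X Y) u + Complex.I • down (F X Y) u) :=
    fun u => by
    rw [down_J, down_F]
    simp only [LinearMap.add_apply, LinearMap.smul_apply, LinearMap.sub_apply, smul_smul,
      Complex.I_mul_I]
    module
  have recY' : ∀ u, down Y u = (1 / 2 : ℂ) • (down (J X Y) u - Complex.I • down (F X Y) u) :=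
    fun u => by
    rw [down_J, down_F]
    simp only [LinearMap.add_apply, LinearMap.smul_apply, LinearMap.sub_apply, smul_smul,
      Complex.I_mul_I]
    module
  have T := R.isTower (l0 := l0) (l1 := l1) (N := N) (v0 := v 0 0) hN
    (by rw [up_J, LinearMap.add_apply, Xtop, Ytop, add_zero])
    (by rw [up_F, LinearMap.smul_apply, LinearMap.sub_apply, Xtop, Ytop, sub_zero, smul_zero])
    (by
      simp only [J, LinearMap.add_apply]
      rw [(h.left 0).weight, (h.right 0).weight, hl1]
      push_cast; module)
    (fun u h1 h2 => h.exists_smul_of_up_eq_zero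
      (by rw [recX, h1, h2]; simp) (by rw [recY, h1, h2]; simp))
  set t := fun n => (tower (down (J X Y)) (down (F X Y)) (v 0 0) l0 l1 n).2 with ht
  have hbot : ∀ n ≤ N, (down (J X Y) ^ (k + r - 2 * n + 1)) (t n) = 0 := fun n hn => by
    refine pow_lower_eq_zero (e := up (J X Y)) (h := J X Y 2) R.J3Jm (fun u => ?_) R.JpJm
      (T.Jp_apply n hn) ?_
    · have c1 : ∀ u, X 2 (up Y u) = up Y (X 2 u) :=
        h.commute (s := fun a => a) (t := fun a => a - 1) (fun a c => (h.left c).weight a)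
          fun a c => (h.right a).raise c
      have c2 : ∀ u, up X (Y 2 u) = Y 2 (up X u) :=
        h.commute (s := fun a => a - 1) (t := fun a => a) (fun a c => (h.left c).raise a)
          fun a c => (h.right a).weight c
      rw [up_J]
      change X 2 (up X u + up Y u) + Y 2 (up X u + up Y u) =
        up X (X 2 u + Y 2 u) + up Y (X 2 u + Y 2 u) + (up X u + up Y u)
      rw [map_add, map_add, map_add, map_add, x2, y2, c1, c2]
      abel
    · rw [T.J3_apply n hn _ rfl, hl1]
      congr 1
      rw [Nat.cast_sub (by omega)]; push_cast; ring
  have G := fun {κ : ℝ} {n m : ℕ} (hn : n ≤ N) (hκ : κ = l1 - 1 - n) (hm : (m : ℝ) ≤ 2 * κ) =>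
    T.gnFormulas R hN hM hbot hn hκ hm
  have hNM : 2 * N ≤ k + r := by omega
  have Gm := gnBasis_lower (Jm := down (J X Y)) hM hNM hbot
  set ξ := gnBasis (down (J X Y)) l1 N t with hξ
  have hmem : ∀ κ ν, (κ, ν) ∈ gnIndex l0 l1 ↔ ∃ n m : ℕ, n ≤ N ∧ m ≤ k + r - 2 * n ∧
      κ = l1 - 1 - n ∧ ν = κ - m := by
    intro κ ν
    have hw : ∀ n ≤ N, κ = l1 - 1 - n → 2 * κ = (k + r - 2 * n : ℕ) := fun n hn hκ => by
      rw [Nat.cast_sub (by omega), hκ, hl1]; push_cast; ring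
    constructor
    · rintro ⟨⟨i, hi⟩, hlt, hν⟩
      simp only at hi hlt hν
      have hiN : i ≤ N := by
        have : (i : ℝ) < N + 1 := by rw [hl1abs] at hlt; linarith
        exact Nat.lt_succ_iff.1 (by exact_mod_cast this)
      have hκ : κ = l1 - 1 - (N - i : ℕ) := by rw [Nat.cast_sub hiN]; linarith
      obtain ⟨m, hm, hνm⟩ := (mem_weights_iff (hw _ (Nat.sub_le _ _) hκ)).1 hν
      exact ⟨N - i, m, Nat.sub_le _ _, hm, hκ, hνm⟩
    · rintro ⟨n, m, hn, hm, hκ, hν⟩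
      refine ⟨⟨N - n, ?_⟩, ?_, (mem_weights_iff (hw n hn hκ)).2 ⟨m, hm, hν⟩⟩
      · simp only; rw [Nat.cast_sub hn]; linarith
      · simp only; rw [hl1abs, hκ]; have := n.cast_nonneg (α := ℝ); linarith
  -- The natural number p of the definition is N + 1, since l₁ = |l₀| + N + 1.
  refine ⟨A, B, hAB, ⟨k - r, by rw [hl0]; push_cast; ring⟩, ⟨N + 1, by omega, ?_⟩, ξ, ?_, ?_⟩
  · rw [hN]; push_cast; ring
  · let e : (Σ n : Fin (N + 1), Fin (k + r - 2 * n + 1)) → gnIndex l0 l1 := fun p =>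
      ⟨(l1 - 1 - (p.1 : ℕ), l1 - 1 - (p.1 : ℕ) - (p.2 : ℕ)), (hmem _ _).2
        ⟨p.1, p.2, Nat.lt_succ_iff.1 p.1.2, Nat.lt_succ_iff.1 p.2.2, rfl, rfl⟩⟩
    have hsp : Submodule.span ℂ (Set.range fun p => ξ (e p).1.1 (e p).1.2) = ⊤ := by
      set W := Submodule.span ℂ (Set.range fun p => ξ (e p).1.1 (e p).1.2) with hW
      have all : ∀ κ ν, ξ κ ν ∈ W := by
        intro κ ν
        by_cases hp : ∃ n m : ℕ, n ≤ N ∧ κ = l1 - 1 - n ∧ ν = κ - m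
        · obtain ⟨n, m, hn, hκ, hν⟩ := hp
          rcases Nat.lt_or_ge (k + r - 2 * n) m with hm | hm
          · rw [hξ, gnBasis_eq _ _ hn hκ hν, descend_eq_zero _ (M := k + r - 2 * n) _ _ hm]
            · exact zero_mem _
            · rw [Nat.cast_sub (by omega), hκ, hl1]; push_cast; ring
          · refine Submodule.subset_span ⟨⟨⟨n, by omega⟩, ⟨m, by simp only; omega⟩⟩, ?_⟩
            simp only [e]
            rw [hν, hκ]
        · rw [hξ, gnBasis_eq_zero _ _ hp]; exact zero_mem _
      have inv : ∀ f : Module.End ℂ V, (∀ n m : ℕ, n ≤ N → (m : ℝ) ≤ 2 * (l1 - 1 - n) →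
          f (ξ (l1 - 1 - n) (l1 - 1 - n - m)) ∈ W) → ∀ w ∈ W, f w ∈ W := by
        intro f hf
        change W ≤ W.comap f
        conv_lhs => rw [hW]
        rw [Submodule.span_le]
        rintro _ ⟨⟨n, m⟩, rfl⟩
        refine hf n m (Nat.lt_succ_iff.1 n.2) ?_
        have : (m : ℝ) ≤ (k + r - 2 * n : ℕ) := by exact_mod_cast Nat.lt_succ_iff.1 m.2
        rw [Nat.cast_sub (by omega)] at this
        rw [hl1]; push_cast at this; linarith
      have cJp := inv (up (J X Y)) fun n m hn hm => by
        rw [(G hn rfl hm).Jp_apply]; exact W.smul_mem _ (all _ _)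
      have cFp := inv (up (F X Y)) fun n m hn hm => by
        rw [(G hn rfl hm).Fp_apply]
        exact add_mem (sub_mem (W.smul_mem _ (all _ _)) (W.smul_mem _ (all _ _)))
          (W.smul_mem _ (all _ _))
      have cJm := inv (down (J X Y)) fun n m hn hm => by
        rw [Gm]; exact W.smul_mem _ (all _ _)
      have cFm := inv (down (F X Y)) fun n m hn hm => by
        rw [(G hn rfl hm).Fm_apply]
        exact sub_mem (sub_mem (neg_mem (W.smul_mem _ (all _ _))) (W.smul_mem _ (all _ _)))
          (W.smul_mem _ (all _ _))
      refine h.invariant_eq_top ?_ ?_ ?_ ?_ ?_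
      · intro hbotW
        have h0 := all (l1 - 1) (l1 - 1)
        rw [hbotW, Submodule.mem_bot, hξ, gnBasis_top _ _ (Nat.zero_le N) (by simp)] at h0
        exact h.top_ne_zero h0
      · intro w hw; rw [recX]
        exact W.smul_mem _ (add_mem (cJp w hw) (W.smul_mem _ (cFp w hw)))
      · intro w hw; rw [recX']
        exact W.smul_mem _ (add_mem (cJm w hw) (W.smul_mem _ (cFm w hw)))
      · intro w hw; rw [recY]
        exact W.smul_mem _ (sub_mem (cJp w hw) (W.smul_mem _ (cFp w hw)))
      · intro w hw; rw [recY']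
        exact W.smul_mem _ (sub_mem (cJm w hw) (W.smul_mem _ (cFm w hw)))
    refine isBasisOn_of_bijective e ⟨?_, ?_⟩ ?_ hsp
    · rintro ⟨n, m⟩ ⟨n', m'⟩ heq
      have := congrArg Subtype.val heq
      simp only [e, Prod.mk.injEq, sub_right_inj, Nat.cast_inj] at this
      obtain ⟨h1, h2⟩ := this
      obtain rfl := Fin.ext h1
      rw [sub_right_inj, Nat.cast_inj] at h2
      rw [Fin.ext h2]
    · rintro ⟨⟨κ, ν⟩, hp⟩
      obtain ⟨n, m, hn, hm, hκ, hν⟩ := (hmem _ _).1 hp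
      refine ⟨⟨⟨n, by omega⟩, ⟨m, by simp only; omega⟩⟩, Subtype.ext (Prod.ext hκ.symm ?_)⟩
      simp only [e]
      rw [hν, hκ]
    -- The index set has as many elements as the ladder basis, by `sum_multiplicities`.
    · apply linearIndependent_of_top_le_span_of_card_eq_finrank hsp.ge
      rw [Module.finrank_eq_card_basis h.basis, Fintype.card_sigma]
      simp only [Fintype.card_fin, Fintype.card_prod]
      rw [hkrprod, Fin.sum_univ_eq_sum_range (fun n => k + r - 2 * n + 1), hkrsum,
        sum_multiplicities]
  · intro κ ν hp
    obtain ⟨n, m, hn, hm, hκ, hν⟩ := (hmem _ _).1 hp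
    have hm' : (m : ℝ) ≤ 2 * κ := by
      have : (m : ℝ) ≤ (k + r - 2 * n : ℕ) := by exact_mod_cast hm
      rw [Nat.cast_sub (by omega)] at this
      rw [hκ, hl1]; push_cast at this; linarith
    have eJ : ∀ j, J X Y j = Complex.I • A j := fun j => by
      simp only [J, hX, hY]; module
    have eF : ∀ j, F X Y j = Complex.I • B j := fun j => by
      simp only [F, hX, hY]
      match_scalars
      · ring
      · linear_combination (-Complex.I) * Complex.I_mul_I
    have uJ : up (J X Y) = Complex.I • A 0 - A 1 := by
      simp only [up, eJ, smul_smul, Complex.I_mul_I]; module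
    have dJ : down (J X Y) = Complex.I • A 0 + A 1 := by
      simp only [down, eJ, smul_smul, Complex.I_mul_I]; module
    have uF : up (F X Y) = Complex.I • B 0 - B 1 := by
      simp only [up, eF, smul_smul, Complex.I_mul_I]; module
    have dF : down (F X Y) = Complex.I • B 0 + B 1 := by
      simp only [down, eF, smul_smul, Complex.I_mul_I]; module
    obtain ⟨g1, g2, g3, g4, g5⟩ := G hn hκ hm'
    rw [← hν] at g1 g2 g3 g4 g5
    have g6 := Gm κ ν
    rw [uJ] at g2
    rw [eJ] at g1
    rw [eF] at g3
    rw [uF] at g4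
    rw [dF] at g5
    rw [dJ] at g6
    exact ⟨g1, g2, g6, g3, g4, g5⟩

theorem isField (h : BiLadder ⊤ k r X Y v) (hAB : Infinitesimal ρ A B)
    (hX : ∀ j, X j = (Complex.I / 2) • (A j + Complex.I • B j))
    (hY : ∀ j, Y j = (Complex.I / 2) • (A j - Complex.I • B j)) :
    IsField ρ (k / 2) (r / 2) ((k - r) / 2) ((k + r) / 2 + 1) :=
  ⟨h.isIrreducible hAB hX hY, h.hasWeight hAB hX hY, h.hasGelfandNaimarkPair hAB hX hY⟩

/-- Operators and ladder are pulled back along the injection ι with range W. This allows all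
computations to take place in the ambient tensor space. -/
theorem isField_of_intertwining {U : Type} [AddCommGroup U] [Module ℂ U]
    {ρU : Representation ℂ Spin13 U} {W : Submodule ℂ V} {ι : U →ₗ[ℂ] V}
    (hι : Function.Injective ι) (hρ : ∀ g u, ι (ρU g u) = ρ g (ι u)) (hW : LinearMap.range ι = W)
    (h : BiLadder W k r X Y v) (hAB : Infinitesimal ρ A B)
    (hX : ∀ j, X j = (Complex.I / 2) • (A j + Complex.I • B j))
    (hY : ∀ j, Y j = (Complex.I / 2) • (A j - Complex.I • B j)) :
    IsField ρU (k / 2) (r / 2) ((k - r) / 2) ((k + r) / 2 + 1) := by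
  have hWρ : ∀ g, ∀ w ∈ W, ρ g w ∈ W := by
    rintro g w hw
    rw [← hW] at hw ⊢
    obtain ⟨u, rfl⟩ := hw
    exact ⟨ρU g u, hρ g u⟩
  have lift : ∀ f : Module.End ℂ V, (∀ w ∈ W, f w ∈ W) →
      ∃ f' : Module.End ℂ U, ∀ u, ι (f' u) = f (ι u) := by
    intro f hf
    have hmem : ∀ u, f (ι u) ∈ LinearMap.range ι := fun u => by
      rw [hW]; exact hf _ (hW ▸ LinearMap.mem_range_self ι u)
    let e := LinearEquiv.ofInjective ι hι
    refine ⟨e.symm.toLinearMap ∘ₗ (f ∘ₗ ι).codRestrict _ hmem, fun u => ?_⟩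
    have := congrArg Subtype.val (e.apply_symm_apply ⟨f (ι u), hmem u⟩)
    exact this
  choose A' hA' using fun i => lift (A i) fun w hw => (hAB.mem_of_invariant hWρ hw i).1
  choose B' hB' using fun i => lift (B i) fun w hw => (hAB.mem_of_invariant hWρ hw i).2
  have hv : ∀ a c, ∃ u, ι u = v a c := fun a c => by
    change v a c ∈ LinearMap.range ι
    by_cases hac : a ≤ k ∧ c ≤ r
    · rw [hW, ← h.span_eq]
      exact Submodule.subset_span ⟨(⟨a, by omega⟩, ⟨c, by omega⟩), rfl⟩
    · rcases not_and_or.1 hac with ha | hc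
      · rw [(h.left c).zero a (not_le.1 ha)]; exact zero_mem _
      · rw [(h.right a).zero c (not_le.1 hc)]; exact zero_mem _
  choose v' hv' using hv
  have hAB' : Infinitesimal ρU A' B' := by
    constructor <;> intro i u f <;>
      -- A linear left inverse of ι extends every functional on U to V.
      obtain ⟨g, hg⟩ := ι.exists_leftInverse_of_injective (LinearMap.ker_eq_bot.2 hι) <;>
      have hg' : ∀ u, f u = (f ∘ₗ g) (ι u) := fun u => by
        rw [LinearMap.comp_apply, ← LinearMap.comp_apply g ι u, hg, LinearMap.id_apply]
    · simp only [hg', hA', hρ]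
      exact hAB.rot i (ι u) (f ∘ₗ g)
    · simp only [hg', hB', hρ]
      exact hAB.boost i (ι u) (f ∘ₗ g)
  obtain ⟨X', dX⟩ : ∃ X' : Fin 3 → Module.End ℂ U,
    ∀ j, X' j = (Complex.I / 2) • (A' j + Complex.I • B' j) := ⟨_, fun _ => rfl⟩
  obtain ⟨Y', dY⟩ : ∃ Y' : Fin 3 → Module.End ℂ U,
    ∀ j, Y' j = (Complex.I / 2) • (A' j - Complex.I • B' j) := ⟨_, fun _ => rfl⟩
  refine isField (X := X') (Y := Y') (v := v') ?_ hAB' dX dY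
  have hX' : ∀ j u, ι (X' j u) = X j (ι u) := fun j u => by
    simp only [hX, dX, LinearMap.smul_apply, LinearMap.add_apply, map_smul, map_add, hA', hB']
  have hY' : ∀ j u, ι (Y' j u) = Y j (ι u) := fun j u => by
    simp only [hY, dY, LinearMap.smul_apply, LinearMap.sub_apply, map_smul, map_sub, hA', hB']
  have hcomp : (ι ∘ fun p : Fin (k + 1) × Fin (r + 1) => v' p.1 p.2) =
      fun p : Fin (k + 1) × Fin (r + 1) => v p.1 p.2 := funext fun p => hv' _ _
  refine ⟨fun c => ⟨fun a => hι ?_, fun a => hι ?_, fun a => hι ?_, fun a ha => hι ?_⟩,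
    fun a => ⟨fun c => hι ?_, fun c => hι ?_, fun c => hι ?_, fun c hc => hι ?_⟩, ?_, ?_⟩
  · rw [LinearMap.sub_apply, LinearMap.smul_apply, map_sub, map_smul, hX', hX', map_smul, hv', hv']
    exact (h.left c).lower a
  · rw [LinearMap.add_apply, LinearMap.smul_apply, map_add, map_smul, hX', hX', map_smul, hv', hv']
    exact (h.left c).raise a
  · rw [hX', map_smul, hv']; exact (h.left c).weight a
  · rw [hv', map_zero]; exact (h.left c).zero a ha
  · rw [LinearMap.sub_apply, LinearMap.smul_apply, map_sub, map_smul, hY', hY', map_smul, hv', hv']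
    exact (h.right a).lower c
  · rw [LinearMap.add_apply, LinearMap.smul_apply, map_add, map_smul, hY', hY', map_smul, hv', hv']
    exact (h.right a).raise c
  · rw [hY', map_smul, hv']; exact (h.right a).weight c
  · rw [hv', map_zero]; exact (h.right a).zero c hc
  · refine LinearIndependent.of_comp ι ?_
    rw [hcomp]; exact h.linearIndependent
  · apply Submodule.map_injective_of_injective hι
    rw [Submodule.map_span, ← Set.range_comp, hcomp, h.span_eq, Submodule.map_top, hW]

end BiLadder

end

/-! ### Derivatives of curves tested on functionals. -/

section WeakDerivative

variable {V U : Type} [AddCommGroup V] [Module ℂ V] [AddCommGroup U] [Module ℂ U]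

/-- The curve `w` has the derivative `w'` at `0` with respect to all linear functionals. -/
def HasWeakDeriv (w : ℝ → V) (w' : V) : Prop :=
  ∀ f : Module.Dual ℂ V, HasDerivAt (fun t => f (w t)) (f w') 0

theorem HasWeakDeriv.map {w : ℝ → V} {w' : V} (h : HasWeakDeriv w w') (f : V →ₗ[ℂ] U) :
    HasWeakDeriv (fun t => f (w t)) (f w') := fun g => h (g ∘ₗ f)

theorem HasWeakDeriv.const (v : V) : HasWeakDeriv (fun _ => v) 0 := fun f => by
  rw [map_zero]; exact hasDerivAt_const _ _

theorem HasWeakDeriv.add {w x : ℝ → V} {w' x' : V} (h : HasWeakDeriv w w')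
    (h' : HasWeakDeriv x x') : HasWeakDeriv (fun t => w t + x t) (w' + x') := fun f => by
  simp only [map_add]; exact (h f).add (h' f)

theorem HasWeakDeriv.smul {w : ℝ → V} {w' : V} (h : HasWeakDeriv w w') {c : ℝ → ℂ} {c' : ℂ}
    (hc : HasDerivAt c c' 0) : HasWeakDeriv (fun t => c t • w t) (c' • w 0 + c 0 • w') :=
  fun f => by
    simp only [map_smul, map_add]
    rw [add_comm]
    exact hc.smul (h f)

theorem HasWeakDeriv.sum {ι : Type} (s : Finset ι) {w : ι → ℝ → V} {w' : ι → V}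
    (h : ∀ i ∈ s, HasWeakDeriv (w i) (w' i)) :
    HasWeakDeriv (fun t => ∑ i ∈ s, w i t) (∑ i ∈ s, w' i) := fun f => by
  simp only [map_sum]; exact HasDerivAt.fun_sum fun i hi => h i hi f

/-- Expanding every argument in a finite basis turns the value into a finite sum of products of
coordinate functions times constant vectors; the product rule for scalar functions then suffices. -/
theorem HasWeakDeriv.multilinear [FiniteDimensional ℂ V] {k : ℕ}
    (φ : MultilinearMap ℂ (fun _ : Fin k => V) U) {w : Fin k → ℝ → V} {w' : Fin k → V}
    (h : ∀ i, HasWeakDeriv (w i) (w' i)) :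
    HasWeakDeriv (fun t => φ fun i => w i t)
      (∑ i, φ (Function.update (fun j => w j 0) i (w' i))) := by
  classical
  let b := Module.finBasis ℂ V
  have expand : ∀ u : Fin k → V, φ u = ∑ J : Fin k → Fin (Module.finrank ℂ V),
      (∏ i, b.repr (u i) (J i)) • φ fun i => b (J i) := fun u => by
    conv_lhs => rw [show u = fun i => ∑ j, b.repr (u i) j • b j from
      funext fun i => (b.sum_repr (u i)).symm]
    rw [φ.map_sum]
    exact Finset.sum_congr rfl fun J _ => φ.map_smul_univ _ _
  have hprod : ∀ J : Fin k → Fin (Module.finrank ℂ V),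
      HasDerivAt (fun t => ∏ i, b.repr (w i t) (J i))
        (∑ i, ∏ j, b.repr (Function.update (fun j => w j 0) i (w' i) j) (J j)) 0 := fun J => by
    have := HasDerivAt.fun_finsetProd (u := Finset.univ) (f := fun i t => b.repr (w i t) (J i))
      (f' := fun i => b.repr (w' i) (J i)) (x := (0 : ℝ)) fun i _ =>
        h i (b.coord (J i))
    refine this.congr_deriv (Finset.sum_congr rfl fun i _ => ?_)
    rw [← Finset.mul_prod_erase _ _ (Finset.mem_univ i), Function.update_self, mul_comm,
      smul_eq_mul]
    congr 1
    refine Finset.prod_congr rfl fun j hj => ?_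
    rw [Function.update_of_ne (Finset.ne_of_mem_erase hj)]
  have hd := HasWeakDeriv.sum Finset.univ fun J _ =>
    (HasWeakDeriv.const (φ fun i => b (J i))).smul (hprod J)
  simp only [← expand, smul_zero, add_zero] at hd
  convert hd using 1
  simp only [Finset.sum_smul]
  rw [Finset.sum_comm]
  exact Finset.sum_congr rfl fun i _ => expand _

theorem HasWeakDeriv.bilinear {V' : Type} [AddCommGroup V'] [Module ℂ V'] [FiniteDimensional ℂ V]
    (φ : V →ₗ[ℂ] V' →ₗ[ℂ] U) {w : ℝ → V} {w' : V} {x : ℝ → V'} {x' : V'}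
    (h : HasWeakDeriv w w') (h' : HasWeakDeriv x x') :
    HasWeakDeriv (fun t => φ (w t) (x t)) (φ w' (x 0) + φ (w 0) x') := by
  let b := Module.finBasis ℂ V
  have expand : ∀ u y, φ u y = ∑ i, b.repr u i • φ (b i) y := fun u y => by
    conv_lhs => rw [← b.sum_repr u, map_sum, LinearMap.sum_apply]
    exact Finset.sum_congr rfl fun i _ => by rw [map_smul, LinearMap.smul_apply]
  have hd := HasWeakDeriv.sum Finset.univ fun i _ =>
    (h'.map (φ (b i))).smul (h (b.coord i))
  convert hd using 1
  · funext t; exact expand _ _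
  · rw [Finset.sum_add_distrib, expand w', expand (w 0)]; rfl

end WeakDerivative

/-! ### Infinitesimal operators of tensor powers and tensor products. -/

section Derivation

variable {V V' : Type} [AddCommGroup V] [Module ℂ V] [AddCommGroup V'] [Module ℂ V']

/-- The derivation of the tensor power induced by an endomorphism. -/
def powDer (V : Type) [AddCommGroup V] [Module ℂ V] (k : ℕ) :
    Module.End ℂ V →ₗ[ℂ] Module.End ℂ (Pow V k) :=
  ∑ i, (PiTensorProduct.mapMultilinear ℂ (fun _ : Fin k => V) (fun _ : Fin k => V)).toLinearMap
    (fun _ => 1) i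

theorem powDer_tprod {k : ℕ} (A : Module.End ℂ V) (u : Fin k → V) :
    powDer V k A (PiTensorProduct.tprod ℂ u) =
      ∑ i, PiTensorProduct.tprod ℂ (Function.update u i (A (u i))) := by
  rw [powDer, LinearMap.sum_apply, LinearMap.sum_apply]
  refine Finset.sum_congr rfl fun i _ => ?_
  rw [MultilinearMap.toLinearMap_apply, PiTensorProduct.mapMultilinear_apply,
    PiTensorProduct.map_tprod]
  congr 1
  funext j
  by_cases h : j = i
  · subst h; simp
  · simp [Function.update_of_ne h]

theorem Infinitesimal.hasWeakDeriv_iff {ρ : Representation ℂ Spin13 V}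
    {A B : Fin 3 → Module.End ℂ V} : Infinitesimal ρ A B ↔
      (∀ i v, HasWeakDeriv (fun t => ρ (SpinField.rot i t) v) (A i v)) ∧
      ∀ i v, HasWeakDeriv (fun t => ρ (SpinField.boost i t) v) (B i v) :=
  ⟨fun h => ⟨h.rot, h.boost⟩, fun h => ⟨h.1, h.2⟩⟩

theorem rot_zero (i : Fin 3) : rot i 0 = 1 := Subtype.ext (by simp [rot])

theorem boost_zero (i : Fin 3) : boost i 0 = 1 := Subtype.ext (by simp [boost])

variable {A A' : Type} [Ring A] [Algebra ℂ A] [Ring A'] [Algebra ℂ A']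

theorem repOf_pow_tprod (γ : A →ₐ[ℂ] Module.End ℂ V) (u : Spin13 →* A) (k : ℕ) (g : Spin13)
    (x : Fin k → V) : repOf (powAction γ k) (powHom u k) g (PiTensorProduct.tprod ℂ x) =
      PiTensorProduct.tprod ℂ fun i => repOf γ u g (x i) := by
  change powAction γ k (PiTensorProduct.tprod ℂ fun _ => u g) _ = _
  rw [powAction, PiTensorProduct.liftAlgHom_apply, PiTensorProduct.lift.tprod]
  exact PiTensorProduct.map_tprod _ _

/-- On pure tensors the curve is multilinear in k curves that pass through the identity at t = 0, so
the Leibniz rule gives the derivation `powDer`. -/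
theorem Infinitesimal.pow [FiniteDimensional ℂ V] {γ : A →ₐ[ℂ] Module.End ℂ V}
    {u : Spin13 →* A} {a b : Fin 3 → Module.End ℂ V} (h : Infinitesimal (repOf γ u) a b) (k : ℕ) :
    Infinitesimal (repOf (powAction γ k) (powHom u k)) (fun i => powDer V k (a i))
      fun i => powDer V k (b i) := by
  have key : ∀ (g : ℝ → Spin13) (E : Module.End ℂ V), g 0 = 1 →
      (∀ v, HasWeakDeriv (fun t => repOf γ u (g t) v) (E v)) → ∀ x, HasWeakDeriv
        (fun t => repOf (powAction γ k) (powHom u k) (g t) x) (powDer V k E x) := by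
    intro g E h0 hE x
    induction x using PiTensorProduct.induction_on with
    | smul_tprod c x =>
      simp only [map_smul, repOf_pow_tprod, powDer_tprod]
      have := HasWeakDeriv.multilinear (PiTensorProduct.tprod ℂ) fun i => hE (x i)
      simp only [h0, map_one, Module.End.one_apply] at this
      exact this.map (c • LinearMap.id)
    | add x y hx hy => simp only [map_add]; exact hx.add hy
  rw [hasWeakDeriv_iff] at h ⊢
  exact ⟨fun i => key _ _ (rot_zero i) (h.1 i), fun i => key _ _ (boost_zero i) (h.2 i)⟩

/-- The derivation of the tensor product induced by endomorphisms of the factors. -/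
def tensorDer (E : Module.End ℂ V) (E' : Module.End ℂ V') : Module.End ℂ (V ⊗[ℂ] V') :=
  TensorProduct.map E LinearMap.id + TensorProduct.map LinearMap.id E'

theorem tensorDer_tmul (E : Module.End ℂ V) (E' : Module.End ℂ V') (x : V) (y : V') :
    tensorDer E E' (x ⊗ₜ y) = E x ⊗ₜ y + x ⊗ₜ E' y := rfl

theorem repOf_tensor_tmul (γ : A →ₐ[ℂ] Module.End ℂ V) (γ' : A' →ₐ[ℂ] Module.End ℂ V')
    (u : Spin13 →* A) (u' : Spin13 →* A') (g : Spin13) (x : V) (y : V') :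
    repOf (tensorAction γ γ') (tensorHom u u') g (x ⊗ₜ y) =
      repOf γ u g x ⊗ₜ repOf γ' u' g y := rfl

theorem Infinitesimal.tensor [FiniteDimensional ℂ V] {γ : A →ₐ[ℂ] Module.End ℂ V}
    {γ' : A' →ₐ[ℂ] Module.End ℂ V'} {u : Spin13 →* A} {u' : Spin13 →* A'}
    {a b : Fin 3 → Module.End ℂ V} {a' b' : Fin 3 → Module.End ℂ V'}
    (h : Infinitesimal (repOf γ u) a b) (h' : Infinitesimal (repOf γ' u') a' b') :
    Infinitesimal (repOf (tensorAction γ γ') (tensorHom u u')) (fun i => tensorDer (a i) (a' i))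
      fun i => tensorDer (b i) (b' i) := by
  have key : ∀ (g : ℝ → Spin13) (E : Module.End ℂ V) (E' : Module.End ℂ V'), g 0 = 1 →
      (∀ v, HasWeakDeriv (fun t => repOf γ u (g t) v) (E v)) →
      (∀ v, HasWeakDeriv (fun t => repOf γ' u' (g t) v) (E' v)) → ∀ x, HasWeakDeriv
        (fun t => repOf (tensorAction γ γ') (tensorHom u u') (g t) x) (tensorDer E E' x) := by
    intro g E E' h0 hE hE' x
    induction x using TensorProduct.induction_on with
    | zero => simp only [map_zero]; exact HasWeakDeriv.const 0
    | tmul x y =>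
      simp only [repOf_tensor_tmul, tensorDer_tmul]
      have := HasWeakDeriv.bilinear (TensorProduct.mk ℂ V V') (hE x) (hE' y)
      simp only [h0, map_one, Module.End.one_apply, TensorProduct.mk_apply] at this
      exact this
    | add x y hx hy => simp only [map_add]; exact hx.add hy
  rw [hasWeakDeriv_iff] at h h' ⊢
  exact ⟨fun i => key _ _ _ (rot_zero i) (h.1 i) (h'.1 i),
    fun i => key _ _ _ (boost_zero i) (h.2 i) (h'.2 i)⟩

end Derivation

/-! ### Vectors whose coordinates are constant on fibers. -/

section FiberSums

variable {V : Type} [AddCommGroup V] [Module ℂ V] {ι γ : Type} [Fintype ι] [DecidableEq γ]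

theorem repr_fiberSum (b : Module.Basis ι ℂ V) (κ : ι → γ) (c : γ) (i : ι) :
    b.repr (∑ j with κ j = c, b j) i = if κ i = c then 1 else 0 := by
  classical
  rw [map_sum, Finsupp.finsetSum_apply]
  simp only [Module.Basis.repr_self, Finsupp.single_apply, Finset.sum_ite_eq', Finset.mem_filter,
    Finset.mem_univ, true_and]

theorem linearIndependent_fiberSum (b : Module.Basis ι ℂ V) {κ : ι → γ}
    (hκ : Function.Surjective κ) [Fintype γ] :
    LinearIndependent ℂ fun c => ∑ j with κ j = c, b j := by
  rw [Fintype.linearIndependent_iff]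
  intro z hz c
  obtain ⟨i, rfl⟩ := hκ c
  have := congrArg (fun x => b.repr x i) hz
  simp only [map_sum, map_smul, Finsupp.finsetSum_apply, Finsupp.smul_apply, map_zero,
    Finsupp.coe_zero, Pi.zero_apply] at this
  simpa only [← Finsupp.finsetSum_apply, ← map_sum, repr_fiberSum, smul_eq_mul, mul_ite, mul_one,
    mul_zero, Finset.sum_ite_eq, Finset.mem_univ, if_true] using this

/-- A vector of W is the combination of the fiber sums with coefficients read off at one
representative of each fiber. -/
theorem span_fiberSum (b : Module.Basis ι ℂ V) {κ : ι → γ} (hκ : Function.Surjective κ) [Fintype γ]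
    {W : Submodule ℂ V}
    (hW : ∀ x, x ∈ W ↔ ∀ i j, κ i = κ j → b.repr x i = b.repr x j) :
    Submodule.span ℂ (Set.range fun c => ∑ j with κ j = c, b j) = W := by
  apply le_antisymm
  · rw [Submodule.span_le]
    rintro _ ⟨c, rfl⟩
    rw [SetLike.mem_coe, hW]
    intro i j hij
    rw [repr_fiberSum, repr_fiberSum, hij]
  · intro x hx
    rw [hW] at hx
    choose s hs using hκ
    have : x = ∑ c, b.repr x (s c) • ∑ j with κ j = c, b j := by
      apply b.ext_elem
      intro i
      simp only [map_sum, map_smul, Finsupp.finsetSum_apply, Finsupp.smul_apply]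
      simp only [← Finsupp.finsetSum_apply, ← map_sum, repr_fiberSum, smul_eq_mul, mul_ite,
        mul_one, mul_zero, Finset.sum_ite_eq, Finset.mem_univ, if_true]
      exact hx _ _ (hs _).symm
    rw [this]
    exact sum_mem fun c _ => Submodule.smul_mem _ _ (Submodule.subset_span ⟨c, rfl⟩)

omit [Fintype ι] in
theorem repr_apply_of_permutes (b : Module.Basis ι ℂ V) {f : Module.End ℂ V} (σ : Equiv.Perm ι)
    (hf : ∀ i, f (b i) = b (σ i)) (x : V) (i : ι) : b.repr (f x) (σ i) = b.repr x i := by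
  classical
  have : b.coord (σ i) ∘ₗ f = b.coord i := b.ext fun j => by
    simp only [LinearMap.comp_apply, hf, Module.Basis.coord_apply, Module.Basis.repr_self,
      Finsupp.single_apply, σ.injective.eq_iff]
  exact LinearMap.congr_fun this x

omit [Fintype ι] in
theorem apply_eq_self_iff_of_permutes (b : Module.Basis ι ℂ V) {f : Module.End ℂ V}
    (σ : Equiv.Perm ι) (hf : ∀ i, f (b i) = b (σ i)) (x : V) :
    f x = x ↔ ∀ i, b.repr x (σ i) = b.repr x i := by
  constructor
  · intro h i
    conv_lhs => rw [← h]
    exact repr_apply_of_permutes b σ hf x i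
  · intro h
    apply b.ext_elem
    intro i
    obtain ⟨i, rfl⟩ := σ.surjective i
    rw [repr_apply_of_permutes b σ hf, h]

end FiberSums

/-! ### Symmetric tensors over a two-dimensional space. -/

section SymmetricPower

variable {V : Type} [AddCommGroup V] [Module ℂ V] (e : Module.Basis (Fin 2) ℂ V) (k : ℕ)

/-- The basis of a tensor power of a two-dimensional space: the set `T` stands for the tensor
product of the vectors `e 1` at the places in `T` and `e 0` at the other places. -/
def setBasis : Module.Basis (Finset (Fin k)) ℂ (Pow V k) :=
  (Basis.piTensorProduct fun _ : Fin k => e).reindex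
    { toFun J := Finset.univ.filter fun i => J i = 1
      invFun T i := if i ∈ T then 1 else 0
      left_inv J := by
        funext i
        simp only [Finset.mem_filter, Finset.mem_univ, true_and]
        split_ifs with h
        · exact h.symm
        · by_contra h0
          exact h (Fin.eq_one_of_ne_zero _ (Ne.symm h0))
      right_inv T := by ext i; simp }

theorem setBasis_apply (T : Finset (Fin k)) :
    setBasis e k T = PiTensorProduct.tprod ℂ fun i => e (if i ∈ T then 1 else 0) := by
  rw [setBasis, Module.Basis.reindex_apply, Basis.piTensorProduct_apply]; rfl

theorem update_setBasis (T : Finset (Fin k)) (i : Fin k) :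
    PiTensorProduct.tprod ℂ (Function.update (fun j => e (if j ∈ T then 1 else 0)) i (e 1)) =
      setBasis e k (insert i T) ∧
    PiTensorProduct.tprod ℂ (Function.update (fun j => e (if j ∈ T then 1 else 0)) i (e 0)) =
      setBasis e k (T.erase i) := by
  rw [setBasis_apply, setBasis_apply]
  constructor <;> congr 1 <;> funext j <;> by_cases h : j = i
  · subst h; simp
  · simp [h]
  · subst h; simp
  · simp [h]

theorem permute_setBasis (π : Equiv.Perm (Fin k)) (T : Finset (Fin k)) :
    permute V π (setBasis e k T) = setBasis e k (Equiv.finsetCongr π T) := by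
  rw [setBasis_apply, setBasis_apply, permute, LinearEquiv.coe_coe, PiTensorProduct.reindex_tprod]
  congr 1
  funext i
  simp [Finset.mem_map_equiv]

/-- The sum of the basis tensors with `a` factors `e 1`. -/
def symVec (a : ℕ) : Pow V k := ∑ T ∈ Finset.powersetCard a Finset.univ, setBasis e k T

variable {k} in
theorem exists_perm_of_card_eq {S T : Finset (Fin k)} (h : S.card = T.card) :
    ∃ π : Equiv.Perm (Fin k), Equiv.finsetCongr π S = T := by
  have e : {x // x ∈ S} ≃ {x // x ∈ T} := Fintype.equivOfCardEq (by simpa using h)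
  refine ⟨e.extendSubtype, Finset.eq_of_subset_of_card_le ?_ (by simp [h])⟩
  intro x hx
  obtain ⟨y, hy, rfl⟩ := Finset.mem_map.1 hx
  exact e.extendSubtype_mem y hy

/-- The cardinality of a subset of `Fin k`. -/
def cardFin (T : Finset (Fin k)) : Fin (k + 1) :=
  ⟨T.card, Nat.lt_succ_of_le ((Finset.card_le_univ T).trans_eq (Fintype.card_fin k))⟩

variable {k} in
theorem cardFin_eq_iff {S T : Finset (Fin k)} : cardFin k S = cardFin k T ↔ S.card = T.card :=
  Fin.ext_iff

theorem cardFin_surjective : Function.Surjective (cardFin k) := fun a => by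
  obtain ⟨T, -, hT⟩ := Finset.exists_subset_card_eq (s := (Finset.univ : Finset (Fin k)))
    (n := a) (by simpa using Nat.lt_succ_iff.1 a.2)
  exact ⟨T, Fin.ext hT⟩

theorem symVec_eq_fiberSum (a : Fin (k + 1)) :
    symVec e k a = ∑ T with cardFin k T = a, setBasis e k T := by
  rw [symVec]
  congr 1
  ext T
  simp [Finset.mem_powersetCard, cardFin, Fin.ext_iff]

/-- Permutations of the factors permute the basis `setBasis`, and they act transitively on the
subsets of each cardinality. -/
theorem mem_symPow_iff (x : Pow V k) : x ∈ symPow V k ↔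
    ∀ S T, cardFin k S = cardFin k T → (setBasis e k).repr x S = (setBasis e k).repr x T := by
  simp only [symPow, Submodule.mem_iInf, LinearMap.mem_eqLocus, LinearMap.id_apply]
  simp only [apply_eq_self_iff_of_permutes (setBasis e k) _ (permute_setBasis e k _)]
  constructor
  · intro h S T hST
    obtain ⟨π, rfl⟩ := exists_perm_of_card_eq (cardFin_eq_iff.1 hST)
    exact (h π S).symm
  · intro h π S
    exact h _ _ (cardFin_eq_iff.2 (by simp))

/-- Double counting: a set of size a with a point outside it is the same as a set of size a + 1 with
a point in it. -/
theorem sum_powersetCard_insert {M : Type} [AddCommMonoid M] (a : ℕ)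
    (f : Finset (Fin k) → Finset (Fin k) → M) :
    ∑ T ∈ Finset.powersetCard a Finset.univ, ∑ i ∈ Tᶜ, f T (insert i T) =
      ∑ T ∈ Finset.powersetCard (a + 1) Finset.univ, ∑ i ∈ T, f (T.erase i) T := by
  rw [Finset.sum_sigma', Finset.sum_sigma']
  refine Finset.sum_bij' (fun p _ => ⟨insert p.2 p.1, p.2⟩) (fun p _ => ⟨p.1.erase p.2, p.2⟩)
    ?_ ?_ ?_ ?_ ?_
  · rintro ⟨T, i⟩ h
    simp only [Finset.mem_sigma, Finset.mem_powersetCard, Finset.subset_univ, true_and,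
      Finset.mem_compl] at h ⊢
    exact ⟨by rw [Finset.card_insert_of_notMem h.2, h.1], Finset.mem_insert_self _ _⟩
  · rintro ⟨T, i⟩ h
    simp only [Finset.mem_sigma, Finset.mem_powersetCard, Finset.subset_univ, true_and,
      Finset.mem_compl] at h ⊢
    exact ⟨by rw [Finset.card_erase_of_mem h.2, h.1]; rfl, Finset.notMem_erase _ _⟩
  · rintro ⟨T, i⟩ h
    simp only [Finset.mem_sigma, Finset.mem_compl] at h
    simp [Finset.erase_insert h.2]
  · rintro ⟨T, i⟩ h
    simp only [Finset.mem_sigma] at h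
    simp [Finset.insert_erase h.2]
  · rintro ⟨T, i⟩ h
    simp only [Finset.mem_sigma, Finset.mem_compl] at h
    simp [Finset.erase_insert h.2]

/-- The operators `Tp`, `Tm`, `T3` act on the basis `e` as in the spin `1/2` representation. -/
structure Doublet (e : Module.Basis (Fin 2) ℂ V) (Tp Tm T3 : Module.End ℂ V) : Prop where
  raise_zero : Tp (e 0) = 0
  raise_one : Tp (e 1) = e 0
  lower_zero : Tm (e 0) = e 1
  lower_one : Tm (e 1) = 0
  weight_zero : T3 (e 0) = (1 / 2 : ℂ) • e 0
  weight_one : T3 (e 1) = -(1 / 2 : ℂ) • e 1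

-- As derivations, lowering inserts a point into the index set and raising erases one. A set of size
-- a + 1 arises from a + 1 smaller sets, and a set of size a from k - a larger ones; these are the
-- ladder coefficients.
variable {e} in
theorem Doublet.ladder {Tp Tm T3 : Module.End ℂ V} (h : Doublet e Tp Tm T3) :
    Ladder k (powDer V k Tp) (powDer V k Tm) (powDer V k T3) (symVec e k) := by
  have hm : ∀ T, powDer V k Tm (setBasis e k T) = ∑ i ∈ Tᶜ, setBasis e k (insert i T) := by
    intro T
    rw [setBasis_apply, powDer_tprod, ← Finset.sum_compl_add_sum T, add_eq_left.2]
    · refine Finset.sum_congr rfl fun i hi => ?_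
      rw [if_neg (Finset.mem_compl.1 hi), h.lower_zero, (update_setBasis e k T i).1]
    · refine Finset.sum_eq_zero fun i hi => ?_
      rw [if_pos hi, h.lower_one, MultilinearMap.map_update_zero]
  have hp : ∀ T, powDer V k Tp (setBasis e k T) = ∑ i ∈ T, setBasis e k (T.erase i) := by
    intro T
    rw [setBasis_apply, powDer_tprod, ← Finset.sum_compl_add_sum T, add_eq_right.2]
    · refine Finset.sum_congr rfl fun i hi => ?_
      rw [if_pos hi, h.raise_one, (update_setBasis e k T i).2]
    · refine Finset.sum_eq_zero fun i hi => ?_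
      rw [if_neg (Finset.mem_compl.1 hi), h.raise_zero, MultilinearMap.map_update_zero]
  have h3 : ∀ T, powDer V k T3 (setBasis e k T) = (k / 2 - T.card : ℂ) • setBasis e k T := by
    intro T
    rw [setBasis_apply, powDer_tprod, ← Finset.sum_compl_add_sum T]
    rw [Finset.sum_congr rfl (g := fun _ => (1 / 2 : ℂ) • setBasis e k T),
      Finset.sum_congr (s₁ := T) rfl (g := fun _ => (-(1 / 2) : ℂ) • setBasis e k T),
      Finset.sum_const, Finset.sum_const, Finset.card_compl, Fintype.card_fin, ← setBasis_apply]
    · rw [← Nat.cast_smul_eq_nsmul ℂ, ← Nat.cast_smul_eq_nsmul ℂ, Nat.cast_sub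
        ((Finset.card_le_univ T).trans_eq (Fintype.card_fin k))]
      module
    · intro i hi
      rw [if_pos hi, h.weight_one, MultilinearMap.map_update_smul, (update_setBasis e k T i).1,
        Finset.insert_eq_of_mem hi]
    · intro i hi
      rw [if_neg (Finset.mem_compl.1 hi), h.weight_zero, MultilinearMap.map_update_smul,
        (update_setBasis e k T i).2, Finset.erase_eq_of_notMem (Finset.mem_compl.1 hi)]
  have hz : ∀ a, k < a → symVec e k a = 0 := fun a ha => by
    rw [symVec, Finset.powersetCard_eq_empty.2 (by simpa using ha), Finset.sum_empty]
  refine ⟨fun a => ?_, fun a => ?_, fun a => ?_, hz⟩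
  · rw [symVec, map_sum]
    simp only [hm]
    rw [sum_powersetCard_insert k a fun _ T => setBasis e k T, symVec, Finset.smul_sum]
    refine Finset.sum_congr rfl fun T hT => ?_
    rw [Finset.sum_const, (Finset.mem_powersetCard.1 hT).2, ← Nat.cast_smul_eq_nsmul ℂ]
    push_cast; rfl
  · rcases a with _ | a
    · rw [raiseCoeff_zero, zero_smul, symVec, map_sum]
      simp [hp]
    · rw [symVec, map_sum]
      simp only [hp]
      rw [← sum_powersetCard_insert k a fun T _ => setBasis e k T, symVec, Finset.smul_sum,
        Nat.add_sub_cancel, raiseCoeff_succ]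
      refine Finset.sum_congr rfl fun T hT => ?_
      have hT := (Finset.mem_powersetCard.1 hT).2
      rw [Finset.sum_const, Finset.card_compl, hT, Fintype.card_fin,
        ← Nat.cast_smul_eq_nsmul ℂ, Nat.cast_sub]
      rw [← hT]; exact (Finset.card_le_univ T).trans_eq (Fintype.card_fin k)
  · rw [symVec, map_sum, Finset.smul_sum]
    refine Finset.sum_congr rfl fun T hT => ?_
    rw [h3, (Finset.mem_powersetCard.1 hT).2]

end SymmetricPower

/-! ### The ladder pairs of symmetric and mixed spintensors. -/

section Ladders

variable {V V' : Type} [AddCommGroup V] [Module ℂ V] [AddCommGroup V'] [Module ℂ V']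
  {e : Module.Basis (Fin 2) ℂ V} {e' : Module.Basis (Fin 2) ℂ V'}

theorem BiLadder.swap {W : Submodule ℂ V} {k r : ℕ} {X Y : Fin 3 → Module.End ℂ V}
    {v : ℕ → ℕ → V} (h : BiLadder W k r X Y v) : BiLadder W r k Y X fun a c => v c a := by
  refine ⟨fun c => h.right c, fun a => h.left a, ?_, ?_⟩
  · exact h.linearIndependent.comp Prod.swap Prod.swap_injective
  · rw [← h.span_eq, ← Prod.swap_surjective.range_comp]; rfl

/-- The operators `T j` act on the basis `e` as in the spin `1/2` representation. -/
abbrev IsDoublet (e : Module.Basis (Fin 2) ℂ V) (T : Fin 3 → Module.End ℂ V) : Prop :=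
  Doublet e (T 0 + Complex.I • T 1) (T 0 - Complex.I • T 1) (T 2)

theorem IsDoublet.ladder {T : Fin 3 → Module.End ℂ V} (h : IsDoublet e T) (k : ℕ) :
    Ladder k (powDer V k (T 0) + Complex.I • powDer V k (T 1))
      (powDer V k (T 0) - Complex.I • powDer V k (T 1)) (powDer V k (T 2)) (symVec e k) := by
  rw [← map_smul, ← map_add, ← map_sub]
  exact Doublet.ladder k h

/-- The second ladder is trivial of spin 0; its vectors with c > 0 must be zero because a `Ladder`
is indexed by all natural numbers. -/
theorem IsDoublet.biLadder_symPow {T : Fin 3 → Module.End ℂ V} (h : IsDoublet e T) (k : ℕ) :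
    BiLadder (symPow V k) k 0 (fun j => powDer V k (T j)) 0
      fun a c => if c = 0 then symVec e k a else 0 := by
  refine ⟨fun c => ?_, fun a => ?_, ?_, ?_⟩
  · by_cases hc : c = 0
    · simpa [hc] using h.ladder k
    · constructor <;> simp [hc]
  · constructor
    · simp
    · rintro (_ | _ | c) <;> simp [raiseCoeff]
    · rintro (_ | c) <;> simp
    · intro c hc; simp [hc.ne']
  · have : LinearIndependent ℂ fun a : Fin (k + 1) => symVec e k a := by
      simp only [symVec_eq_fiberSum]
      exact linearIndependent_fiberSum _ (cardFin_surjective k)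
    have hc : (fun p : Fin (k + 1) × Fin (0 + 1) => if (p.2 : ℕ) = 0 then symVec e k p.1 else 0) =
        (fun a : Fin (k + 1) => symVec e k a) ∘ Prod.fst := by funext p; simp
    rw [hc]
    exact this.comp _ fun p q hpq => Prod.ext hpq (Subsingleton.elim (α := Fin 1) _ _)
  · rw [← span_fiberSum (setBasis e k) (cardFin_surjective k) (mem_symPow_iff e k)]
    congr 1
    ext x
    simp [← symVec_eq_fiberSum]

theorem mem_symMixed_iff (e : Module.Basis (Fin 2) ℂ V) (e' : Module.Basis (Fin 2) ℂ V') (k r : ℕ)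
    (x : Pow V k ⊗[ℂ] Pow V' r) : x ∈ symMixed V V' k r ↔
      ∀ S T : Finset (Fin k) × Finset (Fin r),
        Prod.map (cardFin k) (cardFin r) S = Prod.map (cardFin k) (cardFin r) T →
        ((setBasis e k).tensorProduct (setBasis e' r)).repr x S =
          ((setBasis e k).tensorProduct (setBasis e' r)).repr x T := by
  set b := (setBasis e k).tensorProduct (setBasis e' r) with hb
  have h1 : ∀ (π : Equiv.Perm (Fin k)) (S : Finset (Fin k) × Finset (Fin r)),
      TensorProduct.map (permute V π) LinearMap.id (b S) =
        b ((Equiv.prodCongr (Equiv.finsetCongr π) (Equiv.refl _)) S) := fun π S => by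
    rw [hb, Module.Basis.tensorProduct_apply', Module.Basis.tensorProduct_apply',
      TensorProduct.map_tmul, permute_setBasis]
    rfl
  have h2 : ∀ (π : Equiv.Perm (Fin r)) (S : Finset (Fin k) × Finset (Fin r)),
      TensorProduct.map LinearMap.id (permute V' π) (b S) =
        b ((Equiv.prodCongr (Equiv.refl _) (Equiv.finsetCongr π)) S) := fun π S => by
    rw [hb, Module.Basis.tensorProduct_apply', Module.Basis.tensorProduct_apply',
      TensorProduct.map_tmul, permute_setBasis]
    rfl
  simp only [symMixed, Submodule.mem_inf, Submodule.mem_iInf, LinearMap.mem_eqLocus,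
    LinearMap.id_apply]
  simp only [apply_eq_self_iff_of_permutes b _ (h1 _), apply_eq_self_iff_of_permutes b _ (h2 _)]
  constructor
  · rintro ⟨i1, i2⟩ ⟨S, S'⟩ ⟨T, T'⟩ hST
    obtain ⟨e1, e2⟩ := Prod.ext_iff.1 hST
    obtain ⟨π, rfl⟩ := exists_perm_of_card_eq (cardFin_eq_iff.1 e1)
    obtain ⟨π', rfl⟩ := exists_perm_of_card_eq (cardFin_eq_iff.1 e2)
    exact (i1 π (S, S')).symm.trans (i2 π' _).symm
  · intro h
    exact ⟨fun π S => h _ _ (Prod.ext (cardFin_eq_iff.2 (by simp)) rfl),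
      fun π S => h _ _ (Prod.ext rfl (cardFin_eq_iff.2 (by simp)))⟩

/-- The products of two `symVec` are fiber sums over pairs of sets with prescribed cardinalities, so
basis and span come from the same lemmas as for one factor. -/
theorem IsDoublet.biLadder_symMixed {T : Fin 3 → Module.End ℂ V} {T' : Fin 3 → Module.End ℂ V'}
    (h : IsDoublet e T) (h' : IsDoublet e' T') (k r : ℕ) :
    BiLadder (symMixed V V' k r) k r (fun j => tensorDer (powDer V k (T j)) 0)
      (fun j => tensorDer 0 (powDer V' r (T' j))) fun a c => symVec e k a ⊗ₜ symVec e' r c := by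
  have l := h.ladder k
  have l' := h'.ladder r
  have hsum : (fun p : Fin (k + 1) × Fin (r + 1) => symVec e k p.1 ⊗ₜ[ℂ] symVec e' r p.2) =
      fun p => ∑ S with Prod.map (cardFin k) (cardFin r) S = p,
        (setBasis e k).tensorProduct (setBasis e' r) S := by
    funext p
    rw [symVec_eq_fiberSum, symVec_eq_fiberSum, TensorProduct.sum_tmul]
    simp only [TensorProduct.tmul_sum]
    rw [← Finset.sum_product']
    refine Finset.sum_congr ?_ fun S _ => (Module.Basis.tensorProduct_apply' _ _ _).symm
    ext S
    simp [Prod.ext_iff]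
  have surj : Function.Surjective (Prod.map (cardFin k) (cardFin r)) :=
    (cardFin_surjective k).prodMap (cardFin_surjective r)
  refine ⟨fun c => ⟨fun a => ?_, fun a => ?_, fun a => ?_, fun a ha => ?_⟩,
    fun a => ⟨fun c => ?_, fun c => ?_, fun c => ?_, fun c hc => ?_⟩, ?_, ?_⟩
  · have := congrArg (· ⊗ₜ[ℂ] symVec e' r c) (l.lower a)
    simpa [tensorDer_tmul, TensorProduct.sub_tmul, TensorProduct.smul_tmul'] using this
  · have := congrArg (· ⊗ₜ[ℂ] symVec e' r c) (l.raise a)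
    simpa [tensorDer_tmul, TensorProduct.add_tmul, TensorProduct.smul_tmul'] using this
  · have := congrArg (· ⊗ₜ[ℂ] symVec e' r c) (l.weight a)
    simpa [tensorDer_tmul, TensorProduct.smul_tmul'] using this
  · rw [l.zero a ha, TensorProduct.zero_tmul]
  · have := congrArg (symVec e k a ⊗ₜ[ℂ] ·) (l'.lower c)
    simpa [tensorDer_tmul, TensorProduct.tmul_sub] using this
  · have := congrArg (symVec e k a ⊗ₜ[ℂ] ·) (l'.raise c)
    simpa [tensorDer_tmul, TensorProduct.tmul_add] using this
  · have := congrArg (symVec e k a ⊗ₜ[ℂ] ·) (l'.weight c)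
    simpa [tensorDer_tmul] using this
  · rw [l'.zero c hc, TensorProduct.tmul_zero]
  · rw [hsum]; exact linearIndependent_fiberSum _ surj
  · rw [hsum]; exact span_fiberSum _ surj (mem_symMixed_iff e e' k r)

end Ladders

/-! ### Rotations and boosts in the Pauli algebra. -/

section OneParameter

/-- The Pauli generators `s₁, s₂, s₃`. -/
def pauli (i : Fin 3) : C2 := ![s1, s2, s3] i

theorem s1_mul_s2 : s1 * s2 = Complex.I • s3 := by
  rw [s3, smul_neg, smul_smul, Complex.I_mul_I]; simp

theorem s2_mul_s3 : s2 * s3 = Complex.I • s1 := by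
  rw [s3, mul_neg, mul_smul_comm, ← mul_assoc, s2_s1, neg_mul, mul_assoc, s2_sq]
  simp

theorem s3_mul_s1 : s3 * s1 = Complex.I • s2 := by
  rw [s3, neg_mul, smul_mul_assoc, s1_s2_s1]; simp

theorem pauli_mul (i : Fin 3) : pauli (i + 1) * pauli (i + 2) = Complex.I • pauli i := by
  fin_cases i
  · exact s2_mul_s3
  · exact s3_mul_s1
  · exact s1_mul_s2

theorem paravec_eNeg (ε : ℝ) (i : Fin 3) :
    paravec ε (Pi.single (Sum.inr i) 1) = (ε : ℂ) • pauli i := by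
  rw [paravec_apply]
  fin_cases i <;> simp [pauli]

theorem paravec_ePos (ε : ℝ) : paravec ε (Pi.single (Sum.inl 0) 1) = 1 := by
  rw [paravec_apply]; simp

theorem sigma_eq {g : Spin13} {c s : ℝ} {v w : Fin 1 ⊕ Fin 3 → ℝ}
    (h : (g : Cl 1 3) = c • (1 : Cl 1 3) +
      s • (CliffordAlgebra.ι (realForm 1 3) v * CliffordAlgebra.ι (realForm 1 3) w)) :
    sigma g = (c : ℂ) • 1 + (s : ℂ) • (paravec 1 v * paravec (-1) w) := by
  have : (⟨g.1, spinGroup.mem_even g.2⟩ : CliffordAlgebra.even (realForm 1 3)) =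
      c • 1 + s • (CliffordAlgebra.even.ι (realForm 1 3)).bilin v w := Subtype.ext h
  change evenToC2 _ = _
  rw [this, map_add, map_smul, map_smul, map_one, evenToC2, CliffordAlgebra.even.lift_ι,
    Complex.coe_smul, Complex.coe_smul]
  rfl

/-- The sign comes from the second paravector: e_{i+1}e_{i+2} goes to s_{i+1}(-s_{i+2}) = -i s_i. -/
theorem sigma_rot (i : Fin 3) (t : ℝ) : sigma (rot i t) =
    ((Real.cos (t / 2) : ℝ) : ℂ) • 1 + ((Real.sin (t / 2) : ℝ) : ℂ) • -(Complex.I • pauli i) := by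
  rw [sigma_eq (g := rot i t) rfl, paravec_eNeg, paravec_eNeg, smul_mul_smul_comm, pauli_mul]
  simp

theorem sigma_boost (i : Fin 3) (t : ℝ) : sigma (boost i t) =
    ((Real.cosh (t / 2) : ℝ) : ℂ) • 1 + ((Real.sinh (t / 2) : ℝ) : ℂ) • -pauli i := by
  rw [sigma_eq (g := boost i t) rfl, paravec_eNeg, paravec_ePos]
  simp

/-- The coefficients are real, so passing to the conjugate algebra leaves them unchanged. -/
theorem sigmaBar_eq {g : Spin13} {c s : ℝ} {x : C2} (h : sigma g = (c : ℂ) • 1 + (s : ℂ) • x) :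
    sigmaBar g = (c : ℂ) • 1 + (s : ℂ) • conjAlg C2 x := by
  change conjAlg C2 (sigma g) = _
  rw [h, map_add]
  nth_rw 1 [← Complex.conj_ofReal c]
  nth_rw 1 [← Complex.conj_ofReal s]
  rw [← smul_conjAlg, ← smul_conjAlg, map_one]

theorem hasDerivAt_half {f : ℝ → ℝ} {f' : ℝ} (h : HasDerivAt f f' 0) :
    HasDerivAt (fun t => ((f (t / 2) : ℝ) : ℂ)) ((f' / 2 : ℝ) : ℂ) 0 := by
  have h2 : HasDerivAt (fun t : ℝ => t / 2) (1 / 2) 0 := (hasDerivAt_id _).div_const 2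
  have h3 : HasDerivAt f f' ((fun t : ℝ => t / 2) 0) := by simpa using h
  have := h3.comp 0 h2
  rw [mul_one_div] at this
  exact this.ofReal_comp

/-- The factor 1/2 is the derivative of t/2; at 0 the cosines have derivative 0 and the sines
derivative 1. -/
theorem infinitesimal_of_eq {V A : Type} [AddCommGroup V] [Module ℂ V] [Ring A] [Algebra ℂ A]
    {γ : A →ₐ[ℂ] Module.End ℂ V} {u : Spin13 →* A} {a b : Fin 3 → A}
    (ha : ∀ i t, u (rot i t) =
      ((Real.cos (t / 2) : ℝ) : ℂ) • 1 + ((Real.sin (t / 2) : ℝ) : ℂ) • a i)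
    (hb : ∀ i t, u (boost i t) =
      ((Real.cosh (t / 2) : ℝ) : ℂ) • 1 + ((Real.sinh (t / 2) : ℝ) : ℂ) • b i) :
    Infinitesimal (repOf γ u) (fun i => (1 / 2 : ℂ) • γ (a i)) fun i => (1 / 2 : ℂ) • γ (b i) := by
  have key : ∀ (g : ℝ → Spin13) (E : A) (c s : ℝ → ℝ), HasDerivAt c 0 0 → HasDerivAt s 1 0 →
      (∀ t, u (g t) = ((c (t / 2) : ℝ) : ℂ) • 1 + ((s (t / 2) : ℝ) : ℂ) • E) →
      ∀ v, HasWeakDeriv (fun t => repOf γ u (g t) v) (((1 / 2 : ℂ) • γ E) v) := by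
    intro g E c s hc hs hg v
    have h : ∀ t, repOf γ u (g t) v =
        ((c (t / 2) : ℝ) : ℂ) • v + ((s (t / 2) : ℝ) : ℂ) • γ E v := fun t => by
      change γ (u (g t)) v = _
      rw [hg, map_add, map_smul, map_smul, map_one]; rfl
    simp only [h]
    have := ((HasWeakDeriv.const v).smul (hasDerivAt_half hc)).add
      ((HasWeakDeriv.const (γ E v)).smul (hasDerivAt_half hs))
    simpa using this
  rw [Infinitesimal.hasWeakDeriv_iff]
  refine ⟨fun i => key _ _ Real.cos Real.sin ?_ ?_ (ha i),
    fun i => key _ _ Real.cosh Real.sinh ?_ ?_ (hb i)⟩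
  · simpa using Real.hasDerivAt_cos 0
  · simpa using Real.hasDerivAt_sin 0
  · simpa using Real.hasDerivAt_cosh 0
  · simpa using Real.hasDerivAt_sinh 0

/-- The infinitesimal rotations and boosts of the spinspace. -/
abbrev rotGen (i : Fin 3) : Module.End ℂ S2 := (1 / 2 : ℂ) • spinor (-(Complex.I • pauli i))
/-- See `rotGen`. -/
abbrev boostGen (i : Fin 3) : Module.End ℂ S2 := (1 / 2 : ℂ) • spinor (-pauli i)
/-- The infinitesimal rotations and boosts of the dotted spinspace. -/
abbrev rotGenDot (i : Fin 3) : Module.End ℂ (ConjMod S2) :=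
  (1 / 2 : ℂ) • conjAction spinor (conjAlg C2 (-(Complex.I • pauli i)))
/-- See `rotGenDot`. -/
abbrev boostGenDot (i : Fin 3) : Module.End ℂ (ConjMod S2) :=
  (1 / 2 : ℂ) • conjAction spinor (conjAlg C2 (-pauli i))

theorem infinitesimal_und : Infinitesimal (repOf spinor sigma) rotGen boostGen :=
  infinitesimal_of_eq sigma_rot sigma_boost

theorem infinitesimal_dot :
    Infinitesimal (repOf (conjAction spinor) sigmaBar) rotGenDot boostGenDot :=
  infinitesimal_of_eq (fun i t => sigmaBar_eq (sigma_rot i t))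
    fun i t => sigmaBar_eq (sigma_boost i t)

theorem spinor_s1 : spinor s1 = Matrix.toLin' !![0, 1; 1, 0] := by
  have : spinor s1 = Matrix.toLin' (pauliVec (Pi.single 0 1)) := by
    change Matrix.toLin' (CliffordAlgebra.lift _ _ (CliffordAlgebra.ι _ _)) = _
    rw [CliffordAlgebra.lift_ι_apply]
  rw [this]; congr 1; ext i j; fin_cases i <;> fin_cases j <;> simp [pauliVec]

theorem spinor_s2 : spinor s2 = Matrix.toLin' !![0, -Complex.I; Complex.I, 0] := by
  have : spinor s2 = Matrix.toLin' (pauliVec (Pi.single 1 1)) := by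
    change Matrix.toLin' (CliffordAlgebra.lift _ _ (CliffordAlgebra.ι _ _)) = _
    rw [CliffordAlgebra.lift_ι_apply]
  rw [this]; congr 1; ext i j; fin_cases i <;> fin_cases j <;> simp [pauliVec]

theorem spinor_s3 : spinor s3 = Matrix.toLin' !![1, 0; 0, -1] := by
  rw [s3, map_neg, map_smul, map_mul, spinor_s1, spinor_s2, Module.End.mul_eq_comp,
    ← Matrix.toLin'_mul, ← map_smul, ← map_neg]
  congr 1; ext i j; fin_cases i <;> fin_cases j <;> simp

theorem spinor_pauli_apply (i : Fin 3) (v : S2) : spinor (pauli i) v =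
    ![![v 1, v 0], ![-(Complex.I * v 1), Complex.I * v 0], ![v 0, -v 1]] i := by
  fin_cases i
  · change spinor s1 v = ![v 1, v 0]
    rw [spinor_s1]; ext j; fin_cases j <;> simp [Matrix.mulVec, dotProduct]
  · change spinor s2 v = ![-(Complex.I * v 1), Complex.I * v 0]
    rw [spinor_s2]; ext j; fin_cases j <;> simp [Matrix.mulVec, dotProduct]
  · change spinor s3 v = ![v 0, -v 1]
    rw [spinor_s3]; ext j; fin_cases j <;> simp [Matrix.mulVec, dotProduct]

theorem isDoublet_und : IsDoublet (Pi.basisFun ℂ (Fin 2))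
    fun j => (1 / 2 : ℂ) • spinor (pauli j) := by
  constructor <;> ext j <;> fin_cases j <;>
    simp [spinor_pauli_apply] <;> ring_nf <;> simp <;> norm_num

/-- The conjugate of the standard basis, in the order and with the signs of a doublet. -/
def dotBasis : Module.Basis (Fin 2) ℂ (ConjMod S2) :=
  .ofEquivFun
    { toFun v := ![starRingEnd ℂ ((conjMod S2).symm v 1), -starRingEnd ℂ ((conjMod S2).symm v 0)]
      invFun z := conjMod S2 ![-starRingEnd ℂ (z 1), starRingEnd ℂ (z 0)]
      map_add' v w := by
        ext i; fin_cases i <;> simp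
        ring
      map_smul' c v := by
        obtain ⟨v, rfl⟩ := (conjMod S2).surjective v
        rw [smul_conjMod]
        ext i; fin_cases i <;> simp
      left_inv v := by
        obtain ⟨v, rfl⟩ := (conjMod S2).surjective v
        refine congrArg (conjMod S2) (funext fun i => ?_)
        fin_cases i <;> simp
      right_inv z := by ext i; fin_cases i <;> simp }

theorem dotBasis_zero : dotBasis 0 = conjMod S2 ![0, 1] := by
  rw [dotBasis, Module.Basis.coe_ofEquivFun]
  change conjMod S2 ![-starRingEnd ℂ (Pi.single (M := fun _ => ℂ) (_ : Fin 2) (1 : ℂ) 1),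
    starRingEnd ℂ (Pi.single (M := fun _ => ℂ) (_ : Fin 2) (1 : ℂ) 0)] = _
  simp

theorem dotBasis_one : dotBasis 1 = conjMod S2 ![-1, 0] := by
  rw [dotBasis, Module.Basis.coe_ofEquivFun]
  change conjMod S2 ![-starRingEnd ℂ (Pi.single (M := fun _ => ℂ) (_ : Fin 2) (1 : ℂ) 1),
    starRingEnd ℂ (Pi.single (M := fun _ => ℂ) (_ : Fin 2) (1 : ℂ) 0)] = _
  simp

/-- The operators are -s/2 on the conjugate space, so the weights of the standard basis are
interchanged; `dotBasis` reverses it and changes one sign so that raising and lowering have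
coefficient +1. -/
theorem isDoublet_dot : IsDoublet dotBasis
    fun j => -((1 / 2 : ℂ) • conjAction spinor (conjAlg C2 (pauli j))) := by
  have h : ∀ j v, conjAction spinor (conjAlg C2 (pauli j)) (conjMod S2 v) =
    conjMod S2 (spinor (pauli j) v) := fun j v => rfl
  have h2 : starRingEnd ℂ 2 = 2 := map_ofNat _ 2
  have ext (x y : ConjMod S2) (hxy : ∀ i, (conjMod S2).symm x i = (conjMod S2).symm y i) : x = y :=
    funext hxy
  have hI := Complex.I_mul_I
  constructor <;> apply ext <;> intro i <;>
    simp only [dotBasis_zero, dotBasis_one, LinearMap.add_apply, LinearMap.sub_apply,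
      LinearMap.smul_apply, LinearMap.neg_apply, h, spinor_pauli_apply, smul_conjMod, ← map_add,
      ← map_neg, ← map_sub, AddEquiv.symm_apply_apply] <;>
    fin_cases i <;> simp [h2] <;> 
    first
      | linear_combination (1 / 2 : ℂ) * hI
      | linear_combination (-1 / 2 : ℂ) * hI

end OneParameter

/-! ### Fields carried by invariant subspaces and by direct sums. -/

section Carriers

variable {V V' : Type} [AddCommGroup V] [Module ℂ V] [AddCommGroup V'] [Module ℂ V']

/-- Every representation that is equivalent to the action of `ρ` on `W` is a field of the given
type. -/
def IsFieldOn (ρ : Representation ℂ Spin13 V) (W : Submodule ℂ V) (l l' l0 l1 : ℝ) : Prop :=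
  ∀ (U : Type) [AddCommGroup U] [Module ℂ U] (ρU : Representation ℂ Spin13 U) (ι : U →ₗ[ℂ] V),
    Function.Injective ι → (∀ g u, ι (ρU g u) = ρ g (ι u)) → LinearMap.range ι = W →
    IsField ρU l l' l0 l1

theorem IsFieldOn.carriesField {ρ : Representation ℂ Spin13 V} {W : Submodule ℂ V}
    {l l' l0 l1 : ℝ} (h : IsFieldOn ρ W l l' l0 l1) (hW : ∀ g, ∀ w ∈ W, ρ g w ∈ W) :
    CarriesField ρ W l l' l0 l1 :=
  ⟨⟨W, hW⟩, rfl, h _ _ W.subtype W.injective_subtype (fun _ _ => rfl) W.range_subtype⟩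

/-- The summands are the pairs with one component zero. The projection to the other component
identifies each with W or W', and `IsFieldOn` was quantified over equivalent representations for
exactly this use. -/
theorem IsFieldOn.carriesSumField {ρ : Representation ℂ Spin13 V} {ρ' : Representation ℂ Spin13 V'}
    {W : Submodule ℂ V} {W' : Submodule ℂ V'} {l l' l0 l1 m m' m0 m1 : ℝ}
    (h : IsFieldOn ρ W l l' l0 l1) (h' : IsFieldOn ρ' W' m m' m0 m1)
    (hW : ∀ g, ∀ w ∈ W, ρ g w ∈ W) (hW' : ∀ g, ∀ w ∈ W', ρ' g w ∈ W')
    {σ : Representation ℂ Spin13 (V × V')} (hσ : ∀ g p, σ g p = (ρ g p.1, ρ' g p.2)) :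
    CarriesSumField σ (W.prod W') l l' l0 l1 m m' m0 m1 := by
  let F : Subrepresentation σ := ⟨W.prod W', fun g p hp => by
    rw [hσ]; exact ⟨hW g _ hp.1, hW' g _ hp.2⟩⟩
  let W₁ : Subrepresentation F.toRepresentation :=
    ⟨LinearMap.ker (LinearMap.snd ℂ V V' ∘ₗ F.toSubmodule.subtype), fun g p hp => by
      have hp : (p : V × V').2 = 0 := hp
      change (σ g p).2 = 0
      rw [hσ, hp, map_zero]⟩
  let W₂ : Subrepresentation F.toRepresentation :=
    ⟨LinearMap.ker (LinearMap.fst ℂ V V' ∘ₗ F.toSubmodule.subtype), fun g p hp => by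
      have hp : (p : V × V').1 = 0 := hp
      change (σ g p).1 = 0
      rw [hσ, hp, map_zero]⟩
  refine ⟨F, rfl, W₁, W₂, ?_, ?_, ?_⟩
  · change IsCompl W₁.toSubmodule W₂.toSubmodule
    constructor
    · rw [Submodule.disjoint_def]
      intro p h1 h2
      exact Subtype.ext (Prod.ext h2 h1)
    · rw [codisjoint_iff, eq_top_iff]
      rintro ⟨p, hp⟩ -
      refine Submodule.mem_sup.2 ⟨⟨(p.1, 0), hp.1, zero_mem _⟩, rfl, ⟨(0, p.2), zero_mem _, hp.2⟩,
        rfl, ?_⟩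
      exact Subtype.ext (Prod.ext (add_zero _) (zero_add _))
  · refine h _ _ (LinearMap.fst ℂ V V' ∘ₗ F.toSubmodule.subtype ∘ₗ W₁.toSubmodule.subtype)
      ?_ ?_ ?_
    · rintro ⟨⟨p, hp⟩, h1⟩ ⟨⟨q, hq⟩, h2⟩ hpq
      exact Subtype.ext (Subtype.ext (Prod.ext hpq ((show p.2 = 0 from h1).trans
        (show q.2 = 0 from h2).symm)))
    · intro g u
      exact congrArg Prod.fst (hσ g u.1.1)
    · ext x
      constructor
      · rintro ⟨u, rfl⟩
        exact u.1.2.1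
      · intro hx
        exact ⟨⟨⟨(x, 0), hx, zero_mem _⟩, rfl⟩, rfl⟩
  · refine h' _ _ (LinearMap.snd ℂ V V' ∘ₗ F.toSubmodule.subtype ∘ₗ W₂.toSubmodule.subtype)
      ?_ ?_ ?_
    · rintro ⟨⟨p, hp⟩, h1⟩ ⟨⟨q, hq⟩, h2⟩ hpq
      exact Subtype.ext (Subtype.ext (Prod.ext ((show p.1 = 0 from h1).trans
        (show q.1 = 0 from h2).symm) hpq))
    · intro g u
      exact congrArg Prod.snd (hσ g u.1.1)
    · ext x
      constructor
      · rintro ⟨u, rfl⟩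
        exact u.1.2.2
      · intro hx
        exact ⟨⟨⟨(0, x), zero_mem _, hx⟩, rfl⟩, rfl⟩

theorem BiLadder.isFieldOn {ρ : Representation ℂ Spin13 V} {W : Submodule ℂ V} {k r : ℕ}
    {X Y A B : Fin 3 → Module.End ℂ V} {v : ℕ → ℕ → V} (h : BiLadder W k r X Y v)
    (hAB : Infinitesimal ρ A B)
    (hX : ∀ j, X j = (Complex.I / 2) • (A j + Complex.I • B j))
    (hY : ∀ j, Y j = (Complex.I / 2) • (A j - Complex.I • B j)) :
    IsFieldOn ρ W (k / 2) (r / 2) ((k - r) / 2) ((k + r) / 2 + 1) :=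
  fun _ _ _ _ _ hι hρ hW => isField_of_intertwining hι hρ hW h hAB hX hY

end Carriers

/-! ### Invariance of the symmetric spintensors. -/

section Invariance

variable {A V A' V' : Type} [Ring A] [Algebra ℂ A] [AddCommGroup V] [Module ℂ V]
  [Ring A'] [Algebra ℂ A'] [AddCommGroup V'] [Module ℂ V']

/-- The group acts by the same operator in every factor. -/
theorem permute_repOf_pow (γ : A →ₐ[ℂ] Module.End ℂ V) (u : Spin13 →* A) {k : ℕ} (g : Spin13)
    (π : Equiv.Perm (Fin k)) : permute V π * repOf (powAction γ k) (powHom u k) g =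
      repOf (powAction γ k) (powHom u k) g * permute V π := by
  apply PiTensorProduct.ext
  ext x
  simp only [LinearMap.compMultilinearMap_apply, Module.End.mul_apply, repOf_pow_tprod, permute,
    LinearEquiv.coe_coe, PiTensorProduct.reindex_tprod]

theorem symPow_invariant (γ : A →ₐ[ℂ] Module.End ℂ V) (u : Spin13 →* A) {k : ℕ} (g : Spin13) :
    ∀ w ∈ symPow V k, repOf (powAction γ k) (powHom u k) g w ∈ symPow V k := by
  intro w hw
  simp only [symPow, Submodule.mem_iInf, LinearMap.mem_eqLocus, LinearMap.id_apply] at hw ⊢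
  intro π
  rw [← Module.End.mul_apply, permute_repOf_pow, Module.End.mul_apply, hw]

theorem symMixed_invariant (γ : A →ₐ[ℂ] Module.End ℂ V) (u : Spin13 →* A)
    (γ' : A' →ₐ[ℂ] Module.End ℂ V') (u' : Spin13 →* A') {k r : ℕ} (g : Spin13) :
    ∀ w ∈ symMixed V V' k r, repOf (tensorAction (powAction γ k) (powAction γ' r))
      (tensorHom (powHom u k) (powHom u' r)) g w ∈ symMixed V V' k r := by
  intro w hw
  have hg : repOf (tensorAction (powAction γ k) (powAction γ' r))
      (tensorHom (powHom u k) (powHom u' r)) g = TensorProduct.map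
        (repOf (powAction γ k) (powHom u k) g) (repOf (powAction γ' r) (powHom u' r) g) := rfl
  rw [hg]
  simp only [symMixed, Submodule.mem_inf, Submodule.mem_iInf, LinearMap.mem_eqLocus,
    LinearMap.id_apply] at hw ⊢
  have c1 := fun π => LinearMap.congr_fun (show
    TensorProduct.map (permute V π) LinearMap.id * TensorProduct.map
      (repOf (powAction γ k) (powHom u k) g) (repOf (powAction γ' r) (powHom u' r) g) =
    TensorProduct.map (repOf (powAction γ k) (powHom u k) g)
      (repOf (powAction γ' r) (powHom u' r) g) * TensorProduct.map (permute V π) LinearMap.id by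
    simp only [Module.End.mul_eq_comp, ← TensorProduct.map_comp, LinearMap.id_comp,
      LinearMap.comp_id]
    rw [← Module.End.mul_eq_comp, permute_repOf_pow, Module.End.mul_eq_comp]) w
  have c2 := fun π => LinearMap.congr_fun (show
    TensorProduct.map LinearMap.id (permute V' π) * TensorProduct.map
      (repOf (powAction γ k) (powHom u k) g) (repOf (powAction γ' r) (powHom u' r) g) =
    TensorProduct.map (repOf (powAction γ k) (powHom u k) g)
      (repOf (powAction γ' r) (powHom u' r) g) * TensorProduct.map LinearMap.id (permute V' π) by
    simp only [Module.End.mul_eq_comp, ← TensorProduct.map_comp, LinearMap.id_comp,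
      LinearMap.comp_id]
    rw [← Module.End.mul_eq_comp (permute V' π), permute_repOf_pow, Module.End.mul_eq_comp]) w
  simp only [Module.End.mul_apply] at c1 c2
  exact ⟨fun π => by rw [c1, hw.1], fun π => by rw [c2, hw.2]⟩

end Invariance

/-! ### The spintensor fields. -/

section Fields

/-- With A = -(i/2)s and B = -(1/2)s the two terms of X add up and those of Y cancel. -/
theorem weight_und (j : Fin 3) : (Complex.I / 2) • (rotGen j + Complex.I • boostGen j) =
      (1 / 2 : ℂ) • spinor (pauli j) ∧
    (Complex.I / 2) • (rotGen j - Complex.I • boostGen j) = 0 := by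
  simp only [rotGen, boostGen, map_neg, map_smul]
  constructor <;> match_scalars
  · linear_combination (-(1 / 2)) * Complex.I_mul_I
  · ring

/-- Conjugation turns A into (i/2)s and leaves B = -(1/2)s, so now X cancels and Y = -s/2. -/
theorem weight_dot (j : Fin 3) : (Complex.I / 2) • (rotGenDot j + Complex.I • boostGenDot j) = 0 ∧
    (Complex.I / 2) • (rotGenDot j - Complex.I • boostGenDot j) =
      -((1 / 2 : ℂ) • conjAction spinor (conjAlg C2 (pauli j))) := by
  have : conjAlg C2 (Complex.I • pauli j) = (-Complex.I) • conjAlg C2 (pauli j) := by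
    rw [smul_conjAlg]; simp
  simp only [rotGenDot, boostGenDot, map_neg, this, map_smul]
  constructor <;> match_scalars
  · ring
  · linear_combination (1 / 2) * Complex.I_mul_I

instance : FiniteDimensional ℂ (ConjMod S2) := dotBasis.finiteDimensional_of_finite

instance (k : ℕ) : FiniteDimensional ℂ (S k) :=
  (setBasis (Pi.basisFun ℂ (Fin 2)) k).finiteDimensional_of_finite

instance (k : ℕ) : FiniteDimensional ℂ (SDot k) :=
  (setBasis dotBasis k).finiteDimensional_of_finite

/-- `S_{2^k}` as a representation. -/
abbrev undRep (k : ℕ) : Representation ℂ Spin13 (S k) := repOf (undAction k) (undHom k)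
/-- `Ṡ_{2^r}` as a representation. -/
abbrev dotRep (r : ℕ) : Representation ℂ Spin13 (SDot r) := repOf (dotAction r) (dotHom r)

theorem infinitesimal_undRep (k : ℕ) : Infinitesimal (undRep k)
    (fun i => powDer S2 k (rotGen i)) fun i => powDer S2 k (boostGen i) :=
  infinitesimal_und.pow k

theorem infinitesimal_dotRep (k : ℕ) : Infinitesimal (dotRep k)
    (fun i => powDer (ConjMod S2) k (rotGenDot i)) fun i => powDer (ConjMod S2) k (boostGenDot i) :=
  infinitesimal_dot.pow k

theorem powDer_add {V : Type} [AddCommGroup V] [Module ℂ V] (k : ℕ) (c d : ℂ)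
    (f g : Module.End ℂ V) :
    powDer V k (c • (f + d • g)) = c • (powDer V k f + d • powDer V k g) := by
  rw [map_smul, map_add, map_smul]

theorem powDer_sub {V : Type} [AddCommGroup V] [Module ℂ V] (k : ℕ) (c d : ℂ)
    (f g : Module.End ℂ V) :
    powDer V k (c • (f - d • g)) = c • (powDer V k f - d • powDer V k g) := by
  rw [map_smul, map_sub, map_smul]

theorem powDer_weight_und (k : ℕ) (j : Fin 3) :
    powDer S2 k ((1 / 2 : ℂ) • spinor (pauli j)) =
      (Complex.I / 2) • (powDer S2 k (rotGen j) + Complex.I • powDer S2 k (boostGen j)) ∧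
    0 = (Complex.I / 2) • (powDer S2 k (rotGen j) - Complex.I • powDer S2 k (boostGen j)) := by
  rw [← powDer_add, ← powDer_sub, (weight_und j).1, (weight_und j).2, map_zero]
  exact ⟨rfl, rfl⟩

theorem powDer_weight_dot (k : ℕ) (j : Fin 3) :
    0 = (Complex.I / 2) • (powDer (ConjMod S2) k (rotGenDot j) +
      Complex.I • powDer (ConjMod S2) k (boostGenDot j)) ∧
    powDer (ConjMod S2) k (-((1 / 2 : ℂ) • conjAction spinor (conjAlg C2 (pauli j)))) =
      (Complex.I / 2) • (powDer (ConjMod S2) k (rotGenDot j) -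
        Complex.I • powDer (ConjMod S2) k (boostGenDot j)) := by
  rw [← powDer_add, ← powDer_sub, (weight_dot j).1, (weight_dot j).2, map_zero]
  exact ⟨rfl, rfl⟩

theorem isFieldOn_und (k : ℕ) :
    IsFieldOn (undRep k) (symPow S2 k) (k / 2) 0 (k / 2) (k / 2 + 1) := by
  have := (isDoublet_und.biLadder_symPow k).isFieldOn (infinitesimal_undRep k)
    (fun j => (powDer_weight_und k j).1) fun j => (powDer_weight_und k j).2
  simpa using this

theorem isFieldOn_dot (r : ℕ) :
    IsFieldOn (dotRep r) (symPow (ConjMod S2) r) 0 (r / 2) (-(r / 2)) (r / 2 + 1) := by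
  have := (isDoublet_dot.biLadder_symPow r).swap.isFieldOn (infinitesimal_dotRep r)
    (fun j => (powDer_weight_dot r j).1) fun j => (powDer_weight_dot r j).2
  simpa [neg_div] using this

theorem tensorDer_add {V V' : Type} [AddCommGroup V] [Module ℂ V] [AddCommGroup V'] [Module ℂ V']
    (c d : ℂ) (f g : Module.End ℂ V) (f' g' : Module.End ℂ V') :
    c • (tensorDer f f' + d • tensorDer g g') =
      tensorDer (c • (f + d • g)) (c • (f' + d • g')) := by
  simp only [tensorDer, TensorProduct.map_add_left, TensorProduct.map_add_right,
    TensorProduct.map_smul_left, TensorProduct.map_smul_right]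
  module

theorem tensorDer_sub {V V' : Type} [AddCommGroup V] [Module ℂ V] [AddCommGroup V'] [Module ℂ V']
    (c d : ℂ) (f g : Module.End ℂ V) (f' g' : Module.End ℂ V') :
    c • (tensorDer f f' - d • tensorDer g g') =
      tensorDer (c • (f - d • g)) (c • (f' - d • g')) := by
  have h := tensorDer_add c (-d) f g f' g'
  rw [show f - d • g = f + (-d) • g by module, show f' - d • g' = f' + (-d) • g' by module, ← h]
  module

theorem isFieldOn_mixed (k r : ℕ) :
    IsFieldOn (V := S k ⊗[ℂ] SDot r)
      (repOf (mixedAction k r) (tensorHom (undHom k) (dotHom r)))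
      (symMixed S2 (ConjMod S2) k r) (k / 2) (r / 2) ((k - r) / 2) ((k + r) / 2 + 1) := by
  refine (isDoublet_und.biLadder_symMixed isDoublet_dot k r).isFieldOn
    ((infinitesimal_undRep k).tensor (infinitesimal_dotRep r)) (fun j => ?_) fun j => ?_
  · rw [tensorDer_add, ← (powDer_weight_und k j).1, ← (powDer_weight_dot r j).1]
  · rw [tensorDer_sub, ← (powDer_weight_und k j).2, ← (powDer_weight_dot r j).2]

/-- The dotted factor comes first here, so the ladder pair is swapped to bring the X-ladder, of spin
r/2, to the front. -/
theorem isFieldOn_mixed' (k r : ℕ) :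
    IsFieldOn (V := SDot k ⊗[ℂ] S r)
      (repOf (mixedAction' k r) (tensorHom (dotHom k) (undHom r)))
      (symMixed (ConjMod S2) S2 k r) (r / 2) (k / 2) (-((k - r) / 2)) ((k + r) / 2 + 1) := by
  have := (isDoublet_dot.biLadder_symMixed isDoublet_und k r).swap.isFieldOn
    ((infinitesimal_dotRep k).tensor (infinitesimal_undRep r)) (fun j => by
      rw [tensorDer_add, ← (powDer_weight_und r j).1, ← (powDer_weight_dot k j).1]) fun j => by
      rw [tensorDer_sub, ← (powDer_weight_und r j).2, ← (powDer_weight_dot k j).2]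
  rwa [show ((r : ℝ) - k) / 2 = -((k - r) / 2) by ring, add_comm (r : ℝ)] at this

theorem carriesField_und (r : ℕ) :
    CarriesField (repOf (undAction r) (undHom r)) (symPow S2 r) (r / 2) 0 (r / 2) (r / 2 + 1) :=
  (isFieldOn_und r).carriesField (symPow_invariant spinor sigma)

theorem carriesSumField_sumRep (k r : ℕ) :
    CarriesSumField (sumRep k r) ((symPow S2 k).prod (symPow (ConjMod S2) r))
      (k / 2) 0 (k / 2) (k / 2 + 1) 0 (r / 2) (-(r / 2)) (r / 2 + 1) :=
  (isFieldOn_und k).carriesSumField (isFieldOn_dot r) (symPow_invariant spinor sigma)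
    (symPow_invariant (conjAction spinor) sigmaBar) fun _ _ => rfl

theorem carriesSumField_mixedRep (k r : ℕ) :
    CarriesSumField (V := (S k ⊗[ℂ] SDot r) × (SDot k ⊗[ℂ] S r)) (mixedRep k r)
      ((symMixed S2 (ConjMod S2) k r).prod (symMixed (ConjMod S2) S2 k r))
      (k / 2) (r / 2) ((k - r) / 2) ((k + r) / 2 + 1)
      (r / 2) (k / 2) (-((k - r) / 2)) ((k + r) / 2 + 1) :=
  (isFieldOn_mixed k r).carriesSumField (isFieldOn_mixed' k r)
    (symMixed_invariant spinor sigma (conjAction spinor) sigmaBar)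
    (symMixed_invariant (conjAction spinor) sigmaBar spinor sigma) fun _ _ => rfl

end Fields

/-! ### The spinor actions are full matrix algebras. -/

section Bijectivity

theorem finrank_cliffordAlgebra {K V : Type} [Field K] [Invertible (2 : K)] [AddCommGroup V]
    [Module K V] [FiniteDimensional K V] (Q : QuadraticForm K V) :
    Module.finrank K (CliffordAlgebra Q) = 2 ^ Module.finrank K V ∧
      FiniteDimensional K (CliffordAlgebra Q) := by
  let b := (Module.finBasis K V).ExteriorAlgebra.map (CliffordAlgebra.equivExterior Q).symm
  refine ⟨?_, b.finiteDimensional_of_finite⟩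
  rw [Module.finrank_eq_card_basis b, Fintype.card_finset, Fintype.card_fin]

theorem bijective_of_apply_basis {K V W ι κ : Type} [Field K] [AddCommGroup V] [Module K V]
    [AddCommGroup W] [Module K W] (f : V →ₗ[K] W) (b : Module.Basis ι K V)
    (b' : Module.Basis κ K W) (e : ι ≃ κ) (h : ∀ i, f (b i) = b' (e i)) : Function.Bijective f := by
  have : f = (b.equiv b' e).toLinearMap := b.ext fun i => by
    rw [h, LinearEquiv.coe_coe, Module.Basis.equiv_apply]
  rw [this]
  exact (b.equiv b' e).bijective

theorem bijective_of_surjective_of_finrank {K V W : Type} [Field K] [AddCommGroup V] [Module K V]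
    [AddCommGroup W] [Module K W] [FiniteDimensional K V] [FiniteDimensional K W] (f : V →ₗ[K] W)
    (hf : Function.Surjective f) (h : Module.finrank K V = Module.finrank K W) :
    Function.Bijective f :=
  ⟨(LinearMap.injective_iff_surjective_of_finrank_eq_finrank h).2 hf, hf⟩

instance : FiniteDimensional ℂ C2 := (finrank_cliffordAlgebra pauliForm).2

theorem finrank_C2 : Module.finrank ℂ C2 = 4 := by
  have := (finrank_cliffordAlgebra pauliForm).1
  rw [Module.finrank_fin_fun] at this
  exact this

theorem spinor_bijective : Function.Bijective spinor := by
  refine bijective_of_surjective_of_finrank spinor.toLinearMap (fun f => ?_) ?_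
  · obtain ⟨M, rfl⟩ := Matrix.toLin'.surjective f
    -- The coordinates of M with respect to 1 and the Pauli matrices.
    refine ⟨((M 0 0 + M 1 1) / 2) • 1 + ((M 0 1 + M 1 0) / 2) • s1 +
      (Complex.I * (M 0 1 - M 1 0) / 2) • s2 + ((M 0 0 - M 1 1) / 2) • s3, ?_⟩
    rw [AlgHom.toLinearMap_apply]
    simp only [map_add, map_smul, map_one, spinor_s1, spinor_s2, spinor_s3]
    refine LinearMap.ext fun v => funext fun i => ?_
    fin_cases i <;> simp [Matrix.mulVec, dotProduct, Fin.sum_univ_two, Matrix.vecHead, Matrix.vecTail]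
    · linear_combination (-(1 / 2) * (M 0 1 - M 1 0) * v 1) * Complex.I_mul_I
    · linear_combination (1 / 2 * (M 0 1 - M 1 0) * v 0) * Complex.I_mul_I
  · rw [finrank_C2, Module.finrank_linearMap]; simp

theorem conjAction_bijective {A V : Type} [Ring A] [Algebra ℂ A] [AddCommGroup V] [Module ℂ V]
    {γ : A →ₐ[ℂ] Module.End ℂ V} (h : Function.Bijective γ) :
    Function.Bijective (conjAction γ) := by
  constructor
  · intro a b hab
    obtain ⟨a, rfl⟩ := (conjAlg A).surjective a
    obtain ⟨b, rfl⟩ := (conjAlg A).surjective b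
    have : γ a = γ b := LinearMap.ext fun v => LinearMap.congr_fun hab (conjMod V v)
    rw [h.1 this]
  · intro f
    obtain ⟨a, ha⟩ := h.2
      { toFun := fun v => (conjMod V).symm (f (conjMod V v))
        map_add' := fun v w => by simp
        map_smul' := fun c v => by
          have := smul_conjMod V (starRingEnd ℂ c) v
          rw [Complex.conj_conj] at this
          rw [← this, map_smul]
          obtain ⟨w, hw⟩ := (conjMod V).surjective (f (conjMod V v))
          rw [← hw, smul_conjMod]
          simp }
    exact ⟨conjAlg A a, LinearMap.ext fun v => LinearMap.congr_fun ha ((conjMod V).symm v)⟩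

/-- For the basis of A that acts by matrix units, tensor products act by the matrix units of the
product basis, so a basis goes to a basis. -/
theorem powAction_bijective {A V : Type} [Ring A] [Algebra ℂ A] [AddCommGroup V] [Module ℂ V]
    (e : Module.Basis (Fin 2) ℂ V) {γ : A →ₐ[ℂ] Module.End ℂ V} (h : Function.Bijective γ) (k : ℕ) :
    Function.Bijective (powAction γ k) := by
  let bA := (e.linearMap e).map (LinearEquiv.ofBijective γ.toLinearMap h).symm
  have hbA : ∀ p, γ (bA p) = e.linearMap e p := fun p =>
    (LinearEquiv.ofBijective γ.toLinearMap h).apply_symm_apply _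
  let B := Basis.piTensorProduct fun _ : Fin k => e
  refine bijective_of_apply_basis (powAction γ k).toLinearMap
    (Basis.piTensorProduct fun _ : Fin k => bA) (B.linearMap B)
    (Equiv.arrowProdEquivProdArrow _ _ _) fun J => B.ext fun K => ?_
  rw [Module.Basis.linearMap_apply_apply, Basis.piTensorProduct_apply, AlgHom.toLinearMap_apply,
    powAction, PiTensorProduct.liftAlgHom_apply, PiTensorProduct.lift.tprod]
  change PiTensorProduct.map (fun i => γ (bA (J i))) (B K) = _
  rw [Basis.piTensorProduct_apply, PiTensorProduct.map_tprod]
  simp only [hbA, Module.Basis.linearMap_apply_apply]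
  split_ifs with hJ
  · rw [Basis.piTensorProduct_apply]
    congr 1
    funext i
    exact if_pos (congrFun hJ i)
  · obtain ⟨i, hi⟩ := Function.ne_iff.1 hJ
    exact MultilinearMap.map_coord_zero _ i (if_neg hi)

theorem tensorAction_bijective {A V A' V' : Type} [Ring A] [Algebra ℂ A] [AddCommGroup V]
    [Module ℂ V] [Ring A'] [Algebra ℂ A'] [AddCommGroup V'] [Module ℂ V'] [FiniteDimensional ℂ V]
    [FiniteDimensional ℂ V'] {γ : A →ₐ[ℂ] Module.End ℂ V} {γ' : A' →ₐ[ℂ] Module.End ℂ V'}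
    (h : Function.Bijective γ) (h' : Function.Bijective γ') :
    Function.Bijective (tensorAction γ γ') := by
  let e := (TensorProduct.congr (LinearEquiv.ofBijective γ.toLinearMap h)
    (LinearEquiv.ofBijective γ'.toLinearMap h')).trans (homTensorHomEquiv ℂ V V' V V')
  have : (tensorAction γ γ').toLinearMap = e.toLinearMap := by
    apply TensorProduct.ext'
    intro a b
    change TensorProduct.map (γ a) (γ' b) = homTensorHomEquiv ℂ V V' V V' (γ a ⊗ₜ γ' b)
    rw [homTensorHomEquiv_apply]; rfl
  have h2 : ⇑(tensorAction γ γ') = e := congrArg DFunLike.coe this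
  rw [h2]
  exact e.bijective

theorem undAction_bijective (k : ℕ) : Function.Bijective (undAction k) :=
  powAction_bijective (Pi.basisFun ℂ (Fin 2)) spinor_bijective k

theorem dotAction_bijective (r : ℕ) : Function.Bijective (dotAction r) :=
  powAction_bijective dotBasis (conjAction_bijective spinor_bijective) r

theorem mixedAction_bijective (k r : ℕ) : Function.Bijective (mixedAction k r) :=
  tensorAction_bijective (undAction_bijective k) (dotAction_bijective r)

theorem mixedAction'_bijective (k r : ℕ) : Function.Bijective (mixedAction' k r) :=
  tensorAction_bijective (dotAction_bijective k) (undAction_bijective r)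

end Bijectivity

/-! ### Anticommuting generators and volume elements. -/

section Generators

/-- `x` is a family of anticommuting elements with squares `σ a`. -/
structure IsGenerating {I A : Type} [Ring A] [Algebra ℝ A] (σ : I → ℝ) (x : I → A) : Prop where
  sq : ∀ a, x a * x a = σ a • 1
  anti : ∀ a b, a ≠ b → x a * x b = -(x b * x a)

namespace IsGenerating

variable {I A : Type} [Ring A] [Algebra ℝ A] {σ : I → ℝ} {x : I → A}

theorem comp {J : Type} (h : IsGenerating σ x) (e : J → I) (he : Function.Injective e) :
    IsGenerating (σ ∘ e) (x ∘ e) :=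
  ⟨fun _ => h.sq _, fun _ _ hab => h.anti _ _ (he.ne hab)⟩

theorem mul_prod_of_notMem (h : IsGenerating σ x) {a : I} {l : List I} (ha : a ∉ l) :
    x a * (l.map x).prod = (-1 : ℝ) ^ l.length • ((l.map x).prod * x a) := by
  induction l with
  | nil => simp
  | cons b l ih =>
    rw [List.mem_cons, not_or] at ha
    rw [List.map_cons, List.prod_cons, ← mul_assoc, h.anti a b ha.1, neg_mul, mul_assoc, ih ha.2,
      mul_smul_comm, List.length_cons, pow_succ, mul_neg_one, neg_smul, ← mul_assoc]

theorem mul_prod_of_mem (h : IsGenerating σ x) {a : I} {l : List I} (ha : a ∈ l) (hl : l.Nodup) :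
    x a * (l.map x).prod = (-1 : ℝ) ^ (l.length + 1) • ((l.map x).prod * x a) := by
  induction l with
  | nil => simp at ha
  | cons b l ih =>
    rw [List.nodup_cons] at hl
    rw [List.map_cons, List.prod_cons, List.length_cons]
    by_cases hab : a = b
    · subst hab
      conv_rhs => rw [mul_assoc]
      rw [h.mul_prod_of_notMem hl.1, mul_smul_comm, pow_succ, pow_succ]
      simp
    · rw [← mul_assoc, h.anti a b hab, neg_mul, mul_assoc,
        ih ((List.mem_cons.1 ha).resolve_left hab) hl.2, mul_smul_comm, pow_succ _ (l.length + 1),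
        mul_neg_one, neg_smul, ← mul_assoc]

/-- Bringing equal factors together takes 0 + 1 + ⋯ + (n - 1) transpositions, whence the binomial
coefficient. -/
theorem prod_sq (h : IsGenerating σ x) {l : List I} (hl : l.Nodup) :
    (l.map x).prod * (l.map x).prod =
      ((-1 : ℝ) ^ l.length.choose 2 * (l.map σ).prod) • 1 := by
  induction l with
  | nil => simp
  | cons b l ih =>
    rw [List.nodup_cons] at hl
    have hc := h.mul_prod_of_notMem hl.1
    have : (l.map x).prod * x b = (-1 : ℝ) ^ l.length • (x b * (l.map x).prod) := by
      rw [hc, smul_smul, ← mul_pow]; simp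
    rw [List.map_cons, List.prod_cons, mul_assoc, ← mul_assoc (l.map x).prod, this, smul_mul_assoc,
      mul_smul_comm, ← mul_assoc, ← mul_assoc, h.sq, smul_mul_assoc, one_mul, smul_mul_assoc,
      ih hl.2, smul_smul, smul_smul, List.map_cons, List.prod_cons, List.length_cons,
      Nat.choose_succ_succ' , Nat.choose_one_right, pow_add]
    congr 1; ring

/-- The sum `∑ v_a x_a` has square `∑ σ_a v_a²`. -/
theorem sum_smul_sq [Fintype I] (h : IsGenerating σ x) (v : I → ℝ) :
    (∑ a, v a • x a) * (∑ a, v a • x a) = (∑ a, σ a * (v a * v a)) • 1 := by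
  classical
  -- Doubling the square allows each cross term to be paired with its transpose; the 2 is cancelled
  -- at the end.
  have key : (∑ a, v a • x a) * (∑ a, v a • x a) + (∑ a, v a • x a) * (∑ a, v a • x a) =
      ∑ a, ∑ b, if a = b then ((2 * (σ a * (v a * v a))) • 1 : A) else 0 := by
    rw [Finset.sum_mul_sum]
    nth_rewrite 2 [Finset.sum_comm]
    rw [← Finset.sum_add_distrib]
    refine Finset.sum_congr rfl fun a _ => ?_
    rw [← Finset.sum_add_distrib]
    refine Finset.sum_congr rfl fun b _ => ?_
    split_ifs with hab
    · subst hab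
      rw [smul_mul_smul_comm, h.sq, smul_smul, ← add_smul]
      congr 1; ring
    · rw [smul_mul_smul_comm, smul_mul_smul_comm, h.anti a b hab, mul_comm (v a), smul_neg,
        neg_add_cancel]
  simp only [Finset.sum_ite_eq, Finset.mem_univ, if_true] at key
  rw [← Finset.sum_smul, ← Finset.mul_sum, ← two_smul ℝ, mul_smul] at key
  exact smul_right_injective A (two_ne_zero (α := ℝ)) key

end IsGenerating

/-- The signs of the generators of `Cl_{p,q}`. -/
def sgn {α β : Type} : α ⊕ β → ℝ := Sum.elim (fun _ => 1) (fun _ => -1)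

/-- The generators of `Cl_{p,q}`. -/
def gen (p q : ℕ) (a : Fin p ⊕ Fin q) : Cl p q := CliffordAlgebra.ι (realForm p q) (Pi.single a 1)

theorem realForm_apply (p q : ℕ) (v : Fin p ⊕ Fin q → ℝ) :
    realForm p q v = ∑ a, sgn a * (v a * v a) := by
  simp [realForm, QuadraticMap.weightedSumSquares_apply, sgn]

theorem ι_eq_sum (p q : ℕ) (v : Fin p ⊕ Fin q → ℝ) :
    CliffordAlgebra.ι (realForm p q) v = ∑ a, v a • gen p q a := by
  conv_lhs => rw [pi_eq_sum_univ' v]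
  simp only [map_sum, map_smul, gen]

theorem isGenerating_gen (p q : ℕ) : IsGenerating sgn (gen p q) := by
  have sq : ∀ a, gen p q a * gen p q a = (sgn a : ℝ) • 1 := fun a => by
    rw [gen, CliffordAlgebra.ι_sq_scalar, realForm_apply, Algebra.algebraMap_eq_smul_one]
    congr 1
    simp [Pi.single_apply]
  refine ⟨sq, fun a b hab => ?_⟩
  have h := CliffordAlgebra.ι_sq_scalar (realForm p q) (Pi.single a 1 + Pi.single b 1)
  have hv : realForm p q (Pi.single a 1 + Pi.single b 1) = sgn a + sgn b := by
    rw [realForm_apply, ← Finset.sum_subset (Finset.subset_univ {a, b}), Finset.sum_pair hab]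
    · simp [hab, hab.symm]
    · intro c _ hc
      simp only [Finset.mem_insert, Finset.mem_singleton, not_or] at hc
      simp [hc.1, hc.2]
  rw [hv, map_add, Algebra.algebraMap_eq_smul_one, add_smul, ← sq, ← sq] at h
  change (gen p q a + gen p q b) * (gen p q a + gen p q b) = _ at h
  rw [add_mul, mul_add, mul_add] at h
  refine eq_neg_of_add_eq_zero_left ?_
  have e : gen p q a * gen p q b + gen p q b * gen p q a =
    (gen p q a * gen p q a + gen p q a * gen p q b + (gen p q b * gen p q a +
      gen p q b * gen p q b)) - (gen p q a * gen p q a + gen p q b * gen p q b) := by abel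
  rw [e, h, sub_self]

/-- Anticommuting elements with the right squares define a homomorphism from `Cl_{p,q}`. -/
def clLift {p q : ℕ} {A : Type} [Ring A] [Algebra ℝ A] (x : Fin p ⊕ Fin q → A)
    (h : IsGenerating sgn x) : Cl p q →ₐ[ℝ] A :=
  CliffordAlgebra.lift (realForm p q)
    ⟨Fintype.linearCombination ℝ x, fun v => by
      rw [Fintype.linearCombination_apply, h.sum_smul_sq, realForm_apply,
        Algebra.algebraMap_eq_smul_one]⟩

theorem clLift_gen {p q : ℕ} {A : Type} [Ring A] [Algebra ℝ A] (x : Fin p ⊕ Fin q → A)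
    (h : IsGenerating sgn x) (a : Fin p ⊕ Fin q) : clLift x h (gen p q a) = x a := by
  rw [clLift, gen, CliffordAlgebra.lift_ι_apply, Fintype.linearCombination_apply_single, one_smul]

/-- A subspace of `Cl_{p,q}` that contains `1` and is stable under right multiplication by the
generators is the whole algebra. -/
theorem cl_induction {p q : ℕ} (P : Submodule ℝ (Cl p q)) (h1 : 1 ∈ P)
    (hmul : ∀ b ∈ P, ∀ a, b * gen p q a ∈ P) (b : Cl p q) : b ∈ P := by
  induction b using CliffordAlgebra.right_induction with
  | algebraMap c => rw [Algebra.algebraMap_eq_smul_one]; exact P.smul_mem _ h1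
  | add x y hx hy => exact P.add_mem hx hy
  | mul_ι x v hv =>
    rw [ι_eq_sum, Finset.mul_sum]
    exact P.sum_mem fun a _ => by rw [mul_smul_comm]; exact P.smul_mem _ (hmul _ hv _)

theorem finrank_Cl (p q : ℕ) : Module.finrank ℝ (Cl p q) = 2 ^ (p + q) := by
  rw [(finrank_cliffordAlgebra (realForm p q)).1, Module.finrank_fintype_fun_eq_card]
  simp

instance (p q : ℕ) : FiniteDimensional ℝ (Cl p q) := (finrank_cliffordAlgebra (realForm p q)).2

/-- The list of all generators. -/
def genList (p q : ℕ) : List (Fin p ⊕ Fin q) :=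
  (List.finRange p).map Sum.inl ++ (List.finRange q).map Sum.inr

theorem vol_eq (p q : ℕ) : vol p q = ((genList p q).map (gen p q)).prod := by
  rw [genList, List.map_append, List.prod_append, List.map_map, List.map_map, vol,
    List.ofFn_eq_map, List.ofFn_eq_map]
  rfl

theorem nodup_genList (p q : ℕ) : (genList p q).Nodup := by
  refine List.Nodup.append ((List.nodup_finRange p).map Sum.inl_injective)
    ((List.nodup_finRange q).map Sum.inr_injective) ?_
  intro a ha hb
  simp only [List.mem_map] at ha hb
  obtain ⟨i, -, rfl⟩ := ha
  obtain ⟨j, -, h⟩ := hb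
  cases h

theorem mem_genList (p q : ℕ) (a : Fin p ⊕ Fin q) : a ∈ genList p q := by
  cases a <;> simp [genList]

theorem length_genList (p q : ℕ) : (genList p q).length = p + q := by simp [genList]

theorem gen_mul_vol (p q : ℕ) (a : Fin p ⊕ Fin q) :
    gen p q a * vol p q = (-1 : ℝ) ^ (p + q + 1) • (vol p q * gen p q a) := by
  rw [vol_eq, (isGenerating_gen p q).mul_prod_of_mem (mem_genList p q a) (nodup_genList p q),
    length_genList]

theorem vol_sq (p q : ℕ) : vol p q * vol p q = ((-1 : ℝ) ^ ((p + q).choose 2 + q)) • 1 := by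
  rw [vol_eq, (isGenerating_gen p q).prod_sq (nodup_genList p q), length_genList, pow_add]
  congr 2
  simp [genList, sgn, Function.comp_def, List.map_append]

theorem vol_central {p q r : ℕ} (h : p + q = 2 * r + 1) (a : Cl p q) :
    vol p q * a = a * vol p q := by
  have := cl_induction
    (LinearMap.eqLocus (LinearMap.mulLeft ℝ (vol p q)) (LinearMap.mulRight ℝ (vol p q)))
    (by simp) (fun b hb a => by
      simp only [LinearMap.mem_eqLocus, LinearMap.mulLeft_apply, LinearMap.mulRight_apply] at hb ⊢
      rw [← mul_assoc, hb, mul_assoc, mul_assoc, gen_mul_vol, h]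
      simp [pow_succ, pow_mul]) a
  simpa using this

/-- The binomial coefficient of 2r + 1 over 2 is 2r² + r, of the parity of r. -/
theorem vol_sq_odd {p q r : ℕ} (h : p + q = 2 * r + 1) :
    vol p q * vol p q = ((-1 : ℝ) ^ (r + q)) • 1 := by
  rw [vol_sq, h, pow_add, pow_add _ r, Nat.choose_two_right, Nat.add_sub_cancel,
    show (2 * r + 1) * (2 * r) / 2 = 2 * (r * r) + r by
      rw [show (2 * r + 1) * (2 * r) = 2 * (2 * (r * r) + r) by ring]; simp, pow_add _ _ r, pow_mul]
  simp

theorem vol_sq_two {p q : ℕ} (h : p + q = 2) : vol p q * vol p q = (-(-1 : ℝ) ^ q) • 1 := by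
  rw [vol_sq, h, pow_add]; simp

theorem gen_mul_vol_two {p q : ℕ} (h : p + q = 2) (a : Fin p ⊕ Fin q) :
    gen p q a * vol p q = -(vol p q * gen p q a) := by
  rw [gen_mul_vol, h, pow_succ]; simp

end Generators

/-! ### Signatures of tensor products of two-generator factors. -/

section Signatures

/-- Two finite sets with signs are in bijection if they have the same size and sum of signs. -/
theorem exists_equiv_sgn {ι : Type} [Fintype ι] {p q : ℕ} (τ : ι → ℝ)
    (hτ : ∀ a, τ a = 1 ∨ τ a = -1) (hc : Fintype.card ι = p + q) (hs : ∑ a, τ a = (p : ℝ) - q) :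
    ∃ e : Fin p ⊕ Fin q ≃ ι, ∀ a, τ (e a) = sgn a := by
  classical
  have hsum : ∀ a, τ a = 2 * (if τ a = 1 then 1 else 0) - 1 := fun a => by
    rcases hτ a with h | h <;> rw [h] <;> norm_num
  have hp : Fintype.card {a // τ a = 1} = p := by
    have h1 : ∑ a, τ a = 2 * (Fintype.card {a // τ a = 1} : ℝ) - Fintype.card ι := by
      rw [Finset.sum_congr rfl fun a _ => hsum a, Finset.sum_sub_distrib, ← Finset.mul_sum,
        Finset.sum_boole, Fintype.card_subtype]
      simp
    rw [hs, hc] at h1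
    push_cast at h1
    have : (Fintype.card {a // τ a = 1} : ℝ) = p := by linarith
    exact_mod_cast this
  have hq : Fintype.card {a // ¬ τ a = 1} = q := by
    rw [Fintype.card_subtype_compl, hp, hc]; simp
  let e1 := (Fintype.equivFinOfCardEq hp).symm
  let e2 := (Fintype.equivFinOfCardEq hq).symm
  refine ⟨(Equiv.sumCongr e1 e2).trans (Equiv.sumCompl _), ?_⟩
  rintro (a | a)
  · exact (e1 a).2
  · exact (hτ _).resolve_left (e2 a).2

/-- The square of the volume element of `Cl_{s,t}` for `s + t = 2`. -/
def volSign (t : ℕ) : ℤ := -(-1) ^ t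

/-- The sum of the signs of the generators of `Cl_{s_1,t_1} ⊗ ⋯ ⊗ Cl_{s_r,t_r}`. -/
def signature {r : ℕ} (s t : Fin r → ℕ) : ℤ :=
  ∑ i, ((s i : ℤ) - t i) * ∏ l, if l < i then volSign (t l) else 1

/-- The sign of the square of the structure map: `-1` for each factor `Cl_{0,2} = ℍ`. -/
def structSign (t : ℕ) : ℤ := if t = 2 then -1 else 1

theorem signature_cons {r : ℕ} (s₀ t₀ : ℕ) (s t : Fin r → ℕ) :
    signature (Fin.cons s₀ s : Fin (r + 1) → ℕ) (Fin.cons t₀ t : Fin (r + 1) → ℕ) =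
      (s₀ - t₀) + volSign t₀ * signature s t := by
  simp only [signature, Fin.sum_univ_succ, Fin.prod_univ_succ, Fin.cons_zero, Fin.cons_succ,
    Fin.succ_pos, if_true, Fin.succ_lt_succ_iff, Finset.mul_sum, lt_irrefl, if_false, Fin.not_lt_zero,
    Finset.prod_const_one, mul_one]
  congr 1
  exact Finset.sum_congr rfl fun i _ => by ring

/-- One factor is split off at a time. By `signature_cons` a first factor with ω² = 1 keeps the
remaining signature and one with ω² = -1 reverses it; the types mod 8 are tracked along with the
sign of the structure map. -/
theorem exists_factorization (r : ℕ) : ∀ p q : ℕ, p + q = 2 * r → ∃ s t : Fin r → ℕ,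
    (∀ i, s i + t i = 2) ∧ signature s t = (p : ℤ) - q ∧
      (HasType p q 0 ∨ HasType p q 2 → ∏ i, structSign (t i) = 1) ∧
      (HasType p q 4 ∨ HasType p q 6 → ∏ i, structSign (t i) = -1) := by
  induction r with
  | zero =>
    intro p q h
    obtain rfl : p = 0 := by omega
    obtain rfl : q = 0 := by omega
    exact ⟨Fin.elim0, Fin.elim0, fun i => i.elim0, by simp [signature], by simp,
      by simp [HasType, Int.ModEq]⟩
  | succ r ih =>
    have step : ∀ (p q p' q' s₀ t₀ : ℕ), s₀ + t₀ = 2 → p' + q' = 2 * r →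
        (p : ℤ) - q = (s₀ - t₀) + volSign t₀ * ((p' : ℤ) - q') →
        (structSign t₀ = 1 ∧ (HasType p q 0 ∨ HasType p q 2 → HasType p' q' 0 ∨ HasType p' q' 2) ∧
            (HasType p q 4 ∨ HasType p q 6 → HasType p' q' 4 ∨ HasType p' q' 6) ∨
          structSign t₀ = -1 ∧
            (HasType p q 0 ∨ HasType p q 2 → HasType p' q' 4 ∨ HasType p' q' 6) ∧
            (HasType p q 4 ∨ HasType p q 6 → HasType p' q' 0 ∨ HasType p' q' 2)) →
        ∃ s t : Fin (r + 1) → ℕ, (∀ i, s i + t i = 2) ∧ signature s t = (p : ℤ) - q ∧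
          (HasType p q 0 ∨ HasType p q 2 → ∏ i, structSign (t i) = 1) ∧
          (HasType p q 4 ∨ HasType p q 6 → ∏ i, structSign (t i) = -1) := by
      intro p q p' q' s₀ t₀ h₀ h' hsig htype
      obtain ⟨s, t, hst, hs, h1, h2⟩ := ih p' q' h'
      refine ⟨Fin.cons s₀ s, Fin.cons t₀ t, Fin.cases h₀ hst, by rw [signature_cons, hs, hsig], ?_⟩
      simp only [Fin.prod_univ_succ, Fin.cons_zero, Fin.cons_succ]
      rcases htype with ⟨h, ha, hb⟩ | ⟨h, ha, hb⟩ <;> rw [h]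
      · exact ⟨fun hh => by rw [h1 (ha hh)]; rfl, fun hh => by rw [h2 (hb hh)]; rfl⟩
      · exact ⟨fun hh => by rw [h2 (ha hh)]; rfl, fun hh => by rw [h1 (hb hh)]; rfl⟩
    intro p q h
    rcases Nat.eq_zero_or_pos p with rfl | hp
    -- Cl_{0,q} = Cl_{0,2} ⊗ Cl_{q-2,0}: the only step that changes the sign of the structure map.
    · refine step 0 q (q - 2) 0 0 2 rfl (by omega) ?_ (Or.inr ⟨rfl, ?_⟩)
      · simp only [volSign]; push_cast; omega
      · simp only [HasType, Int.ModEq]; omega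
    · rcases Nat.eq_zero_or_pos q with rfl | hq
      -- Cl_{p,0} = Cl_{2,0} ⊗ Cl_{0,p-2}.
      · refine step p 0 0 (p - 2) 2 0 rfl (by omega) ?_ (Or.inl ⟨rfl, ?_⟩)
        · simp only [volSign]; push_cast; omega
        · simp only [HasType, Int.ModEq]; omega
      -- Cl_{p,q} = Cl_{1,1} ⊗ Cl_{p-1,q-1}; here ω² = 1.
      · refine step p q (p - 1) (q - 1) 1 1 rfl (by omega) ?_ (Or.inl ⟨rfl, ?_⟩)
        · simp only [volSign]; push_cast; omega
        · simp only [HasType, Int.ModEq]; omega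

end Signatures

/-! ### Clifford algebras as tensor products. -/

section Factorization

theorem tprod_mem_of_mulSingle_mem {ι : Type} [Fintype ι] [DecidableEq ι] {B : ι → Type}
    [∀ i, Ring (B i)] [∀ i, Algebra ℝ (B i)] (R : Subalgebra ℝ (⨂[ℝ] i, B i)) (x : ∀ i, B i)
    (h : ∀ i, PiTensorProduct.tprod ℝ (Pi.mulSingle i (x i)) ∈ R) :
    PiTensorProduct.tprod ℝ x ∈ R := by
  have := PiTensorProduct.tprod_noncommProd (R := ℝ) Finset.univ (fun i => Pi.mulSingle i (x i))
    fun i _ j _ _ => Pi.mulSingle_apply_commute x i j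
  rw [Finset.noncommProd_mulSingle] at this
  rw [this]
  exact R.toSubmonoid.noncommProd_mem _ _ _ fun i _ => h i

theorem tprod_mul_tprod_comm {ι : Type} [Fintype ι] {B : ι → Type}
    [∀ i, Ring (B i)] [∀ i, Algebra ℝ (B i)] (c : ι → ℝ) (x y : ∀ i, B i)
    (h : ∀ i, x i * y i = c i • (y i * x i)) :
    PiTensorProduct.tprod ℝ x * PiTensorProduct.tprod ℝ y =
      (∏ i, c i) • (PiTensorProduct.tprod ℝ y * PiTensorProduct.tprod ℝ x) := by
  rw [PiTensorProduct.tprod_mul_tprod, PiTensorProduct.tprod_mul_tprod,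
    ← MultilinearMap.map_smul_univ]
  exact congrArg _ (funext h)

theorem tprod_mul_self {ι : Type} [Fintype ι] {B : ι → Type}
    [∀ i, Ring (B i)] [∀ i, Algebra ℝ (B i)] (c : ι → ℝ) (x : ∀ i, B i)
    (h : ∀ i, x i * x i = c i • 1) :
    PiTensorProduct.tprod ℝ x * PiTensorProduct.tprod ℝ x = (∏ i, c i) • 1 := by
  rw [PiTensorProduct.tprod_mul_tprod, PiTensorProduct.one_def, ← MultilinearMap.map_smul_univ]
  exact congrArg _ (funext h)

variable {r : ℕ} (s t : Fin r → ℕ)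

/-- The set of generators of the factors. -/
abbrev GenIndex : Type := Σ i, Fin (s i) ⊕ Fin (t i)

/-- The element `ω ⊗ ⋯ ⊗ ω ⊗ b ⊗ 1 ⊗ ⋯ ⊗ 1`, with `b` in the `i`-th place. -/
def volSingle (i : Fin r) (b : Cl (s i) (t i)) : ∀ l, Cl (s l) (t l) :=
  Function.update (fun l => if l < i then vol (s l) (t l) else 1) i b

variable {s t}

theorem volSingle_self (i : Fin r) (b : Cl (s i) (t i)) : volSingle s t i b i = b := by
  simp [volSingle]

theorem volSingle_lt {i l : Fin r} (h : l < i) (b : Cl (s i) (t i)) :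
    volSingle s t i b l = vol (s l) (t l) := by
  simp [volSingle, h, h.ne]

theorem volSingle_gt {i l : Fin r} (h : i < l) (b : Cl (s i) (t i)) :
    volSingle s t i b l = 1 := by
  simp [volSingle, h.ne', h.not_gt]

/-- The two tensors commute in every place except the i-th, where a generator meets the volume
element of its own factor and anticommutes with it. -/
theorem volSingle_anti (hst : ∀ i, s i + t i = 2) {i i' : Fin r} (h : i < i')
    (c : Fin (s i) ⊕ Fin (t i)) (b : Cl (s i') (t i')) :
    PiTensorProduct.tprod ℝ (volSingle s t i (gen _ _ c)) * PiTensorProduct.tprod ℝ (volSingle s t i' b) =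
      -(PiTensorProduct.tprod ℝ (volSingle s t i' b) *
        PiTensorProduct.tprod ℝ (volSingle s t i (gen _ _ c))) := by
  rw [tprod_mul_tprod_comm (fun l => if l = i then -1 else 1), Finset.prod_ite_eq']
  · simp
  · intro l
    rcases lt_trichotomy l i with hl | rfl | hl
    · rw [volSingle_lt hl, volSingle_lt (hl.trans h), if_neg hl.ne, one_smul]
    · rw [volSingle_self, volSingle_lt h, gen_mul_vol_two (hst l)]; simp
    · rw [volSingle_gt hl, if_neg hl.ne', mul_one, one_mul, one_smul]

/-- The generators of the tensor product. -/
def tensorGen (s t : Fin r → ℕ) (a : GenIndex s t) : TensorCl s t :=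
  PiTensorProduct.tprod ℝ (volSingle s t a.1 (gen _ _ a.2))

/-- The squares of the generators of the tensor product. -/
def tensorSgn (s t : Fin r → ℕ) (a : GenIndex s t) : ℝ :=
  sgn a.2 * ∏ l, if l < a.1 then (volSign (t l) : ℝ) else 1

theorem volSign_cast (t : ℕ) : (volSign t : ℝ) = -(-1) ^ t := by simp [volSign]

theorem isGenerating_tensorGen (hst : ∀ i, s i + t i = 2) :
    IsGenerating (tensorSgn s t) (tensorGen s t) := by
  refine ⟨?_, ?_⟩
  · rintro ⟨i, c⟩
    rw [tensorGen, tprod_mul_self (fun l => (if l = i then sgn c else 1) *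
      (if l < i then (volSign (t l) : ℝ) else 1)), Finset.prod_mul_distrib, Finset.prod_ite_eq',
      if_pos (Finset.mem_univ _)]
    · rfl
    · intro l
      dsimp only
      rcases lt_trichotomy l i with hl | rfl | hl
      · rw [volSingle_lt hl, if_neg hl.ne, if_pos hl, one_mul, vol_sq_two (hst l), volSign_cast]
      · rw [volSingle_self, if_pos rfl, if_neg (lt_irrefl _), mul_one, (isGenerating_gen _ _).sq]
      · rw [volSingle_gt hl, if_neg hl.ne', if_neg hl.not_gt]; simp
  · rintro ⟨i, c⟩ ⟨i', c'⟩ hne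
    rcases lt_trichotomy i i' with h | rfl | h
    · exact volSingle_anti hst h c _
    · rw [tensorGen, tensorGen, tprod_mul_tprod_comm (fun l => if l = i then -1 else 1),
        Finset.prod_ite_eq']
      · simp
      · intro l
        rcases lt_trichotomy l i with hl | rfl | hl
        · rw [volSingle_lt hl, volSingle_lt hl, if_neg hl.ne, one_smul]
        · rw [volSingle_self, volSingle_self, (isGenerating_gen _ _).anti c c' fun e => hne (by rw [e])]
          simp
        · rw [volSingle_gt hl, volSingle_gt hl, if_neg hl.ne', one_smul]
    · rw [eq_comm, neg_eq_iff_eq_neg]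
      exact volSingle_anti hst h c' _

/-- Once the earlier factors are available, so is ω ⊗ ⋯ ⊗ ω ⊗ 1 ⊗ ⋯ ⊗ 1. Multiplying by it strips
the volume elements off a generator of the i-th factor, up to sign. -/
theorem single_mem (hst : ∀ i, s i + t i = 2) (R : Subalgebra ℝ (TensorCl s t))
    (hR : ∀ a, tensorGen s t a ∈ R) (i : Fin r) (b : Cl (s i) (t i)) :
    PiTensorProduct.tprod ℝ (Pi.mulSingle i b) ∈ R := by
  induction i using WellFoundedLT.induction with
  | ind i ih =>
  have hV : PiTensorProduct.tprod ℝ (volSingle s t i 1) ∈ R := by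
    refine tprod_mem_of_mulSingle_mem R _ fun l => ?_
    rcases lt_trichotomy l i with hl | rfl | hl
    · exact ih l hl _
    · rw [volSingle_self, Pi.mulSingle_one]; exact R.one_mem
    · rw [volSingle_gt hl, Pi.mulSingle_one]; exact R.one_mem
  have hgen : ∀ c, PiTensorProduct.tprod ℝ (Pi.mulSingle i (gen _ _ c)) ∈ R := fun c => by
    have h1 : PiTensorProduct.tprod ℝ (volSingle s t i 1) * tensorGen s t ⟨i, c⟩ =
        (∏ l, if l < i then (volSign (t l) : ℝ) else 1) •
          PiTensorProduct.tprod ℝ (Pi.mulSingle i (gen _ _ c)) := by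
      rw [tensorGen, PiTensorProduct.tprod_mul_tprod, ← MultilinearMap.map_smul_univ]
      congr 1
      funext l
      rw [Pi.mul_apply]
      rcases lt_trichotomy l i with hl | rfl | hl
      · rw [volSingle_lt hl, volSingle_lt hl, if_pos hl, Pi.mulSingle_eq_of_ne hl.ne,
          vol_sq_two (hst l), volSign_cast]
      · rw [volSingle_self, volSingle_self, if_neg (lt_irrefl _), Pi.mulSingle_eq_same, one_smul,
          one_mul]
      · rw [volSingle_gt hl, volSingle_gt hl, if_neg hl.not_gt, Pi.mulSingle_eq_of_ne hl.ne',
          one_smul, one_mul]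
    have h0 : (∏ l, if l < i then (volSign (t l) : ℝ) else 1) ≠ 0 := by
      refine Finset.prod_ne_zero_iff.2 fun l _ => ?_
      split_ifs
      · rw [volSign_cast]; exact neg_ne_zero.2 (pow_ne_zero _ (by norm_num))
      · exact one_ne_zero
    have h2 := R.smul_mem (R.mul_mem hV (hR ⟨i, c⟩)) (∏ l, if l < i then (volSign (t l) : ℝ) else 1)⁻¹
    rwa [h1, smul_smul, inv_mul_cancel₀ h0, one_smul] at h2
  refine cl_induction ((R.comap (PiTensorProduct.singleAlgHom (R := ℝ) i)).toSubmodule)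
    (Subalgebra.one_mem _) (fun b hb c => ?_) b
  exact Subalgebra.mul_mem _ hb (hgen c)

theorem finrank_tensorCl (hst : ∀ i, s i + t i = 2) :
    Module.finrank ℝ (TensorCl s t) = 4 ^ r ∧ FiniteDimensional ℝ (TensorCl s t) := by
  let b := Basis.piTensorProduct fun i => Module.finBasis ℝ (Cl (s i) (t i))
  refine ⟨?_, b.finiteDimensional_of_finite⟩
  rw [Module.finrank_eq_card_basis b, Fintype.card_pi]
  simp [finrank_Cl, hst]

theorem card_genIndex (hst : ∀ i, s i + t i = 2) : Fintype.card (GenIndex s t) = 2 * r := by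
  simp [Fintype.card_sigma, hst, mul_comm]

theorem sum_tensorSgn : ∑ a, tensorSgn s t a = (signature s t : ℝ) := by
  rw [Fintype.sum_sigma, signature, Int.cast_sum]
  refine Finset.sum_congr rfl fun i _ => ?_
  change ∑ c : Fin (s i) ⊕ Fin (t i), sgn c * ∏ l, (if l < i then (volSign (t l) : ℝ) else 1) = _
  rw [← Finset.sum_mul, Fintype.sum_sum_type]
  push_cast
  simp [sgn, sub_eq_add_neg]

theorem tensorSgn_eq (a : GenIndex s t) : tensorSgn s t a = 1 ∨ tensorSgn s t a = -1 := by
  have h1 : (sgn a.2 : ℝ) = 1 ∨ (sgn a.2 : ℝ) = -1 := by rcases a with ⟨i, c | c⟩ <;> simp [sgn]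
  have h2 : (∏ l, if l < a.1 then (volSign (t l) : ℝ) else 1) = 1 ∨
      (∏ l, if l < a.1 then (volSign (t l) : ℝ) else 1) = -1 := by
    refine Finset.prod_induction _ (fun x => x = 1 ∨ x = -1) ?_ (Or.inl rfl) fun l _ => ?_
    · rintro _ _ (rfl | rfl) (rfl | rfl) <;> simp
    · split_ifs
      · rw [volSign_cast]
        rcases neg_one_pow_eq_or ℝ (t l) with h | h <;> simp [h]
      · exact Or.inl rfl
  rw [tensorSgn]
  rcases h1 with h | h <;> rcases h2 with h' | h' <;> rw [h, h'] <;> simp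

/-- `Cl_{p,q}` is the tensor product of any family of factors with two generators and the right
signature. -/
theorem exists_algEquiv_tensorCl {p q : ℕ} (hst : ∀ i, s i + t i = 2) (hpq : p + q = 2 * r)
    (hsig : signature s t = (p : ℤ) - q) : Nonempty (Cl p q ≃ₐ[ℝ] TensorCl s t) := by
  have hsig' : (signature s t : ℝ) = (p : ℝ) - q := by rw [hsig]; simp
  obtain ⟨e, he⟩ := exists_equiv_sgn (tensorSgn s t) tensorSgn_eq
    ((card_genIndex hst).trans hpq.symm) (sum_tensorSgn.trans hsig')
  have hx : IsGenerating sgn (tensorGen s t ∘ e) := by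
    have := (isGenerating_tensorGen hst).comp e e.injective
    rwa [show tensorSgn s t ∘ e = sgn from funext he] at this
  have hgen : ∀ a, tensorGen s t a ∈ (clLift _ hx).range := fun a =>
    ⟨gen p q (e.symm a), by
      change clLift _ hx _ = _
      rw [clLift_gen, Function.comp_apply, e.apply_symm_apply]⟩
  have hsurj : Function.Surjective (clLift _ hx) := by
    rw [← AlgHom.range_eq_top, eq_top_iff]
    intro z _
    induction z using PiTensorProduct.induction_on with
    | smul_tprod c x =>
      exact Subalgebra.smul_mem _ (tprod_mem_of_mulSingle_mem _ _ fun i => single_mem hst _ hgen i _) c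
    | add x y hx hy => exact Subalgebra.add_mem _ (hx trivial) (hy trivial)
  have := (finrank_tensorCl hst).2
  refine ⟨AlgEquiv.ofBijective (clLift _ hx) (bijective_of_surjective_of_finrank
    (clLift _ hx).toLinearMap hsurj ?_)⟩
  rw [finrank_Cl, (finrank_tensorCl hst).1, hpq, pow_mul]
  norm_num

end Factorization

/-! ### Real forms and structure maps. -/

section RealForms

variable {A B V V' : Type} [Ring A] [Algebra ℂ A] [Ring B] [Algebra ℝ B] [AddCommGroup V]
  [Module ℂ V] [AddCommGroup V'] [Module ℂ V']

theorem IsRealForm.span_eq_top {j : RealHom B A} (h : IsRealForm j) :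
    Submodule.span ℂ (Set.range j) = ⊤ := by
  refine eq_top_iff.2 fun a _ => ?_
  obtain ⟨z, rfl⟩ := h.2 a
  induction z using TensorProduct.induction_on with
  | zero => rw [map_zero]; exact zero_mem _
  | add x y hx hy => rw [map_add]; exact add_mem (hx trivial) (hy trivial)
  | tmul c b =>
    rw [LinearMap.liftBaseChange_tmul]
    exact Submodule.smul_mem _ _ (Submodule.subset_span ⟨b, rfl⟩)

theorem isRealForm_of_span [FiniteDimensional ℂ A] [FiniteDimensional ℝ B] (j : RealHom B A)
    (h : Submodule.span ℂ (Set.range j) = ⊤) (hd : Module.finrank ℝ B = Module.finrank ℂ A) :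
    IsRealForm j := by
  refine bijective_of_surjective_of_finrank _ ?_ (by rw [Module.finrank_baseChange, hd])
  rw [← LinearMap.range_eq_top, eq_top_iff, ← h, Submodule.span_le]
  rintro _ ⟨b, rfl⟩
  exact ⟨1 ⊗ₜ b, by rw [LinearMap.liftBaseChange_tmul, one_smul]; rfl⟩

/-- A basis of the real form is a basis of the complexification. -/
def IsRealForm.basis {ι : Type} {j : RealHom B A} (h : IsRealForm j) (b : Module.Basis ι ℝ B) :
    Module.Basis ι ℂ A :=
  (Algebra.TensorProduct.basis ℂ b).map (LinearEquiv.ofBijective _ h)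

theorem IsRealForm.basis_apply {ι : Type} {j : RealHom B A} (h : IsRealForm j)
    (b : Module.Basis ι ℝ B) (i : ι) : h.basis b i = j (b i) := by
  rw [IsRealForm.basis, Module.Basis.map_apply, Algebra.TensorProduct.basis_apply]
  change LinearMap.liftBaseChange ℂ j.toLinearMap (1 ⊗ₜ b i) = _
  rw [LinearMap.liftBaseChange_tmul, one_smul]
  rfl

/-- The homomorphism `b ↦ conj j(b)` into the conjugate algebra. -/
def conjRealHom (j : RealHom B A) : RealHom B (ConjAlg A) where
  __ := (conjAlg A).toRingHom.comp j.toRingHom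
  commutes' c := by
    change conjAlg A (j (algebraMap ℝ B c)) = algebraMap ℝ (ConjAlg A) c
    rw [AlgHom.commutes]
    change conjAlg A (algebraMap ℂ A (c : ℂ)) = algebraMap ℂ A (starRingEnd ℂ (c : ℂ))
    rw [Complex.conj_ofReal]
    rfl

/-- Conjugating the scalars does not change which sets are complex subspaces. -/
theorem span_conjRealHom {j : RealHom B A} (h : Submodule.span ℂ (Set.range j) = ⊤) :
    Submodule.span ℂ (Set.range (conjRealHom j)) = ⊤ := by
  refine Submodule.eq_top_iff'.2 fun a => ?_
  obtain ⟨a, rfl⟩ := (conjAlg A).surjective a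
  have ha : a ∈ Submodule.span ℂ (Set.range j) := h ▸ Submodule.mem_top
  induction ha using Submodule.span_induction with
  | mem x hx => obtain ⟨b, rfl⟩ := hx; exact Submodule.subset_span ⟨b, rfl⟩
  | zero => rw [map_zero]; exact zero_mem _
  | add x y _ _ hx hy => rw [map_add]; exact add_mem hx hy
  | smul c x _ hx =>
    have := smul_conjAlg A (starRingEnd ℂ c) x
    rw [Complex.conj_conj] at this
    rw [← this]
    exact Submodule.smul_mem _ _ hx

theorem finrank_algPow [FiniteDimensional ℂ A] (r : ℕ) :
    Module.finrank ℂ (AlgPow A r) = Module.finrank ℂ A ^ r ∧ FiniteDimensional ℂ (AlgPow A r) := by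
  let b := Basis.piTensorProduct fun _ : Fin r => Module.finBasis ℂ A
  refine ⟨?_, b.finiteDimensional_of_finite⟩
  rw [Module.finrank_eq_card_basis b, Fintype.card_pi]
  simp

variable {r : ℕ} {s t : Fin r → ℕ}

/-- The tensor product of homomorphisms `Cl_{s_i,t_i} → A`. -/
def tensorRealHom (e : ∀ i, RealHom (Cl (s i) (t i)) A) : RealHom (TensorCl s t) (AlgPow A r) :=
  PiTensorProduct.liftAlgHom
    (((PiTensorProduct.tprod ℂ : MultilinearMap ℂ (fun _ : Fin r => A) (AlgPow A r)).restrictScalars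
      ℝ).compLinearMap fun i => (e i).toLinearMap)
    (by
      change PiTensorProduct.tprod ℂ (fun i => e i 1) = _
      simp only [map_one]; rfl)
    (fun x y => by
      change PiTensorProduct.tprod ℂ (fun i => e i (x i * y i)) =
        PiTensorProduct.tprod ℂ (fun i => e i (x i)) * PiTensorProduct.tprod ℂ (fun i => e i (y i))
      simp only [map_mul]
      exact ((PiTensorProduct.tprodMonoidHom ℂ).map_mul (fun i => e i (x i)) (fun i => e i (y i))))

theorem tensorRealHom_tprod (e : ∀ i, RealHom (Cl (s i) (t i)) A) (x : ∀ i, Cl (s i) (t i)) :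
    tensorRealHom e (PiTensorProduct.tprod ℝ x) = PiTensorProduct.tprod ℂ fun i => e i (x i) := by
  rw [tensorRealHom, PiTensorProduct.liftAlgHom_apply, PiTensorProduct.lift.tprod]
  rfl

theorem isRealForm_tensorRealHom [FiniteDimensional ℂ A] {e : ∀ i, RealHom (Cl (s i) (t i)) A}
    (hst : ∀ i, s i + t i = 2) (hA : Module.finrank ℂ A = 4) (h : ∀ i, IsRealForm (e i)) :
    IsRealForm (tensorRealHom e) := by
  have := (finrank_algPow (A := A) r).2
  have := (finrank_tensorCl hst).2
  refine isRealForm_of_span _ ?_ (by rw [(finrank_tensorCl hst).1, (finrank_algPow r).1, hA])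
  let b := fun i => Module.finBasis ℝ (Cl (s i) (t i))
  rw [eq_top_iff, ← (Basis.piTensorProduct fun i => (h i).basis (b i)).span_eq]
  refine Submodule.span_mono ?_
  rintro _ ⟨p, rfl⟩
  refine ⟨PiTensorProduct.tprod ℝ fun i => b i (p i), ?_⟩
  rw [tensorRealHom_tprod, Basis.piTensorProduct_apply]
  simp only [IsRealForm.basis_apply]

/-! ### Antilinear maps -/

/-- The tensor product of antilinear maps. -/
def powAnti (J : Fin r → V →ₛₗ[starRingEnd ℂ] V') : Pow V r →ₛₗ[starRingEnd ℂ] Pow V' r :=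
  let F : Pow V r →ₗ[ℂ] ConjMod (Pow V' r) := PiTensorProduct.lift
    { toFun := fun v => conjMod _ (PiTensorProduct.tprod ℂ fun i => J i (v i))
      map_update_add' := fun v i x y => by
        have h : ∀ z, (fun l => J l (Function.update v i z l)) =
            Function.update (fun l => J l (v l)) i (J i z) := fun z =>
          funext fun l => Function.apply_update (fun l => J l) v i z l
        rw [h, h, h, map_add, MultilinearMap.map_update_add, map_add]
      map_update_smul' := fun v i c x => by
        have h : ∀ z, (fun l => J l (Function.update v i z l)) =
            Function.update (fun l => J l (v l)) i (J i z) := fun z =>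
          funext fun l => Function.apply_update (fun l => J l) v i z l
        rw [h, h, map_smulₛₗ, MultilinearMap.map_update_smul, smul_conjMod] }
  { toFun := fun z => (conjMod _).symm (F z)
    map_add' := fun x y => by rw [map_add, map_add]
    map_smul' := fun c x => by
      rw [map_smul]
      rfl }

theorem powAnti_tprod (J : Fin r → V →ₛₗ[starRingEnd ℂ] V') (v : Fin r → V) :
    powAnti J (PiTensorProduct.tprod ℂ v) = PiTensorProduct.tprod ℂ fun i => J i (v i) := by
  change (conjMod _).symm (PiTensorProduct.lift _ _) = _
  rw [PiTensorProduct.lift.tprod]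
  rfl

theorem antilinear_smul_real (J : V →ₛₗ[starRingEnd ℂ] V') (c : ℝ) (v : V) :
    J (c • v) = c • J v := by
  rw [← Complex.coe_smul, map_smulₛₗ, Complex.conj_ofReal, Complex.coe_smul]

/-- The tensor product of the structure maps of the factors, well defined because all of them are
antilinear; the squares multiply. -/
theorem HasStructure.tensor {γ : A →ₐ[ℂ] Module.End ℂ V} {e : ∀ i, RealHom (Cl (s i) (t i)) A}
    {ε : Fin r → ℂ} (h : ∀ i, HasStructure (ε i) γ (e i)) :
    HasStructure (∏ i, ε i) (powAction γ r) (tensorRealHom e) := by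
  choose J hJ hJe using h
  refine ⟨powAnti J, fun v => ?_, fun b v => ?_⟩
  · induction v using PiTensorProduct.induction_on with
    | smul_tprod c v =>
      rw [map_smulₛₗ, map_smulₛₗ, Complex.conj_conj, powAnti_tprod, powAnti_tprod, smul_comm,
        ← MultilinearMap.map_smul_univ]
      simp only [hJ]
    | add x y hx hy => rw [map_add, map_add, hx, hy, smul_add]
  · induction b using PiTensorProduct.induction_on with
    | smul_tprod c b =>
      rw [map_smul, ← Complex.coe_smul, map_smul, LinearMap.smul_apply, map_smulₛₗ,
        Complex.conj_ofReal, LinearMap.smul_apply, tensorRealHom_tprod]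
      congr 1
      have hγ : ∀ w, powAction γ r (PiTensorProduct.tprod ℂ fun i => e i (b i))
          (PiTensorProduct.tprod ℂ w) = PiTensorProduct.tprod ℂ fun i => γ (e i (b i)) (w i) := by
        intro w
        rw [powAction, PiTensorProduct.liftAlgHom_apply, PiTensorProduct.lift.tprod]
        exact PiTensorProduct.map_tprod _ _
      induction v using PiTensorProduct.induction_on with
      | smul_tprod c v =>
        rw [map_smul, map_smulₛₗ, map_smulₛₗ, map_smul, hγ, powAnti_tprod, powAnti_tprod, hγ]
        simp only [hJe]
      | add x y hx hy => rw [map_add, map_add, hx, hy, map_add, map_add]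
    | add x y hx hy =>
      rw [map_add, map_add, LinearMap.add_apply, map_add, hx, hy, LinearMap.add_apply]

theorem HasStructure.comp {B' : Type} [Ring B'] [Algebra ℝ B'] {γ : A →ₐ[ℂ] Module.End ℂ V}
    {j : RealHom B A} {ε : ℂ} (h : HasStructure ε γ j) (φ : B' →ₐ[ℝ] B) :
    HasStructure ε γ (AlgHom.comp j φ) := by
  obtain ⟨J, h1, h2⟩ := h
  exact ⟨J, h1, fun b v => h2 (φ b) v⟩

theorem HasStructure.conj {γ : A →ₐ[ℂ] Module.End ℂ V} {j : RealHom B A} {ε : ℂ}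
    (hε : starRingEnd ℂ ε = ε) (h : HasStructure ε γ j) :
    HasStructure ε (conjAction γ) (conjRealHom j) := by
  obtain ⟨J, h1, h2⟩ := h
  refine ⟨{ toFun := fun v => conjMod V (J ((conjMod V).symm v))
            map_add' := fun v w => by simp
            map_smul' := fun c v => by
              obtain ⟨v, rfl⟩ := (conjMod V).surjective v
              rw [smul_conjMod, AddEquiv.symm_apply_apply, AddEquiv.symm_apply_apply, map_smulₛₗ,
                smul_conjMod] }, fun v => ?_, fun b v => ?_⟩
  · obtain ⟨v, rfl⟩ := (conjMod V).surjective v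
    change conjMod V (J (J v)) = ε • conjMod V v
    rw [h1, smul_conjMod, hε]
  · exact congrArg (conjMod V) (h2 b v)

/-! ### The factors -/

/-- The generators of `Cl_{s,t}`, `s + t = 2`, in `ℂ_2`. -/
def embGen {s t : ℕ} (h : s + t = 2) (a : Fin s ⊕ Fin t) : C2 :=
  (Sum.elim (fun _ => 1) (fun _ => Complex.I) a : ℂ) •
    (![s1, s2] : Fin 2 → C2) (Fin.cast h (finSumFinEquiv a))

theorem isGenerating_embGen {s t : ℕ} (h : s + t = 2) : IsGenerating sgn (embGen h) := by
  have hsq : ∀ i, (![s1, s2] : Fin 2 → C2) i * (![s1, s2] : Fin 2 → C2) i = 1 := by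
    intro i; fin_cases i
    · exact s1_sq
    · exact s2_sq
  have hanti : ∀ i j, i ≠ j → (![s1, s2] : Fin 2 → C2) i * (![s1, s2] : Fin 2 → C2) j =
      -((![s1, s2] : Fin 2 → C2) j * (![s1, s2] : Fin 2 → C2) i) := by
    intro i j hij; fin_cases i <;> fin_cases j
    · exact absurd rfl hij
    · change s1 * s2 = -(s2 * s1); rw [s2_s1, neg_neg]
    · exact s2_s1
    · exact absurd rfl hij
  refine ⟨fun a => ?_, fun a b hab => ?_⟩
  · rw [embGen, smul_mul_smul_comm, hsq, ← Complex.coe_smul]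
    congr 1
    rcases a with a | a <;> simp [sgn]
  · rw [embGen, embGen, smul_mul_smul_comm, smul_mul_smul_comm, hanti _ _ fun e => hab
      (finSumFinEquiv.injective (Fin.cast_injective h e)), smul_neg, mul_comm]

/-- The embedding of `Cl_{s,t}`, `s + t = 2`, into `ℂ_2`. -/
def emb {s t : ℕ} (h : s + t = 2) : RealHom (Cl s t) C2 := clLift (embGen h) (isGenerating_embGen h)

/-- The complex span of the image is a subalgebra containing s₁ and s₂, hence everything; both sides
have dimension 4. -/
theorem isRealForm_emb {s t : ℕ} (h : s + t = 2) : IsRealForm (emb h) := by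
  refine isRealForm_of_span _ ?_ (by rw [finrank_Cl, finrank_C2, h]; rfl)
  have hs : ∀ i, (![s1, s2] : Fin 2 → C2) i ∈ Algebra.adjoin ℂ (Set.range (emb h)) := fun i => by
    have h1 : emb h (gen s t (finSumFinEquiv.symm (Fin.cast h.symm i))) ∈
        Algebra.adjoin ℂ (Set.range (emb h)) := Algebra.subset_adjoin ⟨_, rfl⟩
    rw [emb, clLift_gen, embGen, Equiv.apply_symm_apply] at h1
    have h2 : (Sum.elim (fun _ => 1) (fun _ => Complex.I)
      (finSumFinEquiv.symm (Fin.cast h.symm i)) : ℂ) ≠ 0 := by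
      cases finSumFinEquiv.symm (Fin.cast h.symm i) <;> simp
    have h3 := Subalgebra.smul_mem _ h1 (Sum.elim (fun _ => 1) (fun _ => Complex.I)
      (finSumFinEquiv.symm (Fin.cast h.symm i)) : ℂ)⁻¹
    rwa [smul_smul, inv_mul_cancel₀ h2, one_smul] at h3
  have hadj : Algebra.adjoin ℂ (Set.range (emb h)) = ⊤ := by
    refine Algebra.eq_top_iff.2 fun a => ?_
    induction a using CliffordAlgebra.induction (Q := pauliForm) with
    | algebraMap c => exact Subalgebra.algebraMap_mem (Algebra.adjoin ℂ (Set.range (emb h))) c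
    | add x y hx hy => exact Subalgebra.add_mem _ hx hy
    | mul x y hx hy => exact Subalgebra.mul_mem _ hx hy
    | ι v =>
      have : (CliffordAlgebra.ι pauliForm v : C2) = v 0 • s1 + v 1 • s2 := by
        change ι2 v = _
        conv_lhs => rw [pi_eq_sum_univ' v]
        rw [map_sum, Fin.sum_univ_two, map_smul, map_smul]
        rfl
      have hm := (Algebra.adjoin ℂ (Set.range (emb h))).add_mem
        (Subalgebra.smul_mem _ (hs 0) (v 0)) (Subalgebra.smul_mem _ (hs 1) (v 1))
      exact this ▸ hm
  have hr : Set.range (emb h) = ((emb h).range.toSubmonoid : Set C2) := rfl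
  rw [eq_top_iff, ← Algebra.top_toSubmodule, ← hadj, Algebra.adjoin_eq_span, hr,
    Submonoid.closure_eq]

/-- J is complex conjugation followed by a matrix m. Of the Pauli matrices s₁ is real and s₂
imaginary, and m is chosen in each signature so that J commutes with both generators, which suffices
by `cl_induction`. -/
theorem hasStructure_emb {s t : ℕ} (h : s + t = 2) :
    HasStructure (structSign t : ℂ) spinor (emb h) := by
  suffices hJ : ∃ J : S2 →ₛₗ[starRingEnd ℂ] S2, (∀ v, J (J v) = (structSign t : ℂ) • v) ∧
      ∀ a v, J (spinor (embGen h a) v) = spinor (embGen h a) (J v) by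
    obtain ⟨J, h1, h2⟩ := hJ
    refine ⟨J, h1, fun b => ?_⟩
    let P : Submodule ℝ (Cl s t) :=
      { carrier := {b | ∀ v, J (spinor (emb h b) v) = spinor (emb h b) (J v)}
        add_mem' := fun {a b} ha hb v => by
          rw [map_add, map_add, LinearMap.add_apply, map_add, ha, hb, LinearMap.add_apply]
        zero_mem' := fun v => by simp
        smul_mem' := fun c b hb v => by
          rw [map_smul, ← Complex.coe_smul, map_smul, LinearMap.smul_apply, map_smulₛₗ,
            Complex.conj_ofReal, LinearMap.smul_apply, hb] }
    refine cl_induction P (fun v => by simp) (fun b hb a v => ?_) b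
    rw [map_mul, map_mul, Module.End.mul_apply, Module.End.mul_apply, hb, emb, clLift_gen, h2]
  have hconj : ∀ m : C2, ∃ J : S2 →ₛₗ[starRingEnd ℂ] S2,
      ∀ v, J v = spinor m (fun i => starRingEnd ℂ (v i)) := fun m =>
    ⟨{ toFun := fun v => spinor m (fun i => starRingEnd ℂ (v i))
       map_add' := fun v w => by
        rw [← map_add]; congr 1; funext i; simp
       map_smul' := fun c v => by
        rw [← map_smul]; congr 1; funext i; simp }, fun v => rfl⟩
  have h1 : ∀ v, spinor s1 v = ![v 1, v 0] := spinor_pauli_apply 0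
  have h2 : ∀ v, spinor s2 v = ![-(Complex.I * v 1), Complex.I * v 0] := spinor_pauli_apply 1
  obtain ⟨rfl, rfl⟩ | ⟨rfl, rfl⟩ | ⟨rfl, rfl⟩ :
      (s = 2 ∧ t = 0) ∨ (s = 1 ∧ t = 1) ∨ (s = 0 ∧ t = 2) := by omega
  · obtain ⟨J, hJ⟩ := hconj s1
    refine ⟨J, fun v => ?_, ?_⟩
    · simp only [hJ, h1]
      funext i; fin_cases i <;> simp [structSign]
    · have e0 : embGen h (Sum.inl 0) = (1 : ℂ) • s1 := rfl
      have e1 : embGen h (Sum.inl 1) = (1 : ℂ) • s2 := rfl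
      rintro (a | a) v
      · fin_cases a
        · simp only [Fin.zero_eta, e0, hJ, map_smul, LinearMap.smul_apply, h1]
          funext i; fin_cases i <;> simp
        · simp only [Fin.mk_one, e1, hJ, map_smul, LinearMap.smul_apply, h1, h2]
          funext i; fin_cases i <;> simp
      · exact a.elim0
  · obtain ⟨J, hJ⟩ := hconj 1
    refine ⟨J, fun v => ?_, ?_⟩
    · simp only [hJ, map_one, Module.End.one_apply]
      funext i; fin_cases i <;> simp [structSign]
    · have e0 : embGen h (Sum.inl 0) = (1 : ℂ) • s1 := rfl
      have e1 : embGen h (Sum.inr 0) = Complex.I • s2 := rfl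
      rintro (a | a) v <;> rw [Subsingleton.elim a 0]
      · simp only [e0, hJ, map_smul, LinearMap.smul_apply, h1, map_one, Module.End.one_apply]
        funext i; fin_cases i <;> simp
      · simp only [e1, hJ, map_smul, LinearMap.smul_apply, h2, map_one, Module.End.one_apply]
        funext i; fin_cases i <;> simp
  -- The sign -1 arises here: m = s₂ is imaginary, so J² = s₂ · conj(s₂) = -1.
  · obtain ⟨J, hJ⟩ := hconj s2
    refine ⟨J, fun v => ?_, ?_⟩
    · simp only [hJ, h2]
      funext i; fin_cases i <;> simp [structSign, ← mul_assoc]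
    · have e0 : embGen h (Sum.inr 0) = Complex.I • s1 := rfl
      have e1 : embGen h (Sum.inr 1) = Complex.I • s2 := rfl
      rintro (a | a) v
      · exact a.elim0
      · fin_cases a
        · simp only [Fin.zero_eta, e0, hJ, map_smul, LinearMap.smul_apply, h1, h2]
          funext i; fin_cases i <;> simp
        · simp only [Fin.mk_one, e1, hJ, map_smul, LinearMap.smul_apply, h2]
          funext i; fin_cases i <;> simp

end RealForms

/-! ### Real and quaternionic matrix algebras from structure maps. -/

section Classification

variable {A B V : Type} [Ring A] [Algebra ℂ A] [Ring B] [Algebra ℝ B] [AddCommGroup V]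
  [Module ℂ V]

theorem IsRealForm.injective {j : RealHom B A} (h : IsRealForm j) : Function.Injective j := by
  let b := Module.Free.chooseBasis ℝ B
  intro x y hxy
  refine b.ext_elem fun i => ?_
  have key : ∀ z, ((h.basis b).repr (j z)) i = (b.repr z i : ℂ) := fun z => by
    conv_lhs => rw [← b.linearCombination_repr z, Finsupp.linearCombination_apply, Finsupp.sum,
      map_sum, map_sum, Finsupp.finsetSum_apply]
    rw [Finset.sum_eq_single i]
    · rw [map_smul, ← h.basis_apply, ← Complex.coe_smul, map_smul, Module.Basis.repr_self]
      simp
    · intro l _ hl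
      rw [map_smul, ← h.basis_apply, ← Complex.coe_smul, map_smul, Module.Basis.repr_self]
      simp [hl]
    · intro hi
      rw [Finsupp.notMem_support_iff.1 hi]; simp
  have := key x
  rw [hxy, key y] at this
  exact_mod_cast this.symm

theorem RealHom.action_real (γ : A →ₐ[ℂ] Module.End ℂ V) (j : RealHom B A) (c : ℝ) (v : V) :
    γ (j (algebraMap ℝ B c)) v = c • v := by
  rw [AlgHom.commutes]
  change γ (algebraMap ℂ A c) v = _
  rw [AlgHom.commutes, Module.algebraMap_end_apply, Complex.coe_smul]

/-- The fixed points W of J form a real subspace with V = W ⊕ iW. B acts on W, faithfully because W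
spans V, and has the dimension of End W. -/
theorem nonempty_algEquiv_matR [FiniteDimensional ℂ V] [FiniteDimensional ℝ B] {r : ℕ}
    (hV : Module.finrank ℂ V = 2 ^ r) (hB : Module.finrank ℝ B = 4 ^ r)
    {γ : A →ₐ[ℂ] Module.End ℂ V} {j : RealHom B A} (hinj : Function.Injective fun b => γ (j b))
    (h : HasStructure 1 γ j) : Nonempty (B ≃ₐ[ℝ] MatR r) := by
  obtain ⟨J, hJ, hJb⟩ := h
  simp only [one_smul] at hJ
  let W : Submodule ℝ V :=
    { carrier := {v | J v = v}
      add_mem' := fun {v w} hv hw => by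
        rw [Set.mem_ofPred_eq] at *; rw [map_add, hv, hw]
      zero_mem' := map_zero J
      smul_mem' := fun c v hv => by
        rw [Set.mem_ofPred_eq] at *; rw [antilinear_smul_real, hv] }
  have hW : ∀ w : W, J w = w := fun w => w.2
  have : FiniteDimensional ℝ V := Module.Finite.trans (R := ℝ) ℂ V
  let e : W × W →ₗ[ℝ] V := W.subtype.coprod
    ((LinearMap.lsmul ℂ V Complex.I).restrictScalars ℝ ∘ₗ W.subtype)
  have he : ∀ a b : W, e (a, b) = a + Complex.I • (b : V) := fun a b => rfl
  have h2 : starRingEnd ℂ 2 = 2 := map_ofNat _ 2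
  have hrep : ∀ v : V, ∃ a b : W, v = a + Complex.I • (b : V) := fun v => by
    -- The real and imaginary parts of v with respect to J.
    refine ⟨⟨(1 / 2 : ℂ) • (v + J v), ?_⟩, ⟨(-Complex.I / 2) • (v - J v), ?_⟩, ?_⟩
    · change J _ = _
      rw [map_smulₛₗ, map_add, hJ, add_comm]; simp [h2]
    · change J _ = _
      rw [map_smulₛₗ, map_sub, hJ, ← neg_sub, smul_neg, ← neg_smul]
      congr 1; simp [h2]; ring
    · simp only [smul_smul]
      rw [show Complex.I * (-Complex.I / 2) = 1 / 2 by
        linear_combination (-1 / 2 : ℂ) * Complex.I_mul_I]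
      rw [← smul_add, add_add_sub_cancel, ← two_smul ℂ v, smul_smul]
      simp
  have hbij : Function.Bijective e := by
    refine ⟨?_, fun v => ?_⟩
    · rw [injective_iff_map_eq_zero]
      rintro ⟨a, b⟩ hab
      rw [he] at hab
      have h2 : (a : V) - Complex.I • (b : V) = 0 := by
        have := congrArg J hab
        rw [map_add, map_smulₛₗ, hW, hW, map_zero, Complex.conj_I, neg_smul] at this
        rw [sub_eq_add_neg, this]
      have ha : (a : V) = 0 := by
        have h3 : (2 : ℂ) • (a : V) = 0 := by
          rw [two_smul]
          calc (a : V) + a = (a + Complex.I • (b : V)) + (a - Complex.I • (b : V)) := by abel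
            _ = 0 := by rw [hab, h2, add_zero]
        exact (smul_eq_zero.1 h3).resolve_left two_ne_zero
      rw [ha, zero_add] at hab
      exact Prod.ext (Subtype.ext ha)
        (Subtype.ext ((smul_eq_zero.1 hab).resolve_left Complex.I_ne_zero))
    · obtain ⟨a, b, hab⟩ := hrep v
      exact ⟨(a, b), hab.symm⟩
  have hWdim : Module.finrank ℝ W = 2 ^ r := by
    have h1 := (LinearEquiv.ofBijective e hbij).finrank_eq
    rw [Module.finrank_prod, finrank_real_of_complex, hV] at h1
    omega
  let F : B →ₐ[ℝ] Module.End ℝ W :=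
    { toFun := fun b => ((γ (j b)).restrictScalars ℝ).restrict (p := W) (q := W) fun v hv => by
        change J (γ (j b) v) = γ (j b) v
        rw [hJb, show J v = v from hv]
      map_one' := by ext v; simp
      map_mul' := fun a b => by ext v; simp
      map_zero' := by ext v; simp
      map_add' := fun a b => by ext v; simp
      commutes' := fun c => by
        ext v
        exact RealHom.action_real γ j c v }
  have hF : ∀ b (w : W), ((F b w : W) : V) = γ (j b) w := fun _ _ => rfl
  have hFinj : Function.Injective F := by
    intro a b hab
    refine hinj (LinearMap.ext fun v => ?_)
    obtain ⟨x, y, rfl⟩ := hrep v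
    simp only [map_add, map_smul, ← hF, hab]
  have hd : Module.finrank ℝ B = Module.finrank ℝ (Module.End ℝ W) := by
    rw [hB, Module.finrank_linearMap, hWdim, ← mul_pow]; rfl
  let E := AlgEquiv.ofBijective F
    ⟨hFinj, (LinearMap.injective_iff_surjective_of_finrank_eq_finrank (f := F.toLinearMap) hd).1 hFinj⟩
  exact ⟨E.trans (algEquivMatrix (Module.finBasisOfFinrankEq ℝ W hWdim))⟩

theorem nonempty_algEquiv_matrix_quaternion {B V : Type} [Ring B] [Algebra ℝ B] [AddCommGroup V]
    [Module ℝ V] [Module ℍ[ℝ] V] [IsScalarTower ℝ ℍ[ℝ] V] [FiniteDimensional ℝ B]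
    [FiniteDimensional ℝ V] {n : ℕ} (hV : Module.finrank ℝ V = 4 * n)
    (hB : Module.finrank ℝ B = 4 * (n * n)) (F : B →ₐ[ℝ] Module.End ℍ[ℝ] V)
    (hF : Function.Injective F) : Nonempty (B ≃ₐ[ℝ] Matrix (Fin n) (Fin n) ℍ[ℝ]) := by
  have : Module.Finite ℍ[ℝ] V := Module.Finite.of_restrictScalars_finite ℝ ℍ[ℝ] V
  have hn : Module.finrank ℍ[ℝ] V = n := by
    have := Module.finrank_mul_finrank ℝ ℍ[ℝ] V
    rw [Quaternion.finrank_eq_four, hV] at this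
    omega
  let e : V ≃ₗ[ℍ[ℝ]] (Fin n → ℍ[ℝ]) := (Module.finBasisOfFinrankEq ℍ[ℝ] V hn).equivFun
  -- Endomorphisms of ℍ as a left module form the opposite algebra; quaternion conjugation
  -- identifies it with ℍ.
  let E : Module.End ℍ[ℝ] V ≃ₐ[ℝ] Matrix (Fin n) (Fin n) ℍ[ℝ] :=
    ((e.conjAlgEquiv ℝ).trans (endVecAlgEquivMatrixEnd (Fin n) ℝ ℍ[ℝ] ℍ[ℝ])).trans
      (AlgEquiv.mapMatrix ((AlgEquiv.moduleEndSelf ℝ).symm.trans Quaternion.starAe.symm))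
  have hd : Module.finrank ℝ B = Module.finrank ℝ (Matrix (Fin n) (Fin n) ℍ[ℝ]) := by
    rw [hB, Module.finrank_matrix, Quaternion.finrank_eq_four]; simp [mul_comm]
  have hinj : Function.Injective (E.toAlgHom.comp F) := E.injective.comp hF
  exact ⟨AlgEquiv.ofBijective (E.toAlgHom.comp F) ⟨hinj,
    (LinearMap.injective_iff_surjective_of_finrank_eq_finrank
      (f := (E.toAlgHom.comp F).toLinearMap) hd).1 hinj⟩⟩

/-- Multiplication by i and J satisfy the quaternion relations, making V a quaternionic space of
dimension 2^(r-1) on which B acts ℍ-linearly and faithfully. -/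
theorem nonempty_algEquiv_matH [FiniteDimensional ℂ V] [FiniteDimensional ℝ B] {r : ℕ}
    (hr : 1 ≤ r) (hV : Module.finrank ℂ V = 2 ^ r) (hB : Module.finrank ℝ B = 4 ^ r)
    {γ : A →ₐ[ℂ] Module.End ℂ V} {j : RealHom B A} (hinj : Function.Injective fun b => γ (j b))
    (h : HasStructure (-1) γ j) : Nonempty (B ≃ₐ[ℝ] MatH r) := by
  obtain ⟨J, hJ, hJb⟩ := h
  let I' : Module.End ℝ V := (LinearMap.lsmul ℂ V Complex.I).restrictScalars ℝ
  let J' : Module.End ℝ V :=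
    { toFun := J, map_add' := map_add J, map_smul' := fun c v => antilinear_smul_real J c v }
  let q : QuaternionAlgebra.Basis (Module.End ℝ V) (-1 : ℝ) 0 (-1) :=
    { i := I', j := J', k := I' * J'
      i_mul_i := by
        ext v
        change Complex.I • Complex.I • v = (-1 : ℝ) • v + (0 : ℝ) • (Complex.I • v)
        rw [smul_smul, Complex.I_mul_I]; simp
      j_mul_j := by
        ext v
        change J (J v) = (-1 : ℝ) • v
        rw [hJ]; simp
      i_mul_j := rfl
      j_mul_i := by
        ext v
        change J (Complex.I • v) = (0 : ℝ) • J v - Complex.I • J v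
        rw [map_smulₛₗ, Complex.conj_I]; simp }
  let Q : ℍ[ℝ] →ₐ[ℝ] Module.End ℝ V := QuaternionAlgebra.lift q
  have hQ : ∀ (x : ℍ[ℝ]) (v : V), Q x v = x.re • v + x.imI • (Complex.I • v) + x.imJ • J v +
      x.imK • (Complex.I • J v) := fun x v => rfl
  let _ : Module ℍ[ℝ] V := Module.compHom V Q.toRingHom
  have hsmul : ∀ (x : ℍ[ℝ]) (v : V), x • v = Q x v := fun _ _ => rfl
  have : IsScalarTower ℝ ℍ[ℝ] V := ⟨fun c x v => by rw [hsmul, hsmul, map_smul]; rfl⟩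
  have : FiniteDimensional ℝ V := Module.Finite.trans (R := ℝ) ℂ V
  obtain ⟨r, rfl⟩ : ∃ s, r = s + 1 := ⟨r - 1, by omega⟩
  let F : B →ₐ[ℝ] Module.End ℍ[ℝ] V :=
    { toFun := fun b =>
        { toFun := γ (j b)
          map_add' := map_add _
          map_smul' := fun x v => by
            rw [RingHom.id_apply, hsmul, hsmul, hQ, hQ]
            simp only [map_add, ← Complex.coe_smul, map_smul, hJb] }
      map_one' := by ext v; simp
      map_mul' := fun a b => by ext v; simp
      map_zero' := by ext v; simp
      map_add' := fun a b => by ext v; simp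
      commutes' := fun c => by
        ext v
        exact RealHom.action_real γ j c v }
  have hF : Function.Injective F := fun a b hab =>
    hinj (LinearMap.ext fun v => LinearMap.congr_fun hab v)
  refine nonempty_algEquiv_matrix_quaternion ?_ ?_ F hF
  · rw [finrank_real_of_complex, hV, Nat.add_sub_cancel]; ring
  · rw [hB, Nat.add_sub_cancel, ← mul_pow, pow_succ]; ring

end Classification

/-! ### The algebras with an even number of generators. -/

section EvenSystem

theorem finrank_S (r : ℕ) : Module.finrank ℂ (S r) = 2 ^ r := by
  rw [Module.finrank_eq_card_basis (Basis.piTensorProduct fun _ : Fin r => Pi.basisFun ℂ (Fin 2))]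
  simp

instance : FiniteDimensional ℂ (ConjAlg C2) := by
  let e := LinearEquiv.ofBijective (conjAction spinor).toLinearMap
    (conjAction_bijective spinor_bijective)
  exact Module.Finite.equiv e.symm

theorem finrank_conjC2 : Module.finrank ℂ (ConjAlg C2) = 4 := by
  rw [(LinearEquiv.ofBijective (conjAction spinor).toLinearMap
    (conjAction_bijective spinor_bijective)).finrank_eq, Module.finrank_linearMap,
    Module.finrank_eq_card_basis dotBasis]
  rfl

instance (r : ℕ) : FiniteDimensional ℂ (Und r) := (finrank_algPow r).2

instance (r : ℕ) : FiniteDimensional ℂ (Dot r) := (finrank_algPow r).2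

theorem finrank_Und (r : ℕ) : Module.finrank ℂ (Und r) = 4 ^ r := by
  rw [(finrank_algPow r).1, finrank_C2]

theorem finrank_Dot (r : ℕ) : Module.finrank ℂ (Dot r) = 4 ^ r := by
  rw [(finrank_algPow r).1, finrank_conjC2]

namespace Factors

variable {r : ℕ} (f : Factors r)

/-- The embedding of `Cl_{s_1,t_1} ⊗ ⋯ ⊗ Cl_{s_r,t_r}` into `ℂ_2 ⊗ ⋯ ⊗ ℂ_2`. -/
def undReal : RealHom f.Alg (Und r) := tensorRealHom f.emb

/-- The embedding of `Cl_{s_1,t_1} ⊗ ⋯ ⊗ Cl_{s_r,t_r}` into `ℂ̄_2 ⊗ ⋯ ⊗ ℂ̄_2`. -/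
def dotReal : RealHom f.Alg (Dot r) := tensorRealHom fun i => conjRealHom (f.emb i)

theorem undReal_tprod (x : ∀ i, Cl (f.s i) (f.t i)) :
    f.undReal (PiTensorProduct.tprod ℝ x) = f.und x := tensorRealHom_tprod _ x

theorem dotReal_tprod (x : ∀ i, Cl (f.s i) (f.t i)) :
    f.dotReal (PiTensorProduct.tprod ℝ x) = f.dot x := tensorRealHom_tprod _ x

theorem isRealForm_undReal : IsRealForm f.undReal :=
  isRealForm_tensorRealHom f.sum_eq finrank_C2 f.isRealForm

theorem isRealForm_dotReal : IsRealForm f.dotReal := by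
  refine isRealForm_tensorRealHom f.sum_eq finrank_conjC2 fun i => isRealForm_of_span _
    (span_conjRealHom (f.isRealForm i).span_eq_top) ?_
  rw [finrank_Cl, f.sum_eq, finrank_conjC2]; rfl

theorem finrank_alg : Module.finrank ℝ f.Alg = 4 ^ r := (finrank_tensorCl f.sum_eq).1

instance : FiniteDimensional ℝ f.Alg := (finrank_tensorCl f.sum_eq).2

end Factors

theorem IsRealForm.comp_algEquiv {A B B' : Type} [Ring A] [Algebra ℂ A] [Ring B] [Algebra ℝ B]
    [Ring B'] [Algebra ℝ B'] [FiniteDimensional ℂ A] [FiniteDimensional ℝ B'] {j : RealHom B A}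
    (h : IsRealForm j) (φ : B' ≃ₐ[ℝ] B) : IsRealForm (AlgHom.comp j φ.toAlgHom) := by
  refine isRealForm_of_span _ ?_ ?_
  · rw [← h.span_eq_top]
    congr 1
    exact φ.surjective.range_comp j
  · have : FiniteDimensional ℝ B := Module.Finite.equiv φ.toLinearEquiv
    rw [φ.toLinearEquiv.finrank_eq, ← (LinearEquiv.ofBijective _ h).finrank_eq,
      Module.finrank_baseChange]

/-- The factorization of `Cl_{p,q}` with `p + q` even, together with its structure maps. -/
theorem exists_factors {p q r : ℕ} (h : p + q = 2 * r) :
    ∃ (f : Factors r) (_ : Cl p q ≃ₐ[ℝ] f.Alg),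
      (HasType p q 0 ∨ HasType p q 2 →
        HasStructure 1 (undAction r) f.undReal ∧ HasStructure 1 (dotAction r) f.dotReal) ∧
      (HasType p q 4 ∨ HasType p q 6 →
        HasStructure (-1) (undAction r) f.undReal ∧ HasStructure (-1) (dotAction r) f.dotReal) := by
  obtain ⟨s, t, hst, hsig, h1, h2⟩ := exists_factorization r p q h
  obtain ⟨φ⟩ := exists_algEquiv_tensorCl hst h hsig
  let f : Factors r := ⟨s, t, hst, fun i => emb (hst i), fun i => isRealForm_emb (hst i)⟩
  have hu : HasStructure (∏ i, (structSign (t i) : ℂ)) (undAction r) f.undReal :=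
    HasStructure.tensor fun i => hasStructure_emb (hst i)
  have hd : HasStructure (∏ i, (structSign (t i) : ℂ)) (dotAction r) f.dotReal :=
    HasStructure.tensor fun i => (hasStructure_emb (hst i)).conj (map_intCast _ _)
  rw [← Int.cast_prod] at hu hd
  refine ⟨f, φ, fun hh => ?_, fun hh => ?_⟩
  · rw [h1 hh, Int.cast_one] at hu hd
    exact ⟨hu, hd⟩
  · rw [h2 hh, Int.cast_neg, Int.cast_one] at hu hd
    exact ⟨hu, hd⟩

theorem Factors.injective_action {r : ℕ} (f : Factors r) :
    Function.Injective fun b => undAction r (f.undReal b) :=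
  (undAction_bijective r).1.comp f.isRealForm_undReal.injective

theorem Factors.nonempty_matR {r : ℕ} (f : Factors r)
    (h : HasStructure 1 (undAction r) f.undReal) : Nonempty (f.Alg ≃ₐ[ℝ] MatR r) :=
  nonempty_algEquiv_matR (finrank_S r) f.finrank_alg f.injective_action h

theorem Factors.nonempty_matH {r : ℕ} (hr : 1 ≤ r) (f : Factors r)
    (h : HasStructure (-1) (undAction r) f.undReal) : Nonempty (f.Alg ≃ₐ[ℝ] MatH r) :=
  nonempty_algEquiv_matH hr (finrank_S r) f.finrank_alg f.injective_action h

theorem one_le_of_hasType {p q r : ℕ} (h : p + q = 2 * r) (h' : HasType p q 4 ∨ HasType p q 6) :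
    1 ≤ r := by
  simp only [HasType, Int.ModEq] at h'
  omega

theorem nonempty_cl_matR {p q r : ℕ} (h : p + q = 2 * r) (h' : HasType p q 0 ∨ HasType p q 2) :
    Nonempty (Cl p q ≃ₐ[ℝ] MatR r) := by
  obtain ⟨f, φ, h0, -⟩ := exists_factors h
  obtain ⟨e⟩ := f.nonempty_matR (h0 h').1
  exact ⟨φ.trans e⟩

theorem nonempty_cl_matH {p q r : ℕ} (h : p + q = 2 * r) (h' : HasType p q 4 ∨ HasType p q 6) :
    Nonempty (Cl p q ≃ₐ[ℝ] MatH r) := by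
  obtain ⟨f, φ, -, h4⟩ := exists_factors h
  obtain ⟨e⟩ := f.nonempty_matH (one_le_of_hasType h h') (h4 h').1
  exact ⟨φ.trans e⟩

/-- The system `M⁺`. -/
theorem even_system {p q r : ℕ} (h : p + q = 2 * r) :
    ∃ (f : Factors r) (φ : Cl p q ≃ₐ[ℝ] f.Alg) (j : RealHom (Cl p q) (Und r)),
      IsRealForm j ∧
      (∀ x, j (φ.symm (PiTensorProduct.tprod ℝ x)) = f.und x) ∧
      (HasType p q 0 ∨ HasType p q 2 →
        Nonempty (Cl p q ≃ₐ[ℝ] MatR r) ∧ HasStructure 1 (undAction r) j) ∧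
      (HasType p q 4 ∨ HasType p q 6 →
        Nonempty (Cl p q ≃ₐ[ℝ] MatH r) ∧ HasStructure (-1) (undAction r) j) := by
  obtain ⟨f, φ, h0, h4⟩ := exists_factors h
  refine ⟨f, φ, AlgHom.comp f.undReal φ.toAlgHom, f.isRealForm_undReal.comp_algEquiv φ, fun x => ?_,
    fun hh => ⟨nonempty_cl_matR h hh, (h0 hh).1.comp _⟩,
    fun hh => ⟨nonempty_cl_matH h hh, (h4 hh).1.comp _⟩⟩
  rw [← f.undReal_tprod]
  exact congrArg f.undReal (φ.apply_symm_apply _)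

end EvenSystem

/-! ### The algebras with an odd number of generators. -/

section OddSystem

/-- An algebra `C = B ⊕ ωB` with `ω` central and `ω² = ε` is determined by `B` and `ε`. -/
theorem exists_algHom_of_decomposition {B C A : Type} [Ring B] [Algebra ℝ B] [Ring C] [Algebra ℝ C]
    [Ring A] [Algebra ℝ A] {ψ : B →ₐ[ℝ] C} {ω : C} (hω : ∀ c, ω * c = c * ω) {ε : ℝ}
    (hε : ω * ω = ε • 1) (hbij : Function.Bijective fun b : B × B => ψ b.1 + ω * ψ b.2)
    (η : B →ₐ[ℝ] A) (ζ : A) (hζ : ∀ b, ζ * η b = η b * ζ) (hζε : ζ * ζ = ε • 1) :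
    ∃ j : C →ₐ[ℝ] A, ∀ b b', j (ψ b + ω * ψ b') = η b + ζ * η b' := by
  let Ψ : B × B →ₗ[ℝ] C := ψ.toLinearMap.coprod (LinearMap.mulLeft ℝ ω ∘ₗ ψ.toLinearMap)
  let H : B × B →ₗ[ℝ] A := η.toLinearMap.coprod (LinearMap.mulLeft ℝ ζ ∘ₗ η.toLinearMap)
  let E : (B × B) ≃ₗ[ℝ] C := LinearEquiv.ofBijective Ψ hbij
  have hE : ∀ b b', E (b, b') = ψ b + ω * ψ b' := fun _ _ => rfl
  let G : C →ₗ[ℝ] A := H ∘ₗ E.symm.toLinearMap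
  have hG : ∀ b b', G (ψ b + ω * ψ b') = η b + ζ * η b' := fun b b' => by
    rw [← hE]
    exact congrArg H (E.symm_apply_apply (b, b'))
  refine ⟨AlgHom.ofLinearMap G ?_ ?_, hG⟩
  · simpa using hG 1 0
  · intro c d
    obtain ⟨⟨a, a'⟩, rfl⟩ := E.surjective c
    obtain ⟨⟨b, b'⟩, rfl⟩ := E.surjective d
    have hmul : ∀ {D : Type} [Ring D] [Algebra ℝ D] (θ : B →ₐ[ℝ] D) (z : D),
        (∀ b, z * θ b = θ b * z) → z * z = ε • 1 →
        (θ a + z * θ a') * (θ b + z * θ b') =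
          θ (a * b + ε • (a' * b')) + z * θ (a * b' + a' * b) := by
      intro D _ _ θ z hz hzz
      have h1 : z * θ a' * (z * θ b') = ε • (θ a' * θ b') := by
        rw [mul_assoc, ← mul_assoc (θ a'), ← hz, mul_assoc z, ← mul_assoc z z, hzz, smul_mul_assoc,
          one_mul]
      have h2 : θ a * (z * θ b') = z * (θ a * θ b') := by rw [← mul_assoc, ← hz, mul_assoc]
      rw [add_mul, mul_add, mul_add, h1, h2, map_add, map_smul, map_mul, map_mul, map_add, map_mul,
        map_mul, mul_add, mul_assoc]
      abel
    rw [hE, hE, hmul ψ ω (fun b => hω _) hε, hG, hG, hG, hmul η ζ hζ hζε]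

/-- The last generator x is dropped, a negative one if there is any. The difference p - q then rises
or falls by 1, so type 1 leads to types 0, 2 and type 5 to types 4, 6. -/
theorem exists_remove_generator {p q r : ℕ} (h : p + q = 2 * r + 1) :
    ∃ p₀ q₀ : ℕ, p₀ + q₀ = 2 * r ∧
      ((p₀ : ℤ) - q₀ = p - q + 1 ∨ (p₀ : ℤ) - q₀ = p - q - 1) ∧
      ∃ (θ : Cl p₀ q₀ →ₐ[ℝ] Cl p q) (x : Cl p q), vol p q = θ (vol p₀ q₀) * x ∧
        ∀ a, gen p q a = x ∨ ∃ c, gen p q a = θ (gen p₀ q₀ c) := by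
  rcases q with _ | q
  · obtain ⟨p, rfl⟩ : ∃ p', p = p' + 1 := ⟨p - 1, by omega⟩
    let e : Fin p ⊕ Fin 0 → Fin (p + 1) ⊕ Fin 0 := Sum.map Fin.castSucc id
    have hx : IsGenerating sgn (gen (p + 1) 0 ∘ e) := by
      have := (isGenerating_gen (p + 1) 0).comp e
        (Sum.map_injective.2 ⟨Fin.castSucc_injective p, Function.injective_id⟩)
      rwa [show (sgn ∘ e : Fin p ⊕ Fin 0 → ℝ) = sgn by funext a; cases a <;> rfl] at this
    obtain ⟨θ, hθ⟩ : ∃ θ : Cl p 0 →ₐ[ℝ] Cl (p + 1) 0, ∀ a, θ (gen p 0 a) = gen (p + 1) 0 (e a) :=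
      ⟨clLift _ hx, clLift_gen _ hx⟩
    refine ⟨p, 0, by omega, Or.inr (by push_cast; ring), θ, gen _ _ (Sum.inl (Fin.last p)), ?_, ?_⟩
    · have hpos : θ ∘ ePos p 0 = fun i => ePos (p + 1) 0 i.castSucc := funext fun i => hθ (Sum.inl i)
      rw [vol, vol, List.ofFn_succ_last, List.prod_append, map_mul, map_list_prod, List.map_ofFn,
        hpos]
      simp [gen, ePos]
    · rintro (a | a)
      · induction a using Fin.lastCases with
        | last => exact Or.inl rfl
        | cast i => exact Or.inr ⟨Sum.inl i, (hθ (Sum.inl i)).symm⟩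
      · exact a.elim0
  · let e : Fin p ⊕ Fin q → Fin p ⊕ Fin (q + 1) := Sum.map id Fin.castSucc
    have hx : IsGenerating sgn (gen p (q + 1) ∘ e) := by
      have := (isGenerating_gen p (q + 1)).comp e
        (Sum.map_injective.2 ⟨Function.injective_id, Fin.castSucc_injective q⟩)
      rwa [show (sgn ∘ e : Fin p ⊕ Fin q → ℝ) = sgn by funext a; cases a <;> rfl] at this
    obtain ⟨θ, hθ⟩ : ∃ θ : Cl p q →ₐ[ℝ] Cl p (q + 1), ∀ a, θ (gen p q a) = gen p (q + 1) (e a) :=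
      ⟨clLift _ hx, clLift_gen _ hx⟩
    refine ⟨p, q, by omega, Or.inl (by push_cast; ring), θ, gen _ _ (Sum.inr (Fin.last q)), ?_, ?_⟩
    · have hpos : θ ∘ ePos p q = ePos p (q + 1) := funext fun i => hθ (Sum.inl i)
      have hneg : θ ∘ eNeg p q = fun i => eNeg p (q + 1) i.castSucc :=
        funext fun i => hθ (Sum.inr i)
      rw [vol, vol, List.ofFn_succ_last (f := eNeg p (q + 1)), List.prod_append, map_mul,
        map_list_prod, map_list_prod, List.map_ofFn, List.map_ofFn, hpos, hneg]
      simp [gen, eNeg, mul_assoc]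
    · rintro (a | a)
      · exact Or.inr ⟨Sum.inl a, (hθ (Sum.inl a)).symm⟩
      · induction a using Fin.lastCases with
        | last => exact Or.inl rfl
        | cast i => exact Or.inr ⟨Sum.inr i, (hθ (Sum.inr i)).symm⟩

/-- `Cl_{p,q} = B ⊕ ωB` for `p + q` odd. -/
theorem exists_odd_factors {p q r : ℕ} (h : p + q = 2 * r + 1) :
    ∃ (f : Factors r) (ψ : f.Alg →ₐ[ℝ] Cl p q),
      Function.Bijective (fun b : f.Alg × f.Alg => ψ b.1 + vol p q * ψ b.2) ∧
      (HasType p q 1 →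
        HasStructure 1 (undAction r) f.undReal ∧ HasStructure 1 (dotAction r) f.dotReal) ∧
      (HasType p q 5 →
        HasStructure (-1) (undAction r) f.undReal ∧ HasStructure (-1) (dotAction r) f.dotReal) := by
  obtain ⟨p₀, q₀, h₀, htype, θ, x, hvol, hgen⟩ := exists_remove_generator h
  obtain ⟨f, φ, h1, h4⟩ := exists_factors h₀
  refine ⟨f, θ.comp φ.symm.toAlgHom, ?_, fun hh => h1 ?_, fun hh => h4 ?_⟩
  · set ψ : f.Alg →ₐ[ℝ] Cl p q := θ.comp φ.symm.toAlgHom with hψ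
    have hψφ : ∀ c, ψ (φ c) = θ c := fun c => congrArg θ (φ.symm_apply_apply c)
    set ω := vol p q with hω
    have hωc : ∀ a, ω * a = a * ω := vol_central h
    let Ψ : f.Alg × f.Alg →ₗ[ℝ] Cl p q :=
      ψ.toLinearMap.coprod (LinearMap.mulLeft ℝ ω ∘ₗ ψ.toLinearMap)
    have hΨ : ∀ b b', Ψ (b, b') = ψ b + ω * ψ b' := fun _ _ => rfl
    have hmulψ : ∀ z ∈ LinearMap.range Ψ, ∀ y, z * ψ y ∈ LinearMap.range Ψ := by
      rintro _ ⟨⟨b, b'⟩, rfl⟩ y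
      exact ⟨(b * y, b' * y), by rw [hΨ, hΨ, map_mul, map_mul, add_mul, mul_assoc]⟩
    -- Multiplication by ω exchanges the two components, up to the sign ω² = ±1.
    have hmulω : ∀ z ∈ LinearMap.range Ψ, z * ω ∈ LinearMap.range Ψ := by
      rintro _ ⟨⟨b, b'⟩, rfl⟩
      refine ⟨((-1 : ℝ) ^ (r + q) • b', b), ?_⟩
      rw [hΨ, hΨ, ← hωc, mul_add, ← mul_assoc, hω, vol_sq_odd h, smul_mul_assoc, one_mul, map_smul,
        add_comm]
    have hsurj : Function.Surjective Ψ := fun c => by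
      refine cl_induction (LinearMap.range Ψ) ⟨(1, 0), by simp [hΨ]⟩ (fun b hb a => ?_) c
      rcases hgen a with ha | ⟨d, hd⟩
      -- The removed generator is recovered from vol = θ(vol₀) x by multiplying with θ(vol₀), whose
      -- square is ±1.
      · have hx : x = ((-1 : ℝ) ^ ((p₀ + q₀).choose 2 + q₀)) • (ψ (φ (vol p₀ q₀)) * ω) := by
          rw [hψφ, hvol, ← mul_assoc, ← map_mul, vol_sq, map_smul, map_one, smul_mul_assoc,
            one_mul, smul_smul, ← mul_pow]
          simp
        rw [ha, hx, mul_smul_comm, ← mul_assoc]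
        exact Submodule.smul_mem _ _ (hmulω _ (hmulψ _ hb _))
      · rw [hd, ← hψφ]
        exact hmulψ _ hb _
    refine bijective_of_surjective_of_finrank Ψ hsurj ?_
    rw [Module.finrank_prod, f.finrank_alg, finrank_Cl, h, pow_succ, pow_mul]
    norm_num; ring
  · simp only [HasType, Int.ModEq] at hh ⊢; omega
  · simp only [HasType, Int.ModEq] at hh ⊢; omega

/-- The homomorphism into a product with given components. -/
def prodRealHom {B A A' : Type} [Ring B] [Algebra ℝ B] [Ring A] [Algebra ℂ A] [Ring A']
    [Algebra ℂ A'] (j : RealHom B A) (j' : RealHom B A') : RealHom B (A × A') where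
  __ := j.toRingHom.prod j'.toRingHom
  commutes' c := Prod.ext (j.commutes c) (j'.commutes c)

theorem prodRealHom_apply {B A A' : Type} [Ring B] [Algebra ℝ B] [Ring A] [Algebra ℂ A] [Ring A']
    [Algebra ℂ A'] (j : RealHom B A) (j' : RealHom B A') (b : B) :
    prodRealHom j j' b = (j b, j' b) := rfl

/-- The first component of a homomorphism into a product. -/
def fstRealHom {B A A' : Type} [Ring B] [Algebra ℝ B] [Ring A] [Algebra ℂ A] [Ring A']
    [Algebra ℂ A'] (j : RealHom B (A × A')) : RealHom B A where
  __ := (RingHom.fst A A').comp j.toRingHom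
  commutes' c := congrArg Prod.fst (j.commutes c)

theorem HasStructure.sum {B C A A' V V' : Type} [Ring B] [Algebra ℝ B] [Ring C] [Algebra ℝ C]
    [Ring A] [Algebra ℂ A] [Ring A'] [Algebra ℂ A'] [AddCommGroup V] [Module ℂ V]
    [AddCommGroup V'] [Module ℂ V'] {ε : ℂ} {γ : A →ₐ[ℂ] Module.End ℂ V}
    {γ' : A' →ₐ[ℂ] Module.End ℂ V'} {j₁ : RealHom B A} {j₂ : RealHom B A'}
    (h₁ : HasStructure ε γ j₁) (h₂ : HasStructure ε γ' j₂) (j : RealHom C (A × A'))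
    (hj : ∀ c, ∃ b b', j c = (j₁ b, j₂ b')) : HasStructure ε (sumAction γ γ') j := by
  obtain ⟨J, hJ, hJb⟩ := h₁
  obtain ⟨J', hJ', hJb'⟩ := h₂
  refine ⟨{ toFun := fun v => (J v.1, J' v.2)
            map_add' := fun v w => by simp
            map_smul' := fun c v => by simp }, fun v => Prod.ext (hJ _) (hJ' _), fun c v => ?_⟩
  obtain ⟨b, b', hb⟩ := hj c
  rw [hb]
  exact Prod.ext (hJb b v.1) (hJb' b' v.2)

end OddSystem

/-! ### Splitting and embedding of B ⊕ ωB. -/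

section OddSystem

/-- `Cl_{p,q}` is `B ⊕ B` if `ω² = 1`. -/
theorem nonempty_algEquiv_prod {B C : Type} [Ring B] [Algebra ℝ B] [Ring C] [Algebra ℝ C]
    [FiniteDimensional ℝ B] {ψ : B →ₐ[ℝ] C} {ω : C} (hω : ∀ c, ω * c = c * ω) (hε : ω * ω = 1)
    (hbij : Function.Bijective fun b : B × B => ψ b.1 + ω * ψ b.2) :
    Nonempty (C ≃ₐ[ℝ] B × B) := by
  -- Sending ω to (1, -1) gives b + ωb' ↦ (b + b', b - b'), which is inverted by half sums and half
  -- differences.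
  obtain ⟨j, hj⟩ := exists_algHom_of_decomposition (ε := 1) hω (by rw [hε, one_smul]) hbij
    (AlgHom.prod (AlgHom.id ℝ B) (AlgHom.id ℝ B)) (1, -1) (fun b => by simp) (by simp)
  have hj' : ∀ b b', j (ψ b + ω * ψ b') = (b + b', b - b') := fun b b' => by
    rw [hj]; simp [sub_eq_add_neg]
  refine ⟨AlgEquiv.ofBijective j ⟨fun x y hxy => ?_, fun ⟨a, b⟩ => ?_⟩⟩
  · obtain ⟨⟨a, a'⟩, rfl⟩ := hbij.2 x
    obtain ⟨⟨b, b'⟩, rfl⟩ := hbij.2 y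
    dsimp only at hxy ⊢
    rw [hj', hj', Prod.mk.injEq] at hxy
    have h1 : (2 : ℝ) • a = (2 : ℝ) • b := by
      rw [two_smul, two_smul]
      calc a + a = (a + a') + (a - a') := by abel
        _ = (b + b') + (b - b') := by rw [hxy.1, hxy.2]
        _ = b + b := by abel
    have h2 : a = b := smul_right_injective B (two_ne_zero (α := ℝ)) h1
    subst h2
    rw [add_left_cancel hxy.1]
  · refine ⟨ψ ((1 / 2 : ℝ) • (a + b)) + ω * ψ ((1 / 2 : ℝ) • (a - b)), ?_⟩
    rw [hj', ← smul_add, ← smul_sub]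
    congr 1
    · rw [add_add_sub_cancel, ← two_smul ℝ a, smul_smul]; norm_num
    · rw [add_sub_sub_cancel, ← two_smul ℝ b, smul_smul]; norm_num

/-- The antilinear map `ℂ_2 ⊗ ⋯ ⊗ ℂ_2 → ℂ̄_2 ⊗ ⋯ ⊗ ℂ̄_2`. -/
def undToDot (r : ℕ) : Und r →ₛₗ[starRingEnd ℂ] Dot r :=
  powAnti fun _ =>
    { toFun := conjAlg C2
      map_add' := map_add _
      map_smul' := fun c a => by rw [smul_conjAlg, Complex.conj_conj] }

theorem undToDot_tprod {r : ℕ} (x : Fin r → C2) : undToDot r (PiTensorProduct.tprod ℂ x) =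
    PiTensorProduct.tprod ℂ fun i => conjAlg C2 (x i) := powAnti_tprod _ x

theorem undToDot_undHom {r : ℕ} (g : Spin13) : undToDot r (undHom r g) = dotHom r g :=
  undToDot_tprod _

theorem Factors.undToDot_undReal {r : ℕ} (f : Factors r) (b : f.Alg) :
    undToDot r (f.undReal b) = f.dotReal b := by
  induction b using PiTensorProduct.induction_on with
  | smul_tprod c x =>
    rw [map_smul, antilinear_smul_real, map_smul, f.undReal_tprod, f.dotReal_tprod]
    congr 1
    exact undToDot_tprod _
  | add x y hx hy => simp only [map_add, hx, hy]

/-- The real form of `A × A'` spanned by `B` and `ωB`, where `ω ↦ (c, -c)`. -/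
theorem isRealForm_of_decomposition {B C A A' : Type} [Ring B] [Algebra ℝ B] [Ring C]
    [Algebra ℝ C] [Ring A] [Algebra ℂ A] [Ring A'] [Algebra ℂ A'] [FiniteDimensional ℂ A]
    [FiniteDimensional ℂ A'] [FiniteDimensional ℝ C] {j₁ : RealHom B A} {j₂ : RealHom B A'}
    (h₁ : IsRealForm j₁) (h₂ : IsRealForm j₂) (j : RealHom C (A × A')) (c : ℂ) (hc : c ≠ 0)
    (h : ∀ b b', ∃ x, j x = (j₁ b + c • j₁ b', j₂ b - c • j₂ b'))
    (hd : Module.finrank ℝ C = Module.finrank ℂ A + Module.finrank ℂ A') : IsRealForm j := by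
  refine isRealForm_of_span j ?_ (by rw [hd, Module.finrank_prod])
  have hmem : ∀ b b', (j₁ b + c • j₁ b', j₂ b - c • j₂ b') ∈ Submodule.span ℂ (Set.range j) :=
    fun b b' => by
      obtain ⟨x, hx⟩ := h b b'
      exact Submodule.subset_span ⟨x, hx⟩
  have hl : ∀ a : A, (a, (0 : A')) ∈ Submodule.span ℂ (Set.range j) := by
    have : (⊤ : Submodule ℂ A) ≤ (Submodule.span ℂ (Set.range j)).comap (LinearMap.inl ℂ A A') := by
      rw [← h₁.span_eq_top, Submodule.span_le]
      rintro _ ⟨b, rfl⟩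
      -- Half the sum of the images of b and of c⁻¹ωb, which are (j₁b, j₂b) and (j₁b, -j₂b).
      have := Submodule.smul_mem _ (1 / 2 : ℂ)
        (add_mem (hmem b 0) (Submodule.smul_mem _ c⁻¹ (hmem 0 b)))
      simp only [map_zero, smul_zero, add_zero, sub_zero, zero_add, zero_sub, Prod.smul_mk,
        Prod.mk_add_mk, smul_neg, inv_smul_smul₀ hc, add_neg_cancel, ← two_smul ℂ (j₁ b),
        smul_smul] at this
      norm_num at this
      exact this
    exact fun a => this trivial
  have hr : ∀ a : A', ((0 : A), a) ∈ Submodule.span ℂ (Set.range j) := by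
    have : (⊤ : Submodule ℂ A') ≤
        (Submodule.span ℂ (Set.range j)).comap (LinearMap.inr ℂ A A') := by
      rw [← h₂.span_eq_top, Submodule.span_le]
      rintro _ ⟨b, rfl⟩
      have := Submodule.sub_mem _ (hmem b 0) (hl (j₁ b))
      simpa using this
    exact fun a => this trivial
  refine Submodule.eq_top_iff'.2 fun ⟨a, a'⟩ => ?_
  have := add_mem (hl a) (hr a')
  simpa using this

theorem nonempty_Und_algEquiv_matC (r : ℕ) : Nonempty (Und r ≃ₐ[ℂ] MatC r) :=
  ⟨(AlgEquiv.ofBijective (undAction r) (undAction_bijective r)).trans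
    (algEquivMatrix (Module.finBasisOfFinrankEq ℂ (S r) (finrank_S r)))⟩

/-- The homomorphism `Cl_{p,q} → ℂ_2^{⊗r} ⊕ ℂ̄_2^{⊗r}` that extends the embeddings of `B` and sends
the volume element to `(c, -c)`. -/
theorem exists_odd_embedding {p q r : ℕ} (h : p + q = 2 * r + 1) {f : Factors r}
    {ψ : f.Alg →ₐ[ℝ] Cl p q}
    (hbij : Function.Bijective fun b : f.Alg × f.Alg => ψ b.1 + vol p q * ψ b.2) {ε : ℝ}
    (hε : vol p q * vol p q = ε • 1) {c : ℂ} (hc : c ≠ 0) (hcε : c * c = ε) :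
    ∃ j : RealHom (Cl p q) (Und r × Dot r), IsRealForm j ∧
      ∀ b b', j (ψ b + vol p q * ψ b') =
        (f.undReal b + c • f.undReal b', f.dotReal b - c • f.dotReal b') := by
  obtain ⟨j, hj⟩ := exists_algHom_of_decomposition (vol_central h) hε hbij
    (prodRealHom f.undReal f.dotReal) (c • (1, -1)) (fun b => by
      rw [smul_mul_assoc, mul_smul_comm, prodRealHom_apply]; simp) (by
      rw [smul_mul_smul_comm, hcε, ← Complex.coe_smul]; simp; rfl)
  have hj' : ∀ b b', j (ψ b + vol p q * ψ b') =
      (f.undReal b + c • f.undReal b', f.dotReal b - c • f.dotReal b') := fun b b' => by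
    rw [hj, prodRealHom_apply, prodRealHom_apply, smul_mul_assoc]
    simp [sub_eq_add_neg]
  refine ⟨j, isRealForm_of_decomposition f.isRealForm_undReal f.isRealForm_dotReal j c hc
    (fun b b' => ⟨_, hj' b b'⟩) ?_, hj'⟩
  rw [finrank_Cl, finrank_Und, finrank_Dot, h, pow_succ, pow_mul]
  norm_num; ring

end OddSystem

/-! ### The two kinds of odd algebras. -/

section OddSystem

theorem vol_sq_of_type_one_five {p q r : ℕ} (h : p + q = 2 * r + 1)
    (hh : HasType p q 1 ∨ HasType p q 5) : vol p q * vol p q = 1 := by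
  have he : Even (r + q) := by
    simp only [HasType, Int.ModEq] at hh
    rw [Nat.even_iff]; omega
  rw [vol_sq_odd h, he.neg_one_pow, one_smul]

theorem vol_sq_of_type_three_seven {p q r : ℕ} (h : p + q = 2 * r + 1)
    (hh : HasType p q 3 ∨ HasType p q 7) : vol p q * vol p q = -1 := by
  have he : Odd (r + q) := by
    simp only [HasType, Int.ModEq] at hh
    rw [Nat.odd_iff]; omega
  rw [vol_sq_odd h, he.neg_one_pow, neg_one_smul]

theorem nonempty_algEquiv_of_prod {A B C : Type} [Ring A] [Algebra ℝ A] [Ring B] [Algebra ℝ B]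
    [Ring C] [Algebra ℝ C] (h : Nonempty (C ≃ₐ[ℝ] A × A)) (e : Nonempty (A ≃ₐ[ℝ] B)) :
    Nonempty (C ≃ₐ[ℝ] B × B) := by
  obtain ⟨h⟩ := h
  obtain ⟨e⟩ := e
  exact ⟨h.trans (AlgEquiv.prodCongr e e)⟩

/-- The algebras with one generator less are compared with B through their matrix forms: for both
choices of (p₀, q₀) the type is 0 or 2 when p - q ≡ 1, and 4 or 6 when p - q ≡ 5. -/
theorem odd_system_split {p q r : ℕ} (h : p + q = 2 * r + 1) {f : Factors r}
    (hC : Nonempty (Cl p q ≃ₐ[ℝ] f.Alg × f.Alg))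
    (hs1 : HasType p q 1 → HasStructure 1 (undAction r) f.undReal)
    (hs5 : HasType p q 5 → HasStructure (-1) (undAction r) f.undReal) :
    (HasType p q 1 → Nonempty (Cl p q ≃ₐ[ℝ] MatR r × MatR r)) ∧
    (HasType p q 5 → Nonempty (Cl p q ≃ₐ[ℝ] MatH r × MatH r)) ∧
    (HasType p q 1 ∨ HasType p q 5 →
      ∀ p₀ q₀ : ℕ, p₀ + q₀ = 2 * r →
        ((p₀ : ℤ) - q₀ = p - q + 1 ∨ (p₀ : ℤ) - q₀ = q - p + 1) →
        Nonempty (Cl p q ≃ₐ[ℝ] Cl p₀ q₀ × Cl p₀ q₀)) := by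
  have hR : HasType p q 1 → Nonempty (Cl p q ≃ₐ[ℝ] MatR r × MatR r) := fun h1 =>
    nonempty_algEquiv_of_prod hC (f.nonempty_matR (hs1 h1))
  have hH : HasType p q 5 → Nonempty (Cl p q ≃ₐ[ℝ] MatH r × MatH r) := fun h5 => by
    refine nonempty_algEquiv_of_prod hC (f.nonempty_matH ?_ (hs5 h5))
    simp only [HasType, Int.ModEq] at h5
    omega
  refine ⟨hR, hH, ?_⟩
  rintro (h1 | h5) p₀ q₀ h₀ ht
  · obtain ⟨e⟩ := nonempty_cl_matR h₀ (by simp only [HasType, Int.ModEq] at h1 ⊢; omega)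
    exact nonempty_algEquiv_of_prod (hR h1) ⟨e.symm⟩
  · obtain ⟨e⟩ := nonempty_cl_matH h₀ (by simp only [HasType, Int.ModEq] at h5 ⊢; omega)
    exact nonempty_algEquiv_of_prod (hH h5) ⟨e.symm⟩

/-- When ω plays the role of i, the image of B + ωB in `Und r` is the complex span of the real form
B, hence everything, and real dimensions agree. The second component is the antilinear conjugate of
the first, so it takes the right value on group elements automatically. -/
theorem odd_system_complex {p q r : ℕ} (h : p + q = 2 * r + 1) {f : Factors r}
    {ψ : f.Alg →ₐ[ℝ] Cl p q}
    (hbij : Function.Bijective fun b : f.Alg × f.Alg => ψ b.1 + vol p q * ψ b.2)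
    {j : RealHom (Cl p q) (Und r × Dot r)}
    (hj : ∀ b b', j (ψ b + vol p q * ψ b') =
      (f.undReal b + Complex.I • f.undReal b', f.dotReal b - Complex.I • f.dotReal b')) :
    Function.Bijective (fun a => (j a).1) ∧ Nonempty (Cl p q ≃ₐ[ℝ] MatC r) ∧
      ∃ u : Spin13 →* Cl p q, ∀ g, j (u g) = sumHom (undHom r) (dotHom r) g := by
  have hsurj : Function.Surjective (fstRealHom j) := fun a => by
    have ha : a ∈ Submodule.span ℂ (Set.range f.undReal) := by
      rw [f.isRealForm_undReal.span_eq_top]; trivial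
    suffices ∃ b b', f.undReal b + Complex.I • f.undReal b' = a by
      obtain ⟨b, b', hb⟩ := this
      exact ⟨ψ b + vol p q * ψ b', (congrArg Prod.fst (hj b b')).trans hb⟩
    induction ha using Submodule.span_induction with
    | mem x hx => obtain ⟨b, rfl⟩ := hx; exact ⟨b, 0, by simp⟩
    | zero => exact ⟨0, 0, by simp⟩
    | add x y _ _ hx hy =>
      obtain ⟨a, a', rfl⟩ := hx
      obtain ⟨b, b', rfl⟩ := hy
      exact ⟨a + b, a' + b', by rw [map_add, map_add, smul_add]; abel⟩
    | smul z x _ hx =>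
      obtain ⟨a, a', rfl⟩ := hx
      -- Complex multiplication of a + i a' by z.
      refine ⟨z.re • a - z.im • a', z.im • a + z.re • a', ?_⟩
      simp only [map_add, map_sub, map_smul, ← Complex.coe_smul, smul_add, smul_smul]
      conv_rhs => rw [← Complex.re_add_im z]
      match_scalars
      · ring
      · linear_combination (-z.im : ℂ) * Complex.I_mul_I
  have hk : Function.Bijective (fstRealHom j) := by
    have : FiniteDimensional ℝ (Und r) := Module.Finite.trans (R := ℝ) ℂ (Und r)
    refine bijective_of_surjective_of_finrank (fstRealHom j).toLinearMap hsurj ?_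
    rw [finrank_Cl, finrank_real_of_complex, finrank_Und, h, pow_succ, pow_mul]
    norm_num; ring
  refine ⟨hk, ?_, ?_⟩
  · obtain ⟨e⟩ := nonempty_Und_algEquiv_matC r
    refine ⟨AlgEquiv.ofRingEquiv (f := (RingEquiv.ofBijective (fstRealHom j) hk).trans
      e.toRingEquiv) fun c => ?_⟩
    change e (fstRealHom j (algebraMap ℝ _ c)) = _
    rw [AlgHom.commutes]
    exact e.commutes (c : ℂ)
  · have h2 : ∀ a, (j a).2 = undToDot r (j a).1 := fun a => by
      obtain ⟨⟨b, b'⟩, rfl⟩ := hbij.2 a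
      dsimp only
      rw [hj, map_add, map_smulₛₗ, Complex.conj_I, f.undToDot_undReal, f.undToDot_undReal, neg_smul,
        sub_eq_add_neg]
    refine ⟨((RingEquiv.ofBijective (fstRealHom j) hk).symm : Und r →* Cl p q).comp (undHom r),
      fun g => ?_⟩
    have h1 : (j ((RingEquiv.ofBijective (fstRealHom j) hk).symm (undHom r g))).1 = undHom r g :=
      (RingEquiv.ofBijective (fstRealHom j) hk).apply_symm_apply _
    refine Prod.ext h1 ?_
    refine (h2 _).trans ?_
    exact (congrArg (undToDot r) h1).trans (undToDot_undHom g)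

/-- The system `M⁻`. -/
theorem odd_system {p q r : ℕ} (h : p + q = 2 * r + 1) :
    ∃ (f : Factors r) (ψ : f.Alg →ₐ[ℝ] Cl p q) (j : RealHom (Cl p q) (Und r × Dot r)),
      Function.Bijective (fun b : f.Alg × f.Alg => ψ b.1 + vol p q * ψ b.2) ∧
      IsRealForm j ∧
      (∀ x, j (ψ (PiTensorProduct.tprod ℝ x)) = (f.und x, f.dot x)) ∧
      (HasType p q 1 ∨ HasType p q 5 →
        vol p q * vol p q = 1 ∧ j (vol p q) = (1, -1) ∧
        Nonempty (Cl p q ≃ₐ[ℝ] f.Alg × f.Alg) ∧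
        (∀ q', q = q' + 1 → Nonempty (Cl p q ≃ₐ[ℝ] Cl p q' × Cl p q')) ∧
        (∀ p', p = p' + 1 → Nonempty (Cl p q ≃ₐ[ℝ] Cl q p' × Cl q p'))) ∧
      (HasType p q 1 →
        Nonempty (Cl p q ≃ₐ[ℝ] MatR r × MatR r) ∧
        HasStructure 1 (sumAction (undAction r) (dotAction r)) j) ∧
      (HasType p q 5 →
        Nonempty (Cl p q ≃ₐ[ℝ] MatH r × MatH r) ∧
        HasStructure (-1) (sumAction (undAction r) (dotAction r)) j) ∧
      (HasType p q 3 ∨ HasType p q 7 →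
        vol p q * vol p q = -1 ∧ j (vol p q) = Complex.I • (1, -1) ∧
        Function.Bijective (fun a => (j a).1) ∧ Nonempty (Cl p q ≃ₐ[ℝ] MatC r) ∧
        ∃ u : Spin13 →* Cl p q, ∀ g, j (u g) = sumHom (undHom r) (dotHom r) g) := by
  obtain ⟨f, ψ, hbij, hs1, hs5⟩ := exists_odd_factors h
  have htprod : ∀ (j : RealHom (Cl p q) (Und r × Dot r)) (c : ℂ),
      (∀ b b', j (ψ b + vol p q * ψ b') =
        (f.undReal b + c • f.undReal b', f.dotReal b - c • f.dotReal b')) →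
      (∀ x, j (ψ (PiTensorProduct.tprod ℝ x)) = (f.und x, f.dot x)) ∧
        j (vol p q) = c • (1, -1) := fun j c hj =>
    ⟨fun x => by
      have := hj (PiTensorProduct.tprod ℝ x) 0
      simpa [f.undReal_tprod, f.dotReal_tprod] using this, by
      have := hj 0 1
      simpa using this⟩
  have htype : (HasType p q 1 ∨ HasType p q 5) ∨ HasType p q 3 ∨ HasType p q 7 := by
    simp only [HasType, Int.ModEq]; omega
  rcases htype with ht | ht
  · have hω := vol_sq_of_type_one_five h ht
    obtain ⟨j, hreal, hj⟩ := exists_odd_embedding h hbij (ε := 1) (by rw [hω, one_smul])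
      (one_ne_zero (α := ℂ)) (by simp)
    obtain ⟨hj1, hj2⟩ := htprod j 1 hj
    have hC := nonempty_algEquiv_prod (vol_central h) hω hbij
    obtain ⟨hR, hH, hCl⟩ := odd_system_split h hC (fun hh => (hs1 hh).1) fun hh => (hs5 hh).1
    have hcomp : ∀ a, ∃ b b', j a = (f.undReal b, f.dotReal b') := fun a => by
      obtain ⟨⟨b, b'⟩, rfl⟩ := hbij.2 a
      exact ⟨b + b', b - b', by dsimp only; rw [hj]; simp⟩
    refine ⟨f, ψ, j, hbij, hreal, hj1, fun _ => ⟨hω, by rw [hj2, one_smul], hC, ?_, ?_⟩,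
      fun h1 => ⟨hR h1, (hs1 h1).1.sum (hs1 h1).2 j hcomp⟩,
      fun h5 => ⟨hH h5, (hs5 h5).1.sum (hs5 h5).2 j hcomp⟩, fun h3 => ?_⟩
    · rintro q' rfl
      exact hCl ht p q' (by omega) (Or.inl (by push_cast; ring))
    · rintro p' rfl
      exact hCl ht q p' (by omega) (Or.inr (by push_cast; ring))
    · simp only [HasType, Int.ModEq] at ht h3
      omega
  · have hω := vol_sq_of_type_three_seven h ht
    obtain ⟨j, hreal, hj⟩ := exists_odd_embedding h hbij (ε := -1) (by rw [hω, neg_one_smul])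
      Complex.I_ne_zero (by simp)
    obtain ⟨hj1, hj2⟩ := htprod j Complex.I hj
    have hno : ¬ (HasType p q 1 ∨ HasType p q 5) := by
      simp only [HasType, Int.ModEq] at ht ⊢
      omega
    exact ⟨f, ψ, j, hbij, hreal, hj1, fun h' => (hno h').elim, fun h' => (hno (Or.inl h')).elim,
      fun h' => (hno (Or.inr h')).elim, fun _ => ⟨hω, hj2, odd_system_complex h hbij hj⟩⟩

end OddSystem

end SpinField

end

theorem theorem3 :
    -- the fields `(l, 0) ⊕ (0, l')` with `l = k/2`, `l' = r/2`
    (∀ k r : ℕ,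
      Function.Bijective (undAction k) ∧ Function.Bijective (dotAction r) ∧
      exponents (k / 2) (k / 2 + 1) = ((k : ℝ), (0 : ℝ)) ∧
      exponents (-(r / 2)) (r / 2 + 1) = ((0 : ℝ), -(r : ℝ)) ∧
      CarriesSumField (sumRep k r) ((symPow S2 k).prod (symPow (ConjMod S2) r))
          (k / 2) 0 (k / 2) (k / 2 + 1)
          0 (r / 2) (-(r / 2)) (r / 2 + 1)) ∧
    -- the tensor fields `(l', l'') ⊕ (l'', l')` with `l' = k/2`, `l'' = r/2`
    (∀ k r : ℕ,
      Function.Bijective (mixedAction k r) ∧ Function.Bijective (mixedAction' k r) ∧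
      exponents ((k - r) / 2) ((k + r) / 2 + 1) = ((k : ℝ), -(r : ℝ)) ∧
      exponents (-((k - r) / 2)) ((k + r) / 2 + 1) = ((r : ℝ), -(k : ℝ)) ∧
      CarriesSumField (mixedRep k r)
          ((symMixed S2 (ConjMod S2) k r).prod (symMixed (ConjMod S2) S2 k r))
          (k / 2) (r / 2) ((k - r) / 2) ((k + r) / 2 + 1)
          (r / 2) (k / 2) (-((k - r) / 2)) ((k + r) / 2 + 1)) ∧
    -- the system `M⁺`
    (∀ p q r : ℕ, p + q = 2 * r →
      (HasType p q 0 ∨ HasType p q 2 ∨ HasType p q 4 ∨ HasType p q 6) ∧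
      ∃ (f : Factors r) (φ : Cl p q ≃ₐ[ℝ] f.Alg) (j : RealHom (Cl p q) (Und r)),
        IsRealForm j ∧
        (∀ x, j (φ.symm (PiTensorProduct.tprod ℝ x)) = f.und x) ∧
        (HasType p q 0 ∨ HasType p q 2 →
          Nonempty (Cl p q ≃ₐ[ℝ] MatR r) ∧ HasStructure 1 (undAction r) j) ∧
        (HasType p q 4 ∨ HasType p q 6 →
          Nonempty (Cl p q ≃ₐ[ℝ] MatH r) ∧ HasStructure (-1) (undAction r) j) ∧
        ∃ l0 : ℝ, l0 = ((p : ℝ) + q) / 4 ∧ l0 = r / 2 ∧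
          CarriesField (repOf (undAction r) (undHom r)) (symPow S2 r) l0 0 l0 (l0 + 1)) ∧
    -- the system `M⁻`
    (∀ p q r : ℕ, p + q = 2 * r + 1 →
      (HasType p q 1 ∨ HasType p q 3 ∨ HasType p q 5 ∨ HasType p q 7) ∧
      (∀ a, vol p q * a = a * vol p q) ∧
      ∃ (f : Factors r) (ψ : f.Alg →ₐ[ℝ] Cl p q) (j : RealHom (Cl p q) (Und r × Dot r)),
        Function.Bijective (fun b : f.Alg × f.Alg => ψ b.1 + vol p q * ψ b.2) ∧
        IsRealForm j ∧
        (∀ x, j (ψ (PiTensorProduct.tprod ℝ x)) = (f.und x, f.dot x)) ∧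
        (HasType p q 1 ∨ HasType p q 5 →
          vol p q * vol p q = 1 ∧ j (vol p q) = (1, -1) ∧
          Nonempty (Cl p q ≃ₐ[ℝ] f.Alg × f.Alg) ∧
          (∀ q', q = q' + 1 → Nonempty (Cl p q ≃ₐ[ℝ] Cl p q' × Cl p q')) ∧
          (∀ p', p = p' + 1 → Nonempty (Cl p q ≃ₐ[ℝ] Cl q p' × Cl q p'))) ∧
        (HasType p q 1 →
          Nonempty (Cl p q ≃ₐ[ℝ] MatR r × MatR r) ∧
          HasStructure 1 (sumAction (undAction r) (dotAction r)) j) ∧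
        (HasType p q 5 →
          Nonempty (Cl p q ≃ₐ[ℝ] MatH r × MatH r) ∧
          HasStructure (-1) (sumAction (undAction r) (dotAction r)) j) ∧
        (HasType p q 3 ∨ HasType p q 7 →
          vol p q * vol p q = -1 ∧ j (vol p q) = Complex.I • (1, -1) ∧
          Function.Bijective (fun a => (j a).1) ∧ Nonempty (Cl p q ≃ₐ[ℝ] MatC r) ∧
          ∃ u : Spin13 →* Cl p q, ∀ g, j (u g) = sumHom (undHom r) (dotHom r) g) ∧
        ∃ l0 : ℝ, l0 = ((p : ℝ) + q - 1) / 4 ∧ l0 = r / 2 ∧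
          CarriesSumField (sumRep r r) ((symPow S2 r).prod (symPow (ConjMod S2) r))
            l0 0 l0 (l0 + 1) 0 l0 (-l0) (l0 + 1)) := by
  refine ⟨fun k r => ⟨undAction_bijective k, dotAction_bijective r, ?_, ?_,
      carriesSumField_sumRep k r⟩,
    fun k r => ⟨mixedAction_bijective k r, mixedAction'_bijective k r, ?_, ?_,
      carriesSumField_mixedRep k r⟩, fun p q r h => ⟨?_, ?_⟩,
    fun p q r h => ⟨?_, vol_central h, ?_⟩⟩
  · exact Prod.ext (by simp only [exponents]; ring) (by simp only [exponents]; ring)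
  · exact Prod.ext (by simp only [exponents]; ring) (by simp only [exponents]; ring)
  · exact Prod.ext (by simp only [exponents]; ring) (by simp only [exponents]; ring)
  · exact Prod.ext (by simp only [exponents]; ring) (by simp only [exponents]; ring)
  · simp only [HasType, Int.ModEq]; omega
  · obtain ⟨f, φ, j, hj⟩ := even_system h
    have hr : (r : ℝ) / 2 = ((p : ℝ) + q) / 4 := by
      have : (p : ℝ) + q = 2 * r := by exact_mod_cast h
      rw [this]; ring
    exact ⟨f, φ, j, hj.1, hj.2.1, hj.2.2.1, hj.2.2.2, r / 2, hr, rfl, carriesField_und r⟩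
  · simp only [HasType, Int.ModEq]; omega
  · obtain ⟨f, ψ, j, h1, h2, h3, h4, h5, h6, h7⟩ := odd_system h
    have hr : (r : ℝ) / 2 = ((p : ℝ) + q - 1) / 4 := by
      have : (p : ℝ) + q = 2 * r + 1 := by exact_mod_cast h
      rw [this]; ring
    exact ⟨f, ψ, j, h1, h2, h3, h4, h5, h6, h7, r / 2, hr, rfl, carriesSumField_sumRep r r⟩
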